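/- Let $\beta\in\mathbb{C}$ be one of the two non-real roots of $x^3-2x^2-1$ (so $|\beta|<1$), and identify $\mathbb{C}$ with $\mathbb{R}^2$. There is exactly one triple $(\Omega_A,\Omega_B,\Omega_C)$ of non-empty compact subsets of $\mathbb{C}$ that solves the iterated function system $$\Omega_A=\beta\,\Omega_A\cup\beta\,\Omega_B,\qquad \Omega_B=(\beta\,\Omega_A+\beta^2-\beta)\cup(\beta\,\Omega_B+\beta^2-\beta)\cup\beta\,\Omega_C,\qquad \Omega_C=\beta\,\Omega_A+\beta^2.$$ Put $\Omega=\Omega_A\cup\Omega_B\cup\Omega_C$. Then: (1) $\Omega$ is compact, homeomorphic to the closed unit disc, and has positive area (Lebesgue measure). (2) The boundary $\partial\Omega$ is a fractal (its Hausdorff dimension is strictly larger than its topological, i.e. Lebesgue covering, dimension), it has Lebesgue measure zero, and it is non-self-intersecting, i.e. it is the image of the unit circle under a continuous injective map into $\mathbb{C}$. (3) $\Omega$ tiles the plane by the lattice $L=\mathbb{Z}(1-\beta)+\mathbb{Z}(\beta^2-2\beta)$: the vectors $1-\beta$ and $\beta^2-2\beta$ are linearly independent over $\mathbb{R}$, the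 translates $t+\Omega$ with $t\in L$ cover $\mathbb{C}$, and distinct translates have disjoint interiors. -/

import Mathlib

open scoped ENNReal

/-- `(A, B, C)` is a solution, in non-empty compact subsets of the plane, of the iterated function
system
`A = β A ∪ β B`, `B = (β A + β² - β) ∪ (β B + β² - β) ∪ β C`, `C = β A + β²`. -/
structure IsWindowSystem (β : ℂ) (A B C : Set ℂ) : Prop where
  nonempty_A : A.Nonempty
  nonempty_B : B.Nonempty
  nonempty_C : C.Nonempty
  compact_A : IsCompact A
  compact_B : IsCompact B
  compact_C : IsCompact C
  eq_A : A = (fun z => β * z) '' A ∪ (fun z => β * z) '' B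
  eq_B : B = (fun z => β * z + β ^ 2 - β) '' A ∪ (fun z => β * z + β ^ 2 - β) '' B ∪
    (fun z => β * z) '' C
  eq_C : C = (fun z => β * z + β ^ 2) '' A

/-- The Lebesgue covering dimension of `X` is at most `n`: every finite open cover of `X` has an
open shrinking in which each point lies in at most `n + 1` members. -/
def CoveringDimLE (X : Type*) [TopologicalSpace X] (n : ℕ) : Prop :=
  ∀ (k : ℕ) (U : Fin k → Set X), (∀ i, IsOpen (U i)) → ⋃ i, U i = Set.univ →
    ∃ V : Fin k → Set X, (∀ i, IsOpen (V i)) ∧ (∀ i, V i ⊆ U i) ∧ ⋃ i, V i = Set.univ ∧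
      ∀ x, {i | x ∈ V i}.ncard ≤ n + 1

/-- A fractal in the sense of Mandelbrot: the Hausdorff dimension of `S` strictly exceeds its
topological (covering) dimension. -/
def IsFractal (S : Set ℂ) : Prop :=
  ∃ n : ℕ, CoveringDimLE S n ∧ (n : ℝ≥0∞) < dimH S

/-- `S` is a closed curve without self-intersections: the image of the unit circle under a
continuous injective map. -/
def IsSimpleClosedCurve (S : Set ℂ) : Prop :=
  ∃ γ : Circle → ℂ, Continuous γ ∧ Function.Injective γ ∧ Set.range γ = S

/-- The translates of `T` by the lattice `ℤ u + ℤ v` tile the plane: `u` and `v` are linearly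
independent over `ℝ`, the translates cover the plane, and distinct translates have disjoint
interiors. -/
structure IsLatticeTiling (T : Set ℂ) (u v : ℂ) : Prop where
  linearIndependent : LinearIndependent ℝ ![u, v]
  covers : ∀ z : ℂ, ∃ t ∈ Submodule.span ℤ {u, v}, z ∈ (fun w => t + w) '' T
  disjoint_interiors : ∀ s ∈ Submodule.span ℤ {u, v}, ∀ t ∈ Submodule.span ℤ {u, v}, s ≠ t →
    Disjoint (interior ((fun w => s + w) '' T)) (interior ((fun w => t + w) '' T))

/-! ### The non-real roots of `x³ - 2x² - 1` -/

namespace WindowRoot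

variable {β : ℂ}

/-! Eliminating Ω_B and Ω_C leaves one attractor. Up to a translation, Ω_A is the tile D with D =
(βD − (1+β²)/2) ∪ (βD + (1+β²)/2) ∪ β³D, and Ω + 1/2 is β⁻² times the union of the first and the
third piece (`IsWindowSystem.eq_A'`, `IsTile.union_eq`). Everything rests on a good parametrization
of D.

The subdivision of D into a left, a right and a middle piece has a piecewise linear model on the
square [-9, 9]², whose three pieces meet only along their boundaries. A self-similar arc `q`
describes the sides of D, and the contraction principle gives a continuous `h` on the square that
conjugates the model maps to the similarities of D (`exists_selfSimilar`, `exists_isArc`,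
`exists_isTile`).

Injectivity is a neighbour-graph argument (`IsTile.Rels.step`). If h p = h p' + t for one of
finitely many short vectors t, passing to the preimages of p and p' under the pieces gives a
relation of the same kind, because all other vectors are too long for a set of radius 0.7. The model
maps contract, so the pair is ever closer to a pair with the expected position, and in the limit it
is one. Hence h p − h p' lies in ℤ + ℤβ only for the expected pairs, and `h` extends to an injective
map of the plane at bounded distance from a linear map. Such a map is a homeomorphism P
(`IsTile.exists_plane`).

The left and the middle piece of the model form a convex polygon, and an affine map after P carries
it to Ω; this gives the disc, the simple closed boundary curve and the positive area. The boundary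
lies in finitely many similar copies of the arc. These are null since |β|⁶ + 2|β|⁴ < 1. The
dimension exceeds 1 because the parameter factors 4/9 and 1/9 of the arc are at most the 1.02-th
powers of its spatial factors |β|² and |β|³.

For the tiling, multiplication by β² turns the lattice into ℤβ + ℤ(1+β²). Translation by β stacks
the windows into a column, and translation by 1+β² moves the left boundary line of the column to its
right one (`IsTile.exists_line`). So the translated columns fill the plane without overlap. -/

theorem im_sq (hβ : β ^ 3 - 2 * β ^ 2 - 1 = 0) (hi : β.im ≠ 0) :
    β.im ^ 2 = 3 * β.re ^ 2 - 4 * β.re := by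
  have h := congrArg Complex.im hβ
  simp [pow_succ, Complex.mul_re, Complex.mul_im] at h
  have : β.im * (3 * β.re ^ 2 - 4 * β.re - β.im ^ 2) = 0 := by linear_combination h
  rcases mul_eq_zero.1 this with h0 | h0
  · exact absurd h0 hi
  · linarith

theorem re_cubic (hβ : β ^ 3 - 2 * β ^ 2 - 1 = 0) (hi : β.im ≠ 0) :
    8 * β.re ^ 3 = 16 * β.re ^ 2 - 8 * β.re - 1 := by
  have h := congrArg Complex.re hβ
  simp [pow_succ, Complex.mul_re, Complex.mul_im] at h
  have h2 := im_sq hβ hi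
  linear_combination (-1) * h + (2 - 3 * β.re) * h2

/-- Together with `normSq_bounds`, this box is all the numerical information on β that the exclusion
of long vectors uses. -/
theorem re_bounds (hβ : β ^ 3 - 2 * β ^ 2 - 1 = 0) (hi : β.im ≠ 0) :
    -0.1028 < β.re ∧ β.re < -0.10275 := by
  have h := re_cubic hβ hi
  have h2 : 0 < 3 * β.re ^ 2 - 4 * β.re := by
    rw [← im_sq hβ hi]; positivity
  set x := β.re
  have hneg : x < 0 := by
    by_contra hx
    push Not at hx
    nlinarith [mul_nonneg hx (sq_nonneg (x - 1))]
  constructor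
  · by_contra hx
    push Not at hx
    nlinarith [sq_nonneg x, mul_nonneg (sq_nonneg x) (by linarith : 0 ≤ -0.1028 - x)]
  · by_contra hx
    push Not at hx
    nlinarith [mul_nonneg (sq_nonneg x) (by linarith : 0 ≤ x + 0.10275),
      mul_nonneg (by linarith : 0 ≤ -x) (by linarith : 0 ≤ x + 0.10275)]

theorem normSq_eq (hβ : β ^ 3 - 2 * β ^ 2 - 1 = 0) (hi : β.im ≠ 0) :
    ‖β‖ ^ 2 = 4 * β.re ^ 2 - 4 * β.re := by
  rw [← Complex.normSq_eq_norm_sq, Complex.normSq_apply]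
  linear_combination im_sq hβ hi

theorem normSq_bounds (hβ : β ^ 3 - 2 * β ^ 2 - 1 = 0) (hi : β.im ≠ 0) :
    0.453 < ‖β‖ ^ 2 ∧ ‖β‖ ^ 2 < 0.4535 := by
  rw [normSq_eq hβ hi]
  obtain ⟨h1, h2⟩ := re_bounds hβ hi
  constructor <;> nlinarith

theorem norm_bounds (hβ : β ^ 3 - 2 * β ^ 2 - 1 = 0) (hi : β.im ≠ 0) :
    0.673 < ‖β‖ ∧ ‖β‖ < 0.6735 := by
  obtain ⟨h1, h2⟩ := normSq_bounds hβ hi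
  have := norm_nonneg β
  constructor <;> nlinarith

theorem norm_lt_one (hβ : β ^ 3 - 2 * β ^ 2 - 1 = 0) (hi : β.im ≠ 0) : ‖β‖ < 1 := by
  have := (norm_bounds hβ hi).2
  linarith

theorem ne_zero (hβ : β ^ 3 - 2 * β ^ 2 - 1 = 0) : β ≠ 0 := by
  rintro rfl
  norm_num at hβ

/-- The squared norm of an element of `ℚ(β)`. -/
theorem normSq_quad (hβ : β ^ 3 - 2 * β ^ 2 - 1 = 0) (hi : β.im ≠ 0) (c₀ c₁ c₂ : ℝ) :
    ‖(c₀ + c₁ * β + c₂ * β ^ 2 : ℂ)‖ ^ 2 =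
      c₀ ^ 2 + c₁ ^ 2 * ‖β‖ ^ 2 - 2 * c₂ ^ 2 * β.re + 2 * c₀ * c₁ * β.re
        + c₀ * c₂ * (4 * β.re - ‖β‖ ^ 2) + c₁ * c₂ * (2 * ‖β‖ ^ 2 - 1) := by
  -- The cubic gives |β|⁴ = −2 Re β, 2 Re β² = 4 Re β − |β|² and 2|β|² Re β = 2|β|² − 1. So the
  -- result is affine in Re β and |β|², and a lower bound over the numerical box is linear
  -- arithmetic.
  rw [normSq_eq hβ hi, ← Complex.normSq_eq_norm_sq, Complex.normSq_apply]
  have h1 := im_sq hβ hi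
  have h2 := re_cubic hβ hi
  simp [pow_succ, Complex.mul_re, Complex.mul_im]
  linear_combination (2*c₀*c₂*(-1) + 2 * c₁ * c₂ * β.re + c₁ ^ 2 + c₂ ^ 2 * (2 * β.re ^ 2 + β.im ^ 2
    + 3 * β.re ^ 2 - 4 * β.re)) * h1 + (c₁ * c₂ + c₂ ^ 2 * (2 * β.re - 0)) * h2

/-- Elements of `ℚ(β)` whose norm exceeds a given bound. -/
theorem not_norm_le (hβ : β ^ 3 - 2 * β ^ 2 - 1 = 0) (hi : β.im ≠ 0) {t : ℂ} (c₀ c₁ c₂ : ℝ)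
    (ht : t = c₀ + c₁ * β + c₂ * β ^ 2) {R : ℝ} (hR : ‖t‖ ≤ R)
    (hlow : ∀ x n : ℝ, -0.1028 < x → x < -0.10275 → 0.453 < n → n < 0.4535 →
      R ^ 2 < c₀ ^ 2 + c₁ ^ 2 * n - 2 * c₂ ^ 2 * x + 2 * c₀ * c₁ * x
        + c₀ * c₂ * (4 * x - n) + c₁ * c₂ * (2 * n - 1)) : False := by
  have h1 := hlow _ _ (re_bounds hβ hi).1 (re_bounds hβ hi).2 (normSq_bounds hβ hi).1
    (normSq_bounds hβ hi).2
  rw [← normSq_quad hβ hi, ← ht] at h1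
  have := norm_nonneg t
  nlinarith

theorem linearIndependent_coords (hi : β.im ≠ 0) {a b : ℝ} (h : (a : ℂ) + b * β = 0) :
    a = 0 ∧ b = 0 := by
  have h1 := congrArg Complex.im h
  have h2 := congrArg Complex.re h
  simp at h1 h2
  have : b = 0 := h1.resolve_right hi
  subst this
  simpa using h2

end WindowRoot

/-! ### Lipschitz estimates from a finite closed cover -/

open Set Filter Topology in
theorem abs_sub_le_of_finite_closed_cover {ι : Type*} [Finite ι] {ψ : ℝ → ℝ} (hψ : Continuous ψ)
    {C : ι → Set ℝ} (hC : ∀ i, IsClosed (C i)) (hcov : ∀ t, ∃ i, t ∈ C i) {K : ℝ}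
    (hK : ∀ i, ∀ s ∈ C i, ∀ t ∈ C i, |ψ s - ψ t| ≤ K * |s - t|) : |ψ 1 - ψ 0| ≤ K := by
  refine le_of_forall_gt_imp_ge_of_dense fun K' hK' => ?_
  have key := image_norm_le_of_liminf_right_slope_norm_lt_deriv_boundary (a := 0) (b := 1)
    (f := fun t => ψ t - ψ 0) (f' := fun _ => K) (B := fun t => K' * t) (B' := fun _ => K')
    (by fun_prop) ?_ (by simp) (by fun_prop) ?_ (fun _ _ _ => hK') (right_mem_Icc.2 zero_le_one)
  · simpa using key
  · intro x _ r hr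
    -- One of the finitely many pieces meets every right neighbourhood of x. Being closed, it
    -- contains x, so right slopes at x are bounded by K along points of that piece, which is all
    -- the mean value inequality needs.
    have hfr : ∃ i, ∃ᶠ z in 𝓝[>] x, z ∈ C i := by
      by_contra hcon
      push Not at hcon
      have : ∀ᶠ z in 𝓝[>] x, ∀ i, z ∉ C i := eventually_all.2 hcon
      obtain ⟨z, hz⟩ := this.exists
      obtain ⟨i, hi⟩ := hcov z
      exact hz i hi
    obtain ⟨i, hi⟩ := hfr
    have hx : x ∈ C i := by
      refine (hC i).mem_of_frequently_of_tendsto hi ?_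
      exact tendsto_nhdsWithin_of_tendsto_nhds tendsto_id
    refine (hi.and_eventually self_mem_nhdsWithin).mono fun z hz => ?_
    obtain ⟨hz, hxz⟩ := hz
    have hxz' : 0 < z - x := sub_pos.2 hxz
    have h1 := hK i z hz x hx
    rw [abs_of_pos hxz'] at h1
    have h2 : |ψ z - ψ 0| - |ψ x - ψ 0| ≤ K * (z - x) :=
      ((abs_sub_abs_le_abs_sub _ _).trans (by simpa using h1))
    rw [slope_def_field, div_lt_iff₀ hxz']
    simp only [Function.comp, Real.norm_eq_abs]
    nlinarith
  · intro x _
    simpa using ((hasDerivAt_id x).const_mul K').hasDerivWithinAt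

/-! ### The piecewise linear model of the subdivision -/

namespace Model

/-- The model tile, a square. -/
def Sq : Set ℂ := {p | (-9 ≤ p.re ∧ p.re ≤ 9) ∧ -9 ≤ p.im ∧ p.im ≤ 9}

/-- The sectors around `-1` on which `gm` is affine. -/
def cone : Fin 6 → Set ℂ
  | 0 => {p | p.re + 1 ≤ 0 ∧ 8 * p.im ≤ 9 * (p.re + 1)}
  | 1 => {p | 0 ≤ p.re + 1 ∧ 9 * (p.re + 1) ≤ -2 * p.im}
  | 2 => {p | -2 * p.im ≤ 9 * (p.re + 1) ∧ 9 * (p.re + 1) ≤ -10 * p.im}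
  | 3 => {p | -10 * p.im ≤ 9 * (p.re + 1) ∧ 10 * p.im ≤ 9 * (p.re + 1)}
  | 4 => {p | 9 * (p.re + 1) ≤ 10 * p.im ∧ -8 * p.im ≤ 9 * (p.re + 1)}
  | 5 => {p | 9 * (p.re + 1) ≤ -8 * p.im ∧ 9 * (p.re + 1) ≤ 8 * p.im}

/-- The affine pieces of `gm`. -/
noncomputable def piece : Fin 6 → ℂ → ℂ
  | 0 => fun p => ⟨-4 - p.im / 3, 3 + 15 * (p.re + 1) / 8 - p.im / 3⟩
  | 1 => fun p => ⟨-4 + (p.re + 1) - p.im / 3, 3 + 3 * (p.re + 1) / 2 - p.im / 3⟩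
  | 2 => fun p => ⟨-4 - (p.re + 1) / 4 - 11 * p.im / 18, 3 - 2 * p.im / 3⟩
  | 3 => fun p => ⟨-4 - (p.re + 1) / 10 - 4 * p.im / 9, 3 + 3 * (p.re + 1) / 5⟩
  | 4 => fun p => ⟨-4 - 5 * p.im / 9, 3 + (p.re + 1) - 4 * p.im / 9⟩
  | 5 => fun p => ⟨-4 + (p.re + 1) / 8 - 4 * p.im / 9, 3 + 3 * (p.re + 1) / 2⟩

theorem exists_cone (p : ℂ) : ∃ i, p ∈ cone i := by
  rcases le_total (p.re + 1) 0 with h | h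
  · rcases le_total (8 * p.im) (9 * (p.re + 1)) with h1 | h1
    · exact ⟨0, h, h1⟩
    · rcases le_total (9 * (p.re + 1)) (-8 * p.im) with h2 | h2
      · exact ⟨5, h2, h1⟩
      · exact ⟨4, by linarith, h2⟩
  · rcases le_total (9 * (p.re + 1)) (-2 * p.im) with h1 | h1
    · exact ⟨1, h, h1⟩
    · rcases le_total (9 * (p.re + 1)) (-10 * p.im) with h2 | h2
      · exact ⟨2, h1, h2⟩
      · rcases le_total (10 * p.im) (9 * (p.re + 1)) with h3 | h3
        · exact ⟨3, h2, h3⟩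
        · exact ⟨4, h3, by linarith⟩

/-- All pieces send −1 to −4 + 3i, and neighbouring ones agree along their common ray. So the choice
in `gm` is immaterial, and `gm` is continuous. -/
theorem piece_eq_piece {i j : Fin 6} {p : ℂ} (hi : p ∈ cone i) (hj : p ∈ cone j) :
    piece i p = piece j p := by
  fin_cases i <;> fin_cases j <;> obtain ⟨h1, h2⟩ := hi <;> obtain ⟨h3, h4⟩ := hj <;>
    simp only [piece] <;> apply Complex.ext <;> dsimp only <;> linarith

/-- The model of the contraction `z ↦ β z - (1 + β²) / 2`: a piecewise linear map which folds the
square onto the part of it to the left of the broken line through `-1 - 9i`, `-1 + 6i`, `1 + 9i`. -/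
noncomputable def gm (p : ℂ) : ℂ := piece (exists_cone p).choose p

theorem gm_eq {i : Fin 6} {p : ℂ} (hi : p ∈ cone i) : gm p = piece i p :=
  piece_eq_piece (exists_cone p).choose_spec hi

/-- The model of `z ↦ β z + (1 + β²) / 2`. -/
noncomputable def gp (p : ℂ) : ℂ := -gm (-p)

/-- The model of `z ↦ β³ z`. -/
noncomputable def gz (p : ℂ) : ℂ := ⟨p.im / 9, -5 * p.re / 6 + p.im / 6⟩

theorem gm_neg (p : ℂ) : gm (-p) = -gp p := by simp [gp]

theorem gp_neg (p : ℂ) : gp (-p) = -gm p := by simp [gp]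

theorem gz_neg (p : ℂ) : gz (-p) = -gz p := by
  apply Complex.ext <;> simp [gz] <;> ring

theorem neg_mem_Sq {p : ℂ} (hp : p ∈ Sq) : -p ∈ Sq := by
  obtain ⟨⟨h1, h2⟩, h3, h4⟩ := hp
  exact ⟨⟨by simp; linarith, by simp; linarith⟩, by simp; linarith, by simp; linarith⟩

theorem isClosed_cone (i : Fin 6) : IsClosed (cone i) := by
  have hr := Complex.continuous_re
  have hi := Complex.continuous_im
  fin_cases i <;> simp only [cone, Set.ofPred_and] <;> refine IsClosed.inter ?_ ?_ <;>
    exact isClosed_le (by fun_prop) (by fun_prop)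

theorem continuous_mk {X : Type*} [TopologicalSpace X] {a b : X → ℝ} (ha : Continuous a)
    (hb : Continuous b) : Continuous fun x => (⟨a x, b x⟩ : ℂ) := by
  have : (fun x => (⟨a x, b x⟩ : ℂ)) = fun x => (a x : ℂ) + b x * Complex.I := by
    funext x
    apply Complex.ext <;> simp
  rw [this]
  fun_prop

theorem continuous_piece (i : Fin 6) : Continuous (piece i) := by
  have hr := Complex.continuous_re
  have hi := Complex.continuous_im
  fin_cases i <;> exact continuous_mk (by fun_prop) (by fun_prop)

theorem continuous_gm : Continuous gm := by
  refine LocallyFinite.continuous (f := cone) (locallyFinite_of_finite _) ?_ isClosed_cone ?_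
  · exact Set.iUnion_eq_univ_iff.2 exists_cone
  · exact fun i => (continuous_piece i).continuousOn.congr fun p hp => gm_eq hp

theorem continuous_gp : Continuous gp := (continuous_gm.comp continuous_neg).neg

theorem continuous_gz : Continuous gz := by
  have hr := Complex.continuous_re
  have hi := Complex.continuous_im
  exact continuous_mk (by fun_prop) (by fun_prop)

/-! #### Contraction -/

/-- A norm on the plane for which the model maps are contractions. -/
def nrm (v : ℂ) : ℝ := max |4 * v.re + 11 * v.im| |-21 * v.re + 5 * v.im|

theorem nrm_le_iff {v : ℂ} {r : ℝ} : nrm v ≤ r ↔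
    (-r ≤ 4 * v.re + 11 * v.im ∧ 4 * v.re + 11 * v.im ≤ r) ∧
      (-r ≤ -21 * v.re + 5 * v.im ∧ -21 * v.re + 5 * v.im ≤ r) := by
  simp only [nrm, max_le_iff, abs_le]

theorem nrm_neg (v : ℂ) : nrm (-v) = nrm v := by
  simp only [nrm, Complex.neg_re, Complex.neg_im]
  rw [← abs_neg (4 * _ + _), ← abs_neg (-21 * _ + _)]
  ring_nf

theorem nrm_nonneg (v : ℂ) : 0 ≤ nrm v := (abs_nonneg _).trans (le_max_left _ _)

/-- The unit ball of `nrm` is a parallelogram that all six linear parts shrink simultaneously; each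
inequality is a linear combination of the four that define the ball. -/
theorem piece_sub_le (i : Fin 6) (v w : ℂ) :
    nrm (piece i v - piece i w) ≤ 0.992 * nrm (v - w) := by
  obtain ⟨⟨h1, h2⟩, h3, h4⟩ := nrm_le_iff.1 (le_refl (nrm (v - w)))
  simp only [Complex.sub_re, Complex.sub_im] at h1 h2 h3 h4
  rw [nrm_le_iff]
  fin_cases i <;> simp only [piece, Complex.sub_re, Complex.sub_im] <;>
    refine ⟨⟨?_, ?_⟩, ?_, ?_⟩ <;> linarith

/-- The pieces contract with a common factor, so `gm` does too: restrict each of the two forms that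
define `nrm` to the segment from w to v, which the cones cut into finitely many closed parts. -/
theorem gm_sub_le (v w : ℂ) : nrm (gm v - gm w) ≤ 0.992 * nrm (v - w) := by
  have hline : Continuous fun t : ℝ => w + t * (v - w) := by fun_prop
  have main : ∀ a b : ℝ, (∀ z : ℂ, |a * z.re + b * z.im| ≤ nrm z) →
      |a * (gm v - gm w).re + b * (gm v - gm w).im| ≤ 0.992 * nrm (v - w) := by
    intro a b hab
    have key := abs_sub_le_of_finite_closed_cover
      (ψ := fun t : ℝ => a * (gm (w + t * (v - w))).re + b * (gm (w + t * (v - w))).im)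
      (C := fun i => (fun t : ℝ => w + t * (v - w)) ⁻¹' cone i) (K := 0.992 * nrm (v - w)) ?_
      (fun i => (isClosed_cone i).preimage hline) (fun t => exists_cone _) ?_
    · simp only [Complex.ofReal_one, one_mul, Complex.ofReal_zero, zero_mul, add_zero,
        add_sub_cancel] at key
      convert key using 2
      simp only [Complex.sub_re, Complex.sub_im]; ring
    · have := continuous_gm.comp hline
      exact (continuous_const.mul (Complex.continuous_re.comp this)).add
        (continuous_const.mul (Complex.continuous_im.comp this))
    · intro i s hs t ht
      simp only [Set.mem_preimage] at hs ht
      rw [gm_eq hs, gm_eq ht]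
      have h1 := (hab _).trans (piece_sub_le i (w + s * (v - w)) (w + t * (v - w)))
      have h2 : nrm (w + s * (v - w) - (w + t * (v - w))) = |s - t| * nrm (v - w) := by
        simp only [nrm]
        rw [mul_max_of_nonneg _ _ (abs_nonneg _), ← abs_mul, ← abs_mul]
        congr 2 <;> simp <;> ring
      rw [h2] at h1
      refine le_trans (le_of_eq ?_) (h1.trans (le_of_eq (by ring)))
      simp only [Complex.sub_re, Complex.sub_im]
      ring_nf
  exact max_le (main 4 11 fun z => le_max_left _ _) (main (-21) 5 fun z => le_max_right _ _)

theorem gp_sub_le (v w : ℂ) : nrm (gp v - gp w) ≤ 0.992 * nrm (v - w) := by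
  have := gm_sub_le (-v) (-w)
  rwa [gm_neg, gm_neg, ← nrm_neg, ← nrm_neg (-v - -w), show -(-gp v - -gp w) = gp v - gp w by ring,
    show -(-v - -w) = v - w by ring] at this

theorem gz_sub_le (v w : ℂ) : nrm (gz v - gz w) ≤ 0.992 * nrm (v - w) := by
  obtain ⟨⟨h1, h2⟩, h3, h4⟩ := nrm_le_iff.1 (le_refl (nrm (v - w)))
  simp only [Complex.sub_re, Complex.sub_im] at h1 h2 h3 h4
  rw [nrm_le_iff]
  simp only [gz, Complex.sub_re, Complex.sub_im]
  refine ⟨⟨?_, ?_⟩, ?_, ?_⟩ <;> linarith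

/-! #### Values on the boundary of the square -/

theorem gm_top (u : ℝ) (h1 : -9 ≤ u) (h2 : u ≤ 9) : gm ⟨u, 9⟩ = ⟨-9, u⟩ := by
  rw [gm_eq (i := 4) ⟨by simp; linarith, by simp; linarith⟩]
  apply Complex.ext <;> simp [piece] <;> ring

theorem gm_left (y : ℝ) (h1 : -9 ≤ y) (h2 : y ≤ 9) : gm ⟨-9, y⟩ = ⟨-5 - 4 * y / 9, -9⟩ := by
  rw [gm_eq (i := 5) ⟨by norm_num; linarith, by norm_num; linarith⟩]
  apply Complex.ext <;> simp [piece] <;> ring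

theorem gm_right (y : ℝ) (h1 : -9 ≤ y) (h2 : y ≤ 9) : gm ⟨9, y⟩ = ⟨-5 - 4 * y / 9, 9⟩ := by
  rw [gm_eq (i := 3) ⟨by norm_num; linarith, by norm_num; linarith⟩]
  apply Complex.ext <;> simp [piece] <;> ring

theorem gm_bot₁ (u : ℝ) (h1 : -9 ≤ u) (h2 : u ≤ -1) :
    gm ⟨u, -9⟩ = ⟨-1, -9 + 15 * (u + 9) / 8⟩ := by
  rw [gm_eq (i := 0) ⟨by norm_num; linarith, by norm_num; linarith⟩]
  apply Complex.ext <;> simp [piece] <;> ring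

theorem gm_bot₂ (u : ℝ) (h1 : -1 ≤ u) (h2 : u ≤ 1) : gm ⟨u, -9⟩ = ⟨u, (3 * u + 15) / 2⟩ := by
  rw [gm_eq (i := 1) ⟨by norm_num; linarith, by norm_num; linarith⟩]
  apply Complex.ext <;> simp [piece] <;> ring

theorem gm_bot₃ (u : ℝ) (h1 : 1 ≤ u) (h2 : u ≤ 9) : gm ⟨u, -9⟩ = ⟨1 - (u - 1) / 4, 9⟩ := by
  rw [gm_eq (i := 2) ⟨by norm_num; linarith, by norm_num; linarith⟩]
  apply Complex.ext <;> simp [piece] <;> ring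

theorem gp_bot (u : ℝ) (h1 : -9 ≤ u) (h2 : u ≤ 9) : gp ⟨u, -9⟩ = ⟨9, u⟩ := by
  have := gm_top (-u) (by linarith) (by linarith)
  rw [gp, show -(⟨u, -9⟩ : ℂ) = ⟨-u, 9⟩ by apply Complex.ext <;> simp, this]
  apply Complex.ext <;> simp

theorem gp_left (y : ℝ) (h1 : -9 ≤ y) (h2 : y ≤ 9) : gp ⟨-9, y⟩ = ⟨5 - 4 * y / 9, -9⟩ := by
  have := gm_right (-y) (by linarith) (by linarith)
  rw [gp, show -(⟨-9, y⟩ : ℂ) = ⟨9, -y⟩ by apply Complex.ext <;> simp, this]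
  apply Complex.ext <;> simp; ring

theorem gp_right (y : ℝ) (h1 : -9 ≤ y) (h2 : y ≤ 9) : gp ⟨9, y⟩ = ⟨5 - 4 * y / 9, 9⟩ := by
  have := gm_left (-y) (by linarith) (by linarith)
  rw [gp, show -(⟨9, y⟩ : ℂ) = ⟨-9, -y⟩ by apply Complex.ext <;> simp, this]
  apply Complex.ext <;> simp; ring

theorem gp_top₃ (u : ℝ) (h1 : -9 ≤ u) (h2 : u ≤ -1) : gp ⟨u, 9⟩ = ⟨-1 - (u + 1) / 4, -9⟩ := by
  have := gm_bot₃ (-u) (by linarith) (by linarith)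
  rw [gp, show -(⟨u, 9⟩ : ℂ) = ⟨-u, -9⟩ by apply Complex.ext <;> simp, this]
  apply Complex.ext <;> simp; ring

end Model

namespace Model

/-! #### Injectivity, images and overlaps -/

theorem gm_injective : Function.Injective gm := by
  intro p p' h
  obtain ⟨i, hi⟩ := exists_cone p
  obtain ⟨j, hj⟩ := exists_cone p'
  rw [gm_eq hi, gm_eq hj] at h
  have hr := congrArg Complex.re h
  have hm := congrArg Complex.im h
  clear h
  fin_cases i <;> fin_cases j <;> obtain ⟨h1, h2⟩ := hi <;> obtain ⟨h3, h4⟩ := hj <;>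
    simp only [piece] at hr hm <;> apply Complex.ext <;> linarith

theorem gp_injective : Function.Injective gp := fun p p' h => by
  have := gm_injective (neg_injective h)
  exact neg_injective this

theorem gz_injective : Function.Injective gz := fun p p' h => by
  have hr := congrArg Complex.re h
  have hm := congrArg Complex.im h
  simp only [gz] at hr hm
  apply Complex.ext <;> linarith

/-- The disjunction describes the closed region of the square to the left of the broken line: a
rectangle, and the triangle attached to it at the top. -/
theorem gm_mem {p : ℂ} (hp : p ∈ Sq) :
    gm p ∈ Sq ∧ ((gm p).re ≤ -1 ∨ 3 * (gm p).re ≤ 2 * (gm p).im - 15) := by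
  obtain ⟨⟨p1, p2⟩, p3, p4⟩ := hp
  obtain ⟨i, hi⟩ := exists_cone p
  rw [gm_eq hi]
  fin_cases i <;> obtain ⟨h1, h2⟩ := hi <;>
    refine ⟨⟨⟨?_, ?_⟩, ?_, ?_⟩, ?_⟩ <;> simp only [piece] <;> try linarith
  · left; linarith
  · right; linarith
  · right; linarith
  · left; linarith
  · left; linarith
  · left; linarith

theorem gp_mem {p : ℂ} (hp : p ∈ Sq) :
    gp p ∈ Sq ∧ (1 ≤ (gp p).re ∨ 2 * (gp p).im + 15 ≤ 3 * (gp p).re) := by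
  obtain ⟨h1, h2⟩ := gm_mem (neg_mem_Sq hp)
  rw [gm_neg] at h1 h2
  refine ⟨by simpa using neg_mem_Sq h1, ?_⟩
  simp only [Complex.neg_re, Complex.neg_im] at h2
  rcases h2 with h | h
  · left; linarith
  · right; linarith

theorem gz_mem {p : ℂ} (hp : p ∈ Sq) :
    gz p ∈ Sq ∧ (-1 ≤ (gz p).re ∧ (gz p).re ≤ 1) ∧
      2 * (gz p).im - 15 ≤ 3 * (gz p).re ∧ 3 * (gz p).re ≤ 2 * (gz p).im + 15 := by
  obtain ⟨⟨p1, p2⟩, p3, p4⟩ := hp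
  simp only [gz, Sq, Set.mem_ofPred_eq]
  refine ⟨⟨⟨?_, ?_⟩, ?_, ?_⟩, ⟨?_, ?_⟩, ?_, ?_⟩ <;> linarith

theorem exists_gm_eq {P : ℂ} (hP : P ∈ Sq) (hl : P.re ≤ -1 ∨ 3 * P.re ≤ 2 * P.im - 15) :
    ∃ p ∈ Sq, gm p = P := by
  obtain ⟨⟨p1, p2⟩, p3, p4⟩ := hP
  obtain ⟨X, Y⟩ := P
  dsimp only at *
  have fin : ∀ (i : Fin 6) (x y : ℝ), (⟨x, y⟩ : ℂ) ∈ cone i → (⟨x, y⟩ : ℂ) ∈ Sq →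
      piece i ⟨x, y⟩ = ⟨X, Y⟩ → ∃ p ∈ Sq, gm p = ⟨X, Y⟩ :=
    fun i x y h1 h2 h3 => ⟨_, h2, (gm_eq h1).trans h3⟩
  have conv : X + 4 ≤ 3 ∨ 3 * (X + 4) ≤ 2 * (Y - 3) + 3 := by
    rcases hl with h | h
    · left; linarith
    · right; linarith
  -- Coordinates about −4 + 3i, the common image of the apex of the cones. The cases below are the
  -- sectors between the rays through the images of the six vertices, and each witness inverts one
  -- affine piece.
  obtain ⟨U, rfl⟩ : ∃ U, X = U - 4 := ⟨X + 4, by ring⟩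
  obtain ⟨V, rfl⟩ : ∃ V, Y = V + 3 := ⟨Y - 3, by ring⟩
  have hl' : U ≤ 3 ∨ 3 * U ≤ 2 * V + 3 := by
    rcases conv with h | h
    · left; linarith
    · right; linarith
  clear conv hl
  rcases le_total V (-4 * U) with a | a
  · rcases le_total (5 * V) (12 * U) with b | b
    · refine fin 5 (2 * V / 3 - 1) (9 / 4 * (V / 12 - U)) ⟨?_, ?_⟩ ⟨⟨?_, ?_⟩, ?_, ?_⟩
        (Complex.ext ?_ ?_) <;> (try simp only [piece]) <;>
        linarith
    · rcases le_total (5 * V) (-6 * U) with c | c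
      · refine fin 4 (V - 4 * U / 5 - 1) (-9 * U / 5) ⟨?_, ?_⟩ ⟨⟨?_, ?_⟩, ?_, ?_⟩
          (Complex.ext ?_ ?_) <;> (try simp only [piece]) <;>
          linarith
      · refine fin 3 (5 * V / 3 - 1) (-9 / 4 * (U + V / 6)) ⟨?_, ?_⟩ ⟨⟨?_, ?_⟩, ?_, ?_⟩
          (Complex.ext ?_ ?_) <;> (try simp only [piece]) <;>
          linarith
  · rcases le_total V U with b | b
    · refine fin 0 (8 * (V - U) / 15 - 1) (-3 * U) ⟨?_, ?_⟩ ⟨⟨?_, ?_⟩, ?_, ?_⟩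
        (Complex.ext ?_ ?_) <;> (try simp only [piece]) <;>
        first | linarith | (rcases hl' with h | h <;> linarith)
    · rcases le_total (5 * V) (6 * U) with c | c
      · refine fin 1 (2 * (V - U) - 1) (3 * (2 * V - 3 * U)) ⟨?_, ?_⟩ ⟨⟨?_, ?_⟩, ?_, ?_⟩
          (Complex.ext ?_ ?_) <;> (try simp only [piece]) <;>
          first | linarith | (rcases hl' with h | h <;> linarith)
      · rcases le_total V (2 * U) with d | d
        · refine fin 2 (-4 * U + 11 * V / 3 - 1) (-3 * V / 2) ⟨?_, ?_⟩ ⟨⟨?_, ?_⟩, ?_, ?_⟩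
            (Complex.ext ?_ ?_) <;> (try simp only [piece]) <;>
            linarith
        · rcases le_total (5 * V) (-6 * U) with d' | d'
          · refine fin 4 (V - 4 * U / 5 - 1) (-9 * U / 5) ⟨?_, ?_⟩ ⟨⟨?_, ?_⟩, ?_, ?_⟩
              (Complex.ext ?_ ?_) <;> (try simp only [piece]) <;>
              linarith
          · refine fin 3 (5 * V / 3 - 1) (-9 / 4 * (U + V / 6)) ⟨?_, ?_⟩ ⟨⟨?_, ?_⟩, ?_, ?_⟩
              (Complex.ext ?_ ?_) <;> (try simp only [piece]) <;>
              linarith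

theorem exists_gp_eq {P : ℂ} (hP : P ∈ Sq) (hr : 1 ≤ P.re ∨ 2 * P.im + 15 ≤ 3 * P.re) :
    ∃ p ∈ Sq, gp p = P := by
  obtain ⟨p, hp, h⟩ := exists_gm_eq (neg_mem_Sq hP) (by
    simp only [Complex.neg_re, Complex.neg_im]
    rcases hr with h | h
    · left; linarith
    · right; linarith)
  exact ⟨-p, neg_mem_Sq hp, by rw [gp_neg, h, neg_neg]⟩

theorem exists_gz_eq {P : ℂ} (h1 : -1 ≤ P.re) (h2 : P.re ≤ 1)
    (h3 : 2 * P.im - 15 ≤ 3 * P.re) (h4 : 3 * P.re ≤ 2 * P.im + 15) : ∃ p ∈ Sq, gz p = P := by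
  refine ⟨⟨6 / 5 * (3 * P.re / 2 - P.im), 9 * P.re⟩, ⟨⟨?_, ?_⟩, ?_, ?_⟩, Complex.ext ?_ ?_⟩ <;>
    simp only [gz] <;> linarith

/-- The three pieces cover the square. -/
theorem exists_preimage {P : ℂ} (hP : P ∈ Sq) :
    ∃ p ∈ Sq, gm p = P ∨ gp p = P ∨ gz p = P := by
  by_cases hl : P.re ≤ -1 ∨ 3 * P.re ≤ 2 * P.im - 15
  · obtain ⟨p, hp, h⟩ := exists_gm_eq hP hl
    exact ⟨p, hp, .inl h⟩
  by_cases hr : 1 ≤ P.re ∨ 2 * P.im + 15 ≤ 3 * P.re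
  · obtain ⟨p, hp, h⟩ := exists_gp_eq hP hr
    exact ⟨p, hp, .inr (.inl h)⟩
  push Not at hl hr
  obtain ⟨p, hp, h⟩ := exists_gz_eq hl.1.le hr.1.le hl.2.le hr.2.le
  exact ⟨p, hp, .inr (.inr h)⟩

/-- The overlap of the left and the middle piece. -/
theorem gm_eq_gz {p p' : ℂ} (hp : p ∈ Sq) (hp' : p' ∈ Sq) (h : gm p = gz p') :
    (p.im = -9 ∧ p'.im = -9 ∧ p.re = -5 - 4 * p'.re / 9) ∨
      (p.im = -9 ∧ p'.re = -9 ∧ p.re = p'.im / 9) := by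
  obtain ⟨⟨p1, p2⟩, p3, p4⟩ := hp
  obtain ⟨⟨q1, q2⟩, q3, q4⟩ := hp'
  obtain ⟨i, hi⟩ := exists_cone p
  rw [gm_eq hi] at h
  have hr := congrArg Complex.re h
  have hm := congrArg Complex.im h
  clear h
  fin_cases i <;> obtain ⟨h1, h2⟩ := hi <;> simp only [piece, gz] at hr hm
  · left; refine ⟨?_, ?_, ?_⟩ <;> linarith
  · right; refine ⟨?_, ?_, ?_⟩ <;> linarith
  · right; refine ⟨?_, ?_, ?_⟩ <;> linarith
  · exfalso; linarith
  · exfalso; linarith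
  · left; refine ⟨?_, ?_, ?_⟩ <;> linarith

/-- The overlap of the left and the right piece. -/
theorem gm_eq_gp {p p' : ℂ} (hp : p ∈ Sq) (hp' : p' ∈ Sq) (h : gm p = gp p') :
    (p = ⟨-9, -9⟩ ∧ p' = ⟨-1, 9⟩) ∨ (p = ⟨1, -9⟩ ∧ p' = ⟨9, 9⟩) := by
  have h1 := gm_mem hp
  have h2 := gp_mem hp'
  rw [← h] at h2
  obtain ⟨⟨⟨a1, a2⟩, a3, a4⟩, a5⟩ := h1
  have a6 := h2.2
  -- The regions left and right of the middle strip touch only at two opposite corners of the strip.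
  have : gm p = ⟨-1, -9⟩ ∨ gm p = ⟨1, 9⟩ := by
    rcases a5 with a5 | a5 <;> rcases a6 with a6 | a6
    · linarith
    · left; apply Complex.ext <;> dsimp only <;> linarith
    · right; apply Complex.ext <;> dsimp only <;> linarith
    · linarith
  rcases this with hv | hv
  · left
    have e1 := gm_bot₁ (-9) (by norm_num) (by norm_num)
    have e2 := gp_top₃ (-1) (by norm_num) (by norm_num)
    norm_num at e1 e2
    exact ⟨gm_injective (hv.trans e1.symm), gp_injective ((h.symm.trans hv).trans e2.symm)⟩
  · right
    have e1 := gm_bot₃ 1 (by norm_num) (by norm_num)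
    have e2 := gp_right 9 (by norm_num) (by norm_num)
    norm_num at e1 e2
    exact ⟨gm_injective (hv.trans e1.symm), gp_injective ((h.symm.trans hv).trans e2.symm)⟩

theorem isCompact_Sq : IsCompact Sq := by
  have : Sq = Set.Icc (-9) 9 ×ℂ Set.Icc (-9) 9 := by
    ext p; simp [Sq, Complex.mem_reProdIm]
  rw [this]
  exact isCompact_Icc.reProdIm isCompact_Icc

end Model

/-! ### Self-similar functions -/

/-- A function `φ` with `φ (g i x) = a i * φ x + b i` exists in a closed class of continuous
functions, if for every member of the class the right-hand side descends along `g` to a member of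
the class. -/
theorem exists_selfSimilar {X ι : Type*} [TopologicalSpace X] [CompactSpace X] [T2Space X]
    [Finite ι] (g : ι → X → X) (hg : ∀ i, Continuous (g i)) (hsurj : ∀ x, ∃ i y, g i y = x)
    (a b : ι → ℂ) {ρ : ℝ} (hρ0 : 0 ≤ ρ) (hρ : ρ < 1) (ha : ∀ i, ‖a i‖ ≤ ρ) (S : Set C(X, ℂ))
    (hS : IsClosed S) (hne : S.Nonempty)
    (compat : ∀ φ ∈ S, ∀ i j x y, g i x = g j y → a i * φ x + b i = a j * φ y + b j)
    (step : ∀ φ ∈ S, ∀ ψ : C(X, ℂ), (∀ i x, ψ (g i x) = a i * φ x + b i) → ψ ∈ S) :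
    ∃ φ ∈ S, ∀ i x, φ (g i x) = a i * φ x + b i := by
  let _ : TopologicalSpace ι := ⊥
  have : DiscreteTopology ι := ⟨rfl⟩
  -- A continuous surjection from a compact space to a Hausdorff space is a quotient map. So a
  -- function on X is continuous as soon as its pullbacks along all `g i` are.
  have hΓ : Topology.IsQuotientMap (fun p : ι × X => g p.1 p.2) := by
    refine .of_surjective_continuous (fun x => ?_) (continuous_prod_of_discrete_left.2 hg)
    obtain ⟨i, y, h⟩ := hsurj x
    exact ⟨(i, y), h⟩
  have ex : ∀ φ : S, ∃ ψ : S, ∀ i x, ψ.1 (g i x) = a i * φ.1 x + b i := by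
    rintro ⟨φ, hφ⟩
    choose I Y hIY using hsurj
    have hval : ∀ i x, a (I (g i x)) * φ (Y (g i x)) + b (I (g i x)) = a i * φ x + b i :=
      fun i x => compat φ hφ _ _ _ _ (hIY (g i x))
    have hcont : Continuous fun x => a (I x) * φ (Y x) + b (I x) := by
      rw [hΓ.continuous_iff]
      refine continuous_prod_of_discrete_left.2 fun i => ?_
      have : (fun x => a i * φ x + b i) =
          fun x => ((fun x => a (I x) * φ (Y x) + b (I x)) ∘ fun p : ι × X => g p.1 p.2) (i, x) :=
        funext fun x => (hval i x).symm
      rw [← this]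
      fun_prop
    exact ⟨⟨⟨_, hcont⟩, step φ hφ _ hval⟩, hval⟩
  choose T hT using ex
  have := hS.completeSpace_coe
  have : Nonempty S := hne.to_subtype
  lift ρ to NNReal using hρ0
  have hcontr : ContractingWith ρ T := by
    refine ⟨by exact_mod_cast hρ, LipschitzWith.of_dist_le_mul fun φ φ' => ?_⟩
    rw [Subtype.dist_eq, Subtype.dist_eq]
    refine (ContinuousMap.dist_le (mul_nonneg ρ.2 dist_nonneg)).2 fun x => ?_
    obtain ⟨i, y, rfl⟩ := hsurj x
    rw [hT, hT, dist_add_right, dist_eq_norm, ← mul_sub, norm_mul, ← dist_eq_norm]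
    exact mul_le_mul (ha i) (ContinuousMap.dist_apply_le_dist y) dist_nonneg ρ.2
  refine ⟨(ContractingWith.fixedPoint T hcontr).1, (ContractingWith.fixedPoint T hcontr).2,
    fun i x => ?_⟩
  have hfix : T (ContractingWith.fixedPoint T hcontr) = ContractingWith.fixedPoint T hcontr :=
    hcontr.fixedPoint_isFixedPt
  have := hT (ContractingWith.fixedPoint T hcontr) i x
  rwa [hfix] at this

/-! ### The boundary arc -/

/-- The self-similar arc, parametrized by `[-9, 9]`, whose copies bound the tiles. -/
structure IsArc (β : ℂ) (q : ℝ → ℂ) : Prop where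
  continuous : Continuous q
  odd : ∀ u ∈ Set.Icc (-9 : ℝ) 9, q (-u) = -q u
  apply_nine : q 9 = 1 / 2
  mid : ∀ u ∈ Set.Icc (-9 : ℝ) 9, q (u / 9) = β ^ 3 * q u
  right : ∀ u ∈ Set.Icc (-9 : ℝ) 9, q (5 + 4 * u / 9) = -β ^ 2 * q u + (1 + β ^ 2) / 2

theorem IsArc.left {β : ℂ} {q : ℝ → ℂ} (hq : IsArc β q) {u : ℝ} (hu : u ∈ Set.Icc (-9 : ℝ) 9) :
    q (-5 + 4 * u / 9) = -β ^ 2 * q u - (1 + β ^ 2) / 2 := by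
  obtain ⟨h1, h2⟩ := hu
  have e := hq.odd (5 + 4 * (-u) / 9) ⟨by linarith, by linarith⟩
  rw [hq.right (-u) ⟨by linarith, by linarith⟩, hq.odd u ⟨h1, h2⟩] at e
  rw [show -5 + 4 * u / 9 = -(5 + 4 * (-u) / 9) by ring, e]
  ring

theorem exists_isArc {β : ℂ} (hβ : β ^ 3 - 2 * β ^ 2 - 1 = 0) (hi : β.im ≠ 0) :
    ∃ q, IsArc β q := by
  let X := Set.Icc (-9 : ℝ) 9
  have hn := WindowRoot.norm_lt_one hβ hi
  have h0 := norm_nonneg β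
  let g : Fin 3 → X → X := ![
    fun u => ⟨u.1 / 9, by have := u.2.1; have := u.2.2; constructor <;> linarith⟩,
    fun u => ⟨5 + 4 * u.1 / 9, by have := u.2.1; have := u.2.2; constructor <;> linarith⟩,
    fun u => ⟨-5 + 4 * u.1 / 9, by have := u.2.1; have := u.2.2; constructor <;> linarith⟩]
  let neg : X → X := fun u => ⟨-u.1, by have := u.2.1; have := u.2.2; constructor <;> linarith⟩
  let nine : X := ⟨9, by norm_num, le_refl _⟩
  -- Oddness and the value at 9 fix φ(±9) = ±1/2. This is all that is needed at the parameters ±1,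
  -- where the three pieces of the arc meet; the pieces fit together there exactly because β³ = 2β²
  -- + 1.
  let S : Set C(X, ℂ) := {φ | φ nine = 1 / 2 ∧ ∀ u, φ (neg u) = -φ u}
  have key : ∃ φ ∈ S, ∀ i x, φ (g i x) = (![β ^ 3, -β ^ 2, -β ^ 2] : Fin 3 → ℂ) i * φ x +
      (![0, (1 + β ^ 2) / 2, -((1 + β ^ 2) / 2)] : Fin 3 → ℂ) i := by
    refine exists_selfSimilar g ?_ ?_ _ _ h0 hn ?_ S ?_ ?_ ?_ ?_
    · intro i
      fin_cases i <;> exact Continuous.subtype_mk (by fun_prop) _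
    · rintro ⟨x, h1, h2⟩
      rcases le_total x (-1) with h | h
      · exact ⟨2, ⟨9 / 4 * (x + 5), by linarith, by linarith⟩, Subtype.ext (by simp [g]; ring)⟩
      rcases le_total x 1 with h' | h'
      · exact ⟨0, ⟨9 * x, by linarith, by linarith⟩, Subtype.ext (by simp [g])⟩
      · exact ⟨1, ⟨9 / 4 * (x - 5), by linarith, by linarith⟩, Subtype.ext (by simp [g]; ring)⟩
    · intro i
      have h2 : ‖β‖ ^ 2 ≤ ‖β‖ := by nlinarith
      have h3 : ‖β‖ ^ 3 ≤ ‖β‖ := by nlinarith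
      fin_cases i <;> simp only [Matrix.cons_val, norm_neg, norm_pow, Fin.reduceFinMk] <;>
        assumption
    · simp only [S, Set.ofPred_and, Set.ofPred_forall]
      refine IsClosed.inter ?_ (isClosed_iInter fun u => ?_) <;>
        exact isClosed_eq (by fun_prop) (by fun_prop)
    · refine ⟨⟨fun u => (u.1 : ℂ) / 18, by fun_prop⟩, ?_, fun u => ?_⟩
      · simp [nine]; norm_num
      · simp [neg]; ring
    · rintro φ ⟨h9, hodd⟩
      have hm9 : ∀ u : X, u.1 = -9 → φ u = -1 / 2 := by
        intro u hu
        have := hodd nine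
        rw [h9, show neg nine = u from Subtype.ext hu.symm] at this
        rw [this]; ring
      have hp9 : ∀ u : X, u.1 = 9 → φ u = 1 / 2 := by
        intro u hu
        rw [← h9, show nine = u from Subtype.ext hu.symm]
      intro i j x y hxy
      have hx1 := x.2.1; have hx2 := x.2.2; have hy1 := y.2.1; have hy2 := y.2.2
      have hxy' := congrArg Subtype.val hxy
      fin_cases i <;> fin_cases j <;> simp [g] at hxy' ⊢
      · rw [Subtype.ext hxy']; simp
      · rw [hp9 x (by linarith), hm9 y (by linarith)]; linear_combination hβ / 2
      · rw [hm9 x (by linarith), hp9 y (by linarith)]; linear_combination -hβ / 2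
      · rw [hm9 x (by linarith), hp9 y (by linarith)]; linear_combination -hβ / 2
      · rw [Subtype.ext hxy']; simp
      · exfalso; linarith
      · rw [hp9 x (by linarith), hm9 y (by linarith)]; linear_combination hβ / 2
      · exfalso; linarith
      · rw [Subtype.ext hxy']; simp
    · rintro φ ⟨h9, hodd⟩ ψ hψ
      constructor
      · have : g 1 nine = nine := Subtype.ext (by simp [g, nine]; norm_num)
        rw [← this, hψ, h9]
        simp; ring
      · have e0 : ∀ x, neg (g 0 x) = g 0 (neg x) := fun x =>
          Subtype.ext (by simp [g, neg]; ring)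
        have e1 : ∀ x, neg (g 1 x) = g 2 (neg x) := fun x =>
          Subtype.ext (by simp [g, neg]; ring)
        have e2 : ∀ x, neg (g 2 x) = g 1 (neg x) := fun x =>
          Subtype.ext (by simp [g, neg]; ring)
        intro u
        obtain ⟨u, h1, h2⟩ := u
        rcases le_total u (-1) with h | h
        · have : (⟨u, h1, h2⟩ : X) = g 2 ⟨9 / 4 * (u + 5), by linarith, by linarith⟩ :=
            Subtype.ext (by simp [g]; ring)
          rw [this, e2, hψ, hψ, hodd]
          simp; ring
        rcases le_total u 1 with h' | h'
        · have : (⟨u, h1, h2⟩ : X) = g 0 ⟨9 * u, by linarith, by linarith⟩ :=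
            Subtype.ext (by simp [g])
          rw [this, e0, hψ, hψ, hodd]
          simp
        · have : (⟨u, h1, h2⟩ : X) = g 1 ⟨9 / 4 * (u - 5), by linarith, by linarith⟩ :=
            Subtype.ext (by simp [g]; ring)
          rw [this, e1, hψ, hψ, hodd]
          simp; ring
  obtain ⟨φ, ⟨h9, hodd⟩, hφ⟩ := key
  refine ⟨fun u => φ (Set.projIcc (-9) 9 (by norm_num) u), ?_, ?_, ?_, ?_, ?_⟩
  · exact φ.continuous.comp continuous_projIcc
  · intro u hu
    have hu' : -u ∈ Set.Icc (-9 : ℝ) 9 := ⟨by linarith [hu.2], by linarith [hu.1]⟩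
    rw [Set.projIcc_of_mem _ hu, Set.projIcc_of_mem _ hu']
    exact hodd ⟨u, hu⟩
  · rw [Set.projIcc_of_mem _ nine.2]
    exact h9
  · intro u hu
    have hu' : u / 9 ∈ Set.Icc (-9 : ℝ) 9 := ⟨by linarith [hu.1], by linarith [hu.2]⟩
    rw [Set.projIcc_of_mem _ hu, Set.projIcc_of_mem _ hu']
    simpa [g] using hφ 0 ⟨u, hu⟩
  · intro u hu
    have hu' : 5 + 4 * u / 9 ∈ Set.Icc (-9 : ℝ) 9 := ⟨by linarith [hu.1], by linarith [hu.2]⟩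
    rw [Set.projIcc_of_mem _ hu, Set.projIcc_of_mem _ hu']
    simpa [g] using hφ 1 ⟨u, hu⟩

/-! ### The parametrized tile -/

theorem IsArc.apply_neg_nine {β : ℂ} {q : ℝ → ℂ} (hq : IsArc β q) : q (-9) = -1 / 2 := by
  rw [hq.odd 9 ⟨by norm_num, le_rfl⟩, hq.apply_nine]
  ring

theorem IsArc.apply_one {β : ℂ} {q : ℝ → ℂ} (hq : IsArc β q) : q 1 = β ^ 3 / 2 := by
  have := hq.mid 9 ⟨by norm_num, le_rfl⟩
  rw [hq.apply_nine] at this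
  norm_num at this
  rw [this]
  ring

/-- A parametrization of the centred tile by the square: it conjugates the model maps to the
contractions of the tile, and on the sides of the square it is given by the arc `q`. -/
structure IsTile (β : ℂ) (q : ℝ → ℂ) (h : ℂ → ℂ) : Prop where
  continuous : Continuous h
  odd : ∀ p ∈ Model.Sq, h (-p) = -h p
  gm : ∀ p ∈ Model.Sq, h (Model.gm p) = β * h p - (1 + β ^ 2) / 2
  gz : ∀ p ∈ Model.Sq, h (Model.gz p) = β ^ 3 * h p
  bot : ∀ x ∈ Set.Icc (-9 : ℝ) 9, h ⟨x, -9⟩ = q x - β / 2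
  left : ∀ y ∈ Set.Icc (-9 : ℝ) 9, h ⟨-9, y⟩ = β * q y - 1 / 2

theorem exists_isTile {β : ℂ} (hβ : β ^ 3 - 2 * β ^ 2 - 1 = 0) (hi : β.im ≠ 0) {q : ℝ → ℂ}
    (hq : IsArc β q) : ∃ h, IsTile β q h := by
  let X := Model.Sq
  have : CompactSpace X := isCompact_iff_compactSpace.1 Model.isCompact_Sq
  have hn := WindowRoot.norm_lt_one hβ hi
  have h0 := norm_nonneg β
  let g : Fin 3 → X → X := ![
    fun p => ⟨Model.gm p, (Model.gm_mem p.2).1⟩,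
    fun p => ⟨Model.gp p, (Model.gp_mem p.2).1⟩,
    fun p => ⟨Model.gz p, (Model.gz_mem p.2).1⟩]
  -- Different pieces overlap only in images of points on the sides of the square. Prescribing φ on
  -- the bottom and the left side, and by oddness on the other two, makes compatibility a property
  -- of `q`.
  let S : Set C(X, ℂ) := {φ | (∀ p p' : X, p'.1 = -p.1 → φ p' = -φ p) ∧
    (∀ p : X, p.1.im = -9 → φ p = q p.1.re - β / 2) ∧
    (∀ p : X, p.1.re = -9 → φ p = β * q p.1.im - 1 / 2)}
  let neg : X → X := fun p => ⟨-p.1, Model.neg_mem_Sq p.2⟩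
  have hneg : ∀ p : X, (neg p).1 = -p.1 := fun p => rfl
  have top : ∀ φ ∈ S, ∀ p : X, p.1.im = 9 → φ p = q p.1.re + β / 2 := by
    rintro φ ⟨hodd, hbot, -⟩ p hp
    rw [hodd (neg p) p (by simp [neg]), hbot (neg p) (by simp [neg, hp])]
    simp only [neg, Complex.neg_re]
    rw [hq.odd _ p.2.1]
    ring
  have key : ∃ φ ∈ S, ∀ i x, φ (g i x) = (![β, β, β ^ 3] : Fin 3 → ℂ) i * φ x +
      (![-((1 + β ^ 2) / 2), (1 + β ^ 2) / 2, 0] : Fin 3 → ℂ) i := by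
    refine exists_selfSimilar g ?_ ?_ _ _ h0 hn ?_ S ?_ ?_ ?_ ?_
    · intro i
      fin_cases i
      · exact (Model.continuous_gm.comp continuous_subtype_val).subtype_mk _
      · exact (Model.continuous_gp.comp continuous_subtype_val).subtype_mk _
      · exact (Model.continuous_gz.comp continuous_subtype_val).subtype_mk _
    · rintro ⟨P, hP⟩
      obtain ⟨p, hp, h | h | h⟩ := Model.exists_preimage hP
      · exact ⟨0, ⟨p, hp⟩, Subtype.ext h⟩
      · exact ⟨1, ⟨p, hp⟩, Subtype.ext h⟩
      · exact ⟨2, ⟨p, hp⟩, Subtype.ext h⟩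
    · intro i
      have h3 : ‖β‖ ^ 3 ≤ ‖β‖ := by nlinarith [sq_nonneg ‖β‖]
      fin_cases i <;> simp only [Matrix.cons_val, norm_pow, Fin.reduceFinMk] <;>
        first | exact le_rfl | exact h3
    · simp only [S, Set.ofPred_and, Set.ofPred_forall]
      refine IsClosed.inter ?_ (IsClosed.inter ?_ ?_)
      · exact isClosed_iInter fun p => isClosed_iInter fun p' => isClosed_iInter fun _ =>
          isClosed_eq (by fun_prop) (by fun_prop)
      · exact isClosed_iInter fun p => isClosed_iInter fun _ =>
          isClosed_eq (by fun_prop) (by fun_prop)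
      · exact isClosed_iInter fun p => isClosed_iInter fun _ =>
          isClosed_eq (by fun_prop) (by fun_prop)
    · have hqc := hq.continuous
      -- The sum of the two arcs has the right values on the sides because q(−9) = −1/2.
      refine ⟨⟨fun p => q p.1.re + β * q p.1.im, ?_⟩, ?_, ?_, ?_⟩
      · have h1 : Continuous fun p : X => p.1.re := Complex.continuous_re.comp continuous_subtype_val
        have h2 : Continuous fun p : X => p.1.im := Complex.continuous_im.comp continuous_subtype_val
        exact (hqc.comp h1).add (continuous_const.mul (hqc.comp h2))
      · intro p p' hp
        simp only [ContinuousMap.coe_mk, hp, Complex.neg_re, Complex.neg_im]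
        rw [hq.odd _ p.2.1, hq.odd _ p.2.2]
        ring
      · intro p hp
        simp only [ContinuousMap.coe_mk, hp, hq.apply_neg_nine]
        ring
      · intro p hp
        simp only [ContinuousMap.coe_mk, hp, hq.apply_neg_nine]
        ring
    · intro φ hφ
      have htop := top φ hφ
      obtain ⟨hodd, hbot, hleft⟩ := hφ
      have mz : ∀ p p' : X, Model.gm p = Model.gz p' →
          β * φ p - (1 + β ^ 2) / 2 = β ^ 3 * φ p' := by
        intro p p' h
        rcases Model.gm_eq_gz p.2 p'.2 h with ⟨h1, h2, h3⟩ | ⟨h1, h2, h3⟩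
        · rw [hbot p h1, hbot p' h2, h3,
            show -5 - 4 * p'.1.re / 9 = -5 + 4 * (-p'.1.re) / 9 by ring,
            hq.left (u := -p'.1.re) ⟨by linarith [p'.2.1.2], by linarith [p'.2.1.1]⟩,
            hq.odd _ p'.2.1]
          linear_combination (β + 1) * hβ / 2
        · rw [hbot p h1, hleft p' h2, h3, hq.mid _ p'.2.2]
          linear_combination hβ / 2
      have mp : ∀ p p' : X, Model.gm p = Model.gp p' →
          β * φ p - (1 + β ^ 2) / 2 = β * φ p' + (1 + β ^ 2) / 2 := by
        intro p p' h
        rcases Model.gm_eq_gp p.2 p'.2 h with ⟨h1, h2⟩ | ⟨h1, h2⟩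
        · rw [hbot p (by rw [h1]), htop p' (by rw [h2]), h1, h2]
          simp only
          rw [hq.apply_neg_nine, hq.odd 1 ⟨by norm_num, by norm_num⟩, hq.apply_one]
          linear_combination (β / 2 + 1) * hβ
        · rw [hbot p (by rw [h1]), htop p' (by rw [h2]), h1, h2]
          simp only
          rw [hq.apply_nine, hq.apply_one]
          linear_combination (β / 2 + 1) * hβ
      have pz : ∀ p p' : X, Model.gp p = Model.gz p' →
          β * φ p + (1 + β ^ 2) / 2 = β ^ 3 * φ p' := by
        intro p p' h
        have := mz (neg p) (neg p') (by rw [hneg, hneg, Model.gm_neg, Model.gz_neg, h])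
        rw [hodd p _ (hneg p), hodd p' _ (hneg p')] at this
        linear_combination -this
      intro i j x y hxy
      have hxy' := congrArg Subtype.val hxy
      fin_cases i <;> fin_cases j <;> simp [g] at hxy' ⊢
      · rw [Subtype.ext (Model.gm_injective hxy')]; simp
      · linear_combination mp x y hxy'
      · linear_combination mz x y hxy'
      · linear_combination -mp y x hxy'.symm
      · rw [Subtype.ext (Model.gp_injective hxy')]; simp
      · linear_combination pz x y hxy'
      · linear_combination -mz y x hxy'.symm
      · linear_combination -pz y x hxy'.symm
      · rw [Subtype.ext (Model.gz_injective hxy')]; simp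
    · intro φ hφ ψ hψ
      have htop := top φ hφ
      obtain ⟨hodd, hbot, hleft⟩ := hφ
      have hm : ∀ p P : X, P.1 = Model.gm p → ψ P = β * φ p - (1 + β ^ 2) / 2 := by
        intro p P h
        rw [show P = g 0 p from Subtype.ext h, hψ]
        simp; ring
      have hp : ∀ p P : X, P.1 = Model.gp p → ψ P = β * φ p + (1 + β ^ 2) / 2 := by
        intro p P h
        rw [show P = g 1 p from Subtype.ext h, hψ]
        simp
      have hz : ∀ p P : X, P.1 = Model.gz p → ψ P = β ^ 3 * φ p := by
        intro p P h
        rw [show P = g 2 p from Subtype.ext h, hψ]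
        simp
      refine ⟨fun P P' h => ?_, ?_, ?_⟩
      · obtain ⟨p, hp', e | e | e⟩ := Model.exists_preimage P.2
        · rw [hm ⟨p, hp'⟩ P e.symm, hp (neg ⟨p, hp'⟩) P' (by rw [h, ← e, hneg, Model.gp_neg]),
            hodd _ _ (hneg _)]
          ring
        · rw [hp ⟨p, hp'⟩ P e.symm, hm (neg ⟨p, hp'⟩) P' (by rw [h, ← e, hneg, Model.gm_neg]),
            hodd _ _ (hneg _)]
          ring
        · rw [hz ⟨p, hp'⟩ P e.symm, hz (neg ⟨p, hp'⟩) P' (by rw [h, ← e, hneg, Model.gz_neg]),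
            hodd _ _ (hneg _)]
          ring
      · rintro ⟨⟨x, y⟩, ⟨x1, x2⟩, _⟩ h
        obtain rfl : y = -9 := h
        dsimp only at x1 x2 ⊢
        rcases le_total x (-1) with h' | h'
        · obtain ⟨v, rfl⟩ : ∃ v, x = -5 - 4 * v / 9 := ⟨-9 / 4 * (x + 5), by ring⟩
          have v1 : -9 ≤ v := by linarith
          have v2 : v ≤ 9 := by linarith
          rw [hm ⟨⟨-9, v⟩, ⟨le_rfl, by norm_num⟩, v1, v2⟩ _ (Model.gm_left v v1 v2).symm,
            hleft _ rfl, show -5 - 4 * v / 9 = -5 + 4 * (-v) / 9 by ring,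
            hq.left (u := -v) ⟨by linarith, by linarith⟩, hq.odd _ ⟨v1, v2⟩]
          ring
        rcases le_total x 1 with h'' | h''
        · obtain ⟨v, rfl⟩ : ∃ v, x = -v / 9 := ⟨-9 * x, by ring⟩
          have v1 : -9 ≤ v := by linarith
          have v2 : v ≤ 9 := by linarith
          have e := Model.gp_top₃ (-5 + 4 * v / 9) (by linarith) (by linarith)
          rw [hp ⟨⟨-5 + 4 * v / 9, 9⟩, ⟨by dsimp only; linarith, by dsimp only; linarith⟩,
            by norm_num, le_rfl⟩ _ (by rw [e]; exact congrArg (Complex.mk · (-9)) (by ring)), htop _ rfl]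
          dsimp only
          rw [hq.left ⟨v1, v2⟩, hq.mid (-v) ⟨by linarith, by linarith⟩, hq.odd _ ⟨v1, v2⟩]
          linear_combination (-1 / 2) * hβ
        · obtain ⟨v, rfl⟩ : ∃ v, x = 5 - 4 * v / 9 := ⟨9 / 4 * (5 - x), by ring⟩
          have v1 : -9 ≤ v := by linarith
          have v2 : v ≤ 9 := by linarith
          rw [hp ⟨⟨-9, v⟩, ⟨le_rfl, by norm_num⟩, v1, v2⟩ _ (Model.gp_left v v1 v2).symm,
            hleft _ rfl, show 5 - 4 * v / 9 = 5 + 4 * (-v) / 9 by ring,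
            hq.right (-v) ⟨by linarith, by linarith⟩, hq.odd _ ⟨v1, v2⟩]
          ring
      · rintro ⟨⟨x, y⟩, _, y1, y2⟩ h
        obtain rfl : x = -9 := h
        rw [hm ⟨⟨y, 9⟩, ⟨y1, y2⟩, by norm_num, le_rfl⟩ _ (Model.gm_top y y1 y2).symm, htop _ rfl]
        ring
  obtain ⟨φ, ⟨hodd, hbot, hleft⟩, hφ⟩ := key
  have h99 : (-9 : ℝ) ≤ 9 := by norm_num
  -- Clamping the coordinates extends the function from the square to a continuous function on ℂ.
  let P : ℝ → ℝ := fun x => Set.projIcc (-9) 9 h99 x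
  have hP : ∀ x ∈ Set.Icc (-9 : ℝ) 9, P x = x := fun x hx => by
    simp only [P, Set.projIcc_of_mem h99 hx]
  let clamp : ℂ → X := fun p => ⟨⟨P p.re, P p.im⟩, (Set.projIcc (-9) 9 h99 p.re).2,
    (Set.projIcc (-9) 9 h99 p.im).2⟩
  have hcl : ∀ p (hp : p ∈ Model.Sq), clamp p = ⟨p, hp⟩ := fun p hp =>
    Subtype.ext (Complex.ext (hP _ hp.1) (hP _ hp.2))
  have hPc : Continuous P := continuous_subtype_val.comp continuous_projIcc
  refine ⟨fun p => φ (clamp p), ?_, ?_, ?_, ?_, ?_, ?_⟩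
  · refine φ.continuous.comp (Continuous.subtype_mk ?_ _)
    exact Model.continuous_mk (hPc.comp Complex.continuous_re) (hPc.comp Complex.continuous_im)
  · intro p hp
    rw [hcl p hp, hcl _ (Model.neg_mem_Sq hp)]
    exact hodd _ _ rfl
  · intro p hp
    rw [hcl p hp, hcl _ (Model.gm_mem hp).1]
    have := hφ 0 ⟨p, hp⟩
    simp only [g, Matrix.cons_val] at this
    rw [this]
    ring
  · intro p hp
    rw [hcl p hp, hcl _ (Model.gz_mem hp).1]
    have := hφ 2 ⟨p, hp⟩
    simp only [g, Matrix.cons_val] at this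
    rw [this]
    ring
  · intro x hx
    rw [hcl ⟨x, -9⟩ ⟨hx, le_rfl, h99⟩]
    exact hbot _ rfl
  · intro y hy
    rw [hcl ⟨-9, y⟩ ⟨⟨le_rfl, h99⟩, hy⟩]
    exact hleft _ rfl

namespace IsTile

variable {β : ℂ} {q : ℝ → ℂ} {h : ℂ → ℂ}

theorem gp (H : IsTile β q h) {p : ℂ} (hp : p ∈ Model.Sq) :
    h (Model.gp p) = β * h p + (1 + β ^ 2) / 2 := by
  have h1 := H.gm _ (Model.neg_mem_Sq hp)
  rw [H.odd _ hp, Model.gm_neg, H.odd _ (Model.gp_mem hp).1] at h1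
  linear_combination -h1

/-- The norm bound on the tile. -/
theorem norm_le (hβ : β ^ 3 - 2 * β ^ 2 - 1 = 0) (hi : β.im ≠ 0) (H : IsTile β q h) {p : ℂ}
    (hp : p ∈ Model.Sq) : ‖h p‖ ≤ 0.7 := by
  -- At a point of maximal norm M, two levels of the subdivision give M ≤ 0.4535 M + 0.3762, hence M
  -- ≤ 0.7. A single level, with factor 0.6735 and error 0.3, would only give about 0.92.
  obtain ⟨P, hP, hmax⟩ := Model.isCompact_Sq.exists_isMaxOn ⟨p, hp⟩
    (H.continuous.norm.continuousOn)
  refine (hmax hp).trans ?_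
  have hmax' : ∀ z ∈ Model.Sq, ‖h z‖ ≤ ‖h P‖ := fun z hz => hmax hz
  have hn := WindowRoot.normSq_bounds hβ hi
  have hn' := WindowRoot.norm_bounds hβ hi
  have hre := WindowRoot.re_bounds hβ hi
  have h0 := norm_nonneg (h P)
  have hsq := WindowRoot.normSq_quad hβ hi
  have e1 : ‖(1 + β ^ 2) / 2‖ ≤ 0.3 := by
    have := hsq (1 / 2) 0 (1 / 2)
    push_cast at this
    rw [show (1 / 2 + 0 * β + 1 / 2 * β ^ 2 : ℂ) = (1 + β ^ 2) / 2 by ring] at this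
    refine abs_le_of_sq_le_sq' ?_ (by norm_num) |>.2
    rw [this]; norm_num; linarith
  have e2 : ‖(β + β ^ 2) / 2‖ ≤ 0.3762 := by
    have := hsq 0 (1 / 2) (1 / 2)
    push_cast at this
    rw [show (0 + 1 / 2 * β + 1 / 2 * β ^ 2 : ℂ) = (β + β ^ 2) / 2 by ring] at this
    refine abs_le_of_sq_le_sq' ?_ (by norm_num) |>.2
    rw [this]; norm_num; linarith
  have e3 : ‖(2 + β + 3 * β ^ 2) / 2‖ ≤ 0.3762 := by
    have := hsq 1 (1 / 2) (3 / 2)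
    push_cast at this
    rw [show (1 + 1 / 2 * β + 3 / 2 * β ^ 2 : ℂ) = (2 + β + 3 * β ^ 2) / 2 by ring] at this
    refine abs_le_of_sq_le_sq' ?_ (by norm_num) |>.2
    rw [this]; norm_num; linarith
  -- `h P` is the value at another point, up to a small factor and a small error
  have fin : ∀ (c b : ℂ) (z : ℂ), z ∈ Model.Sq → ‖c‖ ≤ 0.4535 → ‖b‖ ≤ 0.3762 →
      ‖h P‖ = ‖c * h z + b‖ → ‖h P‖ ≤ 0.7 := by
    intro c b z hz hc hb e
    have h1 := norm_add_le (c * h z) b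
    rw [norm_mul] at h1
    have := hmax' z hz
    nlinarith [norm_nonneg c, norm_nonneg (h z)]
  have n2 : ‖β ^ 2‖ ≤ 0.4535 := by rw [norm_pow]; exact hn.2.le
  have n3 : ‖β ^ 3‖ ≤ 0.4535 := by rw [norm_pow]; nlinarith
  have n4 : ‖β ^ 4‖ ≤ 0.4535 := by rw [norm_pow]; nlinarith
  have left : ∀ w ∈ Model.Sq, ‖h P‖ = ‖h (Model.gm w)‖ → ‖h P‖ ≤ 0.7 := by
    intro w hw e
    rw [H.gm w hw] at e
    obtain ⟨z, hz, rfl | rfl | rfl⟩ := Model.exists_preimage hw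
    · refine fin _ (-((2 + β + 3 * β ^ 2) / 2)) z hz n2 (by rwa [norm_neg]) ?_
      rw [e, H.gm z hz]; congr 1; linear_combination (-1 / 2) * hβ
    · refine fin _ ((β + β ^ 2) / 2) z hz n2 e2 ?_
      rw [e, H.gp hz]; congr 1; linear_combination (1 / 2) * hβ
    · refine fin _ (-((1 + β ^ 2) / 2)) z hz n4 (by rw [norm_neg]; linarith) ?_
      rw [e, H.gz z hz]; congr 1; ring
  obtain ⟨w, hw, e | e | e⟩ := Model.exists_preimage hP
  · exact left w hw (by rw [e])
  · refine left (-w) (Model.neg_mem_Sq hw) ?_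
    rw [Model.gm_neg, e, H.odd _ hP, norm_neg]
  · refine fin _ 0 w hw n3 (by norm_num) ?_
    rw [← e, H.gz w hw, add_zero]

/-! ### Pairs of points of the square whose images differ by a given vector -/

/-- The translation part, up to the factor `(1 + β²) / 2`, of the contractions. -/
def sgn : Fin 3 → ℝ := ![-1, 1, 0]

/-- The model maps. -/
noncomputable def mdl : Fin 3 → ℂ → ℂ := ![Model.gm, Model.gp, Model.gz]

/-- The exponents of the linear parts of the contractions. -/
def expo : Fin 3 → ℕ := ![1, 1, 3]

/-- Bounds for the contraction factors. -/
noncomputable def rad : Fin 3 → ℝ := ![0.6735, 0.6735, 0.3055]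

theorem exists_digit (H : IsTile β q h) {p : ℂ} (hp : p ∈ Model.Sq) :
    ∃ k, ∃ a ∈ Model.Sq, p = mdl k a ∧ h p = β ^ expo k * h a + sgn k * ((1 + β ^ 2) / 2) := by
  obtain ⟨a, ha, rfl | rfl | rfl⟩ := Model.exists_preimage hp
  · refine ⟨0, a, ha, rfl, ?_⟩
    rw [H.gm a ha]; simp [expo, sgn]; ring
  · refine ⟨1, a, ha, rfl, ?_⟩
    rw [H.gp ha]; simp [expo, sgn]
  · refine ⟨2, a, ha, rfl, ?_⟩
    rw [H.gz a ha]; simp [expo, sgn]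

theorem norm_pow_expo_le (hβ : β ^ 3 - 2 * β ^ 2 - 1 = 0) (hi : β.im ≠ 0) (k : Fin 3) :
    ‖β ^ expo k‖ ≤ rad k := by
  have h1 := WindowRoot.norm_bounds hβ hi
  have h2 := WindowRoot.normSq_bounds hβ hi
  rw [norm_pow]
  fin_cases k <;> simp [expo, rad] <;> nlinarith

/-- Too long a vector is not a difference of scaled points of the tile. -/
theorem not_rel (hβ : β ^ 3 - 2 * β ^ 2 - 1 = 0) (hi : β.im ≠ 0) (H : IsTile β q h) {a b X Y : ℂ}
    (ha : a ∈ Model.Sq) (hb : b ∈ Model.Sq) {r s : ℝ} (hX : ‖X‖ ≤ r) (hY : ‖Y‖ ≤ s)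
    (c₀ c₁ c₂ : ℝ) (e : X * h a = Y * h b + (c₀ + c₁ * β + c₂ * β ^ 2))
    (hlow : ∀ x n : ℝ, -0.1028 < x → x < -0.10275 → 0.453 < n → n < 0.4535 →
      (0.7 * (r + s)) ^ 2 < c₀ ^ 2 + c₁ ^ 2 * n - 2 * c₂ ^ 2 * x + 2 * c₀ * c₁ * x
        + c₀ * c₂ * (4 * x - n) + c₁ * c₂ * (2 * n - 1)) : False := by
  refine WindowRoot.not_norm_le hβ hi c₀ c₁ c₂ rfl ?_ hlow
  rw [show (c₀ + c₁ * β + c₂ * β ^ 2 : ℂ) = X * h a - Y * h b by rw [e]; ring]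
  refine (norm_sub_le _ _).trans ?_
  rw [norm_mul, norm_mul]
  have h1 := H.norm_le hβ hi ha
  have h2 := H.norm_le hβ hi hb
  nlinarith [norm_nonneg X, norm_nonneg Y, norm_nonneg (h a), norm_nonneg (h b)]

/-- Subtracting the two translation parts shows that h a and h b, scaled by the factors of the
pieces, differ by the vector with the shifted coefficients. This is impossible if that vector is
longer than 0.7 times the sum of the factors. -/
theorem not_digits (hβ : β ^ 3 - 2 * β ^ 2 - 1 = 0) (hi : β.im ≠ 0) (H : IsTile β q h) {a b : ℂ}
    (ha : a ∈ Model.Sq) (hb : b ∈ Model.Sq) {k l : Fin 3} {c₀ c₁ c₂ : ℝ}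
    (e : β ^ expo k * h a + sgn k * ((1 + β ^ 2) / 2) =
      β ^ expo l * h b + sgn l * ((1 + β ^ 2) / 2) + (c₀ + c₁ * β + c₂ * β ^ 2))
    (hlow : ∀ x n : ℝ, -0.1028 < x → x < -0.10275 → 0.453 < n → n < 0.4535 →
      (0.7 * (rad k + rad l)) ^ 2 < (c₀ + (sgn l - sgn k) / 2) ^ 2 + c₁ ^ 2 * n
        - 2 * (c₂ + (sgn l - sgn k) / 2) ^ 2 * x + 2 * (c₀ + (sgn l - sgn k) / 2) * c₁ * x
        + (c₀ + (sgn l - sgn k) / 2) * (c₂ + (sgn l - sgn k) / 2) * (4 * x - n)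
        + c₁ * (c₂ + (sgn l - sgn k) / 2) * (2 * n - 1)) : False := by
  refine H.not_rel hβ hi ha hb (norm_pow_expo_le hβ hi k) (norm_pow_expo_le hβ hi l)
    (c₀ + (sgn l - sgn k) / 2) c₁ (c₂ + (sgn l - sgn k) / 2) ?_ hlow
  push_cast
  linear_combination e

theorem not_digit (hβ : β ^ 3 - 2 * β ^ 2 - 1 = 0) (hi : β.im ≠ 0) (H : IsTile β q h) {a b Y : ℂ}
    (ha : a ∈ Model.Sq) (hb : b ∈ Model.Sq) {k : Fin 3} {c₀ c₁ c₂ s : ℝ} (hY : ‖Y‖ ≤ s)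
    (e : β ^ expo k * h a + sgn k * ((1 + β ^ 2) / 2) = Y * h b + (c₀ + c₁ * β + c₂ * β ^ 2))
    (hlow : ∀ x n : ℝ, -0.1028 < x → x < -0.10275 → 0.453 < n → n < 0.4535 →
      (0.7 * (rad k + s)) ^ 2 < (c₀ - sgn k / 2) ^ 2 + c₁ ^ 2 * n
        - 2 * (c₂ - sgn k / 2) ^ 2 * x + 2 * (c₀ - sgn k / 2) * c₁ * x
        + (c₀ - sgn k / 2) * (c₂ - sgn k / 2) * (4 * x - n)
        + c₁ * (c₂ - sgn k / 2) * (2 * n - 1)) : False := by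
  refine H.not_rel hβ hi ha hb (norm_pow_expo_le hβ hi k) hY
    (c₀ - sgn k / 2) c₁ (c₂ - sgn k / 2) ?_ hlow
  push_cast
  linear_combination e

end IsTile

/-! ### Approximate relations -/

/-- The pair `(p, p')` is `ε`-close to a pair of points of the square related by `G`. -/
def Near (G : ℂ → ℂ → Prop) (ε : ℝ) (p p' : ℂ) : Prop :=
  ∃ a ∈ Model.Sq, ∃ b ∈ Model.Sq, G a b ∧ Model.nrm (p - a) ≤ ε ∧ Model.nrm (p' - b) ≤ ε

namespace Near

variable {G G' : ℂ → ℂ → Prop} {ε : ℝ} {p p' : ℂ}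

theorem nonneg (hN : Near G ε p p') : 0 ≤ ε := by
  obtain ⟨a, -, b, -, -, h, -⟩ := hN
  exact (Model.nrm_nonneg _).trans h

theorem symm (hN : Near G ε p p') : Near (fun a b => G b a) ε p' p := by
  obtain ⟨a, ha, b, hb, hG, h1, h2⟩ := hN
  exact ⟨b, hb, a, ha, hG, h2, h1⟩

theorem neg (hN : Near G ε (-p) (-p')) : Near (fun a b => G (-a) (-b)) ε p p' := by
  obtain ⟨a, ha, b, hb, hG, h1, h2⟩ := hN
  refine ⟨-a, Model.neg_mem_Sq ha, -b, Model.neg_mem_Sq hb, by simpa using hG, ?_, ?_⟩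
  · rwa [← Model.nrm_neg, show -(p - -a) = -p - a by ring]
  · rwa [← Model.nrm_neg, show -(p' - -b) = -p' - b by ring]

theorem mdl_sub_le (k : Fin 3) (v w : ℂ) :
    Model.nrm (IsTile.mdl k v - IsTile.mdl k w) ≤ 0.992 * Model.nrm (v - w) := by
  fin_cases k
  · exact Model.gm_sub_le v w
  · exact Model.gp_sub_le v w
  · exact Model.gz_sub_le v w

theorem mdl_mem (k : Fin 3) {v : ℂ} (hv : v ∈ Model.Sq) : IsTile.mdl k v ∈ Model.Sq := by
  fin_cases k
  · exact (Model.gm_mem hv).1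
  · exact (Model.gp_mem hv).1
  · exact (Model.gz_mem hv).1

theorem map (k l : Fin 3) (hN : Near G ε p p') (hGG : ∀ a ∈ Model.Sq, ∀ b ∈ Model.Sq, G a b →
    G' (IsTile.mdl k a) (IsTile.mdl l b)) :
    Near G' (0.992 * ε) (IsTile.mdl k p) (IsTile.mdl l p') := by
  obtain ⟨a, ha, b, hb, hG, h1, h2⟩ := hN
  exact ⟨_, mdl_mem k ha, _, mdl_mem l hb, hGG a ha b hb hG,
    (mdl_sub_le k p a).trans (by linarith), (mdl_sub_le l p' b).trans (by linarith)⟩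

/-- Only one point is moved, so the error of the other one stays and no factor is gained. The gain
comes from `map`. -/
theorem map_left (k : Fin 3) (hN : Near G ε p p') (hGG : ∀ a ∈ Model.Sq, ∀ b ∈ Model.Sq, G a b →
    G' (IsTile.mdl k a) b) : Near G' ε (IsTile.mdl k p) p' := by
  have h0 := hN.nonneg
  obtain ⟨a, ha, b, hb, hG, h1, h2⟩ := hN
  exact ⟨_, mdl_mem k ha, _, hb, hGG a ha b hb hG, (mdl_sub_le k p a).trans (by linarith), h2⟩

theorem of_forall_near (hG : IsClosed {x : ℂ × ℂ | G x.1 x.2}) {C : ℝ}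
    (hN : ∀ n : ℕ, Near G (C * 0.992 ^ n) p p') : G p p' := by
  choose a ha b hb hab h1 h2 using hN
  have hlim : Filter.Tendsto (fun n : ℕ => C * (0.992 : ℝ) ^ n) Filter.atTop (nhds 0) := by
    simpa using (tendsto_pow_atTop_nhds_zero_of_lt_one (by norm_num)
      (by norm_num : (0.992 : ℝ) < 1)).const_mul C
  have bound : ∀ v : ℂ, ‖v‖ ≤ Model.nrm v := by
    intro v
    refine (Complex.norm_le_abs_re_add_abs_im v).trans ?_
    have h1 : |4 * v.re + 11 * v.im| ≤ Model.nrm v := le_max_left _ _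
    have h2 : |-21 * v.re + 5 * v.im| ≤ Model.nrm v := le_max_right _ _
    rw [abs_le] at h1 h2
    rcases abs_cases v.re with h3 | h3 <;> rcases abs_cases v.im with h4 | h4 <;> linarith
  have conv : ∀ (x : ℂ) (u : ℕ → ℂ), (∀ n : ℕ, Model.nrm (x - u n) ≤ C * 0.992 ^ n) →
      Filter.Tendsto u Filter.atTop (nhds x) := by
    intro x u hu
    rw [tendsto_iff_norm_sub_tendsto_zero]
    refine squeeze_zero (fun n => norm_nonneg _) (fun n => ?_) hlim
    rw [norm_sub_rev]
    exact (bound _).trans (hu n)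
  exact hG.mem_of_tendsto ((conv p a h1).prodMk_nhds (conv p' b h2))
    (Filter.Eventually.of_forall hab)

/-- The diameter of the square in `nrm` is at most 500, so at this scale every pair is close to any
relation that is non-empty on the square. This starts the induction. -/
theorem of_mem (hp : p ∈ Model.Sq) (hp' : p' ∈ Model.Sq) {a b : ℂ} (ha : a ∈ Model.Sq)
    (hb : b ∈ Model.Sq) (hab : G a b) : Near G 500 p p' := by
  have : ∀ x ∈ Model.Sq, ∀ y ∈ Model.Sq, Model.nrm (x - y) ≤ 500 := by
    rintro x ⟨⟨x1, x2⟩, x3, x4⟩ y ⟨⟨y1, y2⟩, y3, y4⟩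
    rw [Model.nrm, max_le_iff, abs_le, abs_le, Complex.sub_re, Complex.sub_im]
    refine ⟨⟨?_, ?_⟩, ?_, ?_⟩ <;> linarith
  exact ⟨a, ha, b, hb, hab, this p hp a ha, this p' hp' b hb⟩

end Near

/-! ### The neighbour graph of the tile -/

namespace IsTile

variable {β : ℂ} {q : ℝ → ℂ} {h : ℂ → ℂ}

/-- Pairs of points of the square with `h p = Y * h p' + t` are `ε`-close to `G`. -/
def Rel (h : ℂ → ℂ) (ε : ℝ) (Y t : ℂ) (G : ℂ → ℂ → Prop) : Prop :=
  ∀ p ∈ Model.Sq, ∀ p' ∈ Model.Sq, h p = Y * h p' + t → Near G ε p p'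

/-- Opposite points of the vertical sides. -/
def OppH (p p' : ℂ) : Prop := p.re = 9 ∧ p'.re = -9 ∧ p.im = p'.im

/-- Opposite points of the horizontal sides. -/
def OppV (p p' : ℂ) : Prop := p.im = 9 ∧ p'.im = -9 ∧ p.re = p'.re

/-- Points of the bottom and the top side, at a distance. -/
def OppS (p p' : ℂ) : Prop := p.im = -9 ∧ p'.im = 9 ∧ p.re = p'.re + 10

/-- Ends of the rising diagonal. -/
def DiagA (p p' : ℂ) : Prop := p = ⟨9, 9⟩ ∧ p' = ⟨-9, -9⟩

/-- Ends of the falling diagonal. -/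
def DiagB (p p' : ℂ) : Prop := p = ⟨9, -9⟩ ∧ p' = ⟨-9, 9⟩

/-- Pairs identified by the left and the right piece. -/
def GlueLR (p p' : ℂ) : Prop := Model.gm p = Model.gp p'

/-- Pairs identified by the left and the middle piece. -/
def GlueLM (p p' : ℂ) : Prop := Model.gm p = Model.gz p'

/-- The corner `9 - 9i`, twice. -/
def Corner (p p' : ℂ) : Prop := p = ⟨9, -9⟩ ∧ p' = ⟨9, -9⟩

/-- Points of the left and the bottom side with the same parameter. -/
def LeftBot (p p' : ℂ) : Prop := p.re = -9 ∧ p'.im = -9 ∧ p.im = p'.re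

/-- Points of the top and the left side. -/
def TopLeft (p p' : ℂ) : Prop := p.im = 9 ∧ p'.re = -9 ∧ p.re = -5 - 4 * p'.im / 9

/-- The corners `-9 - 9i` and `9 - 9i`. -/
def BotEnds (p p' : ℂ) : Prop := p = ⟨-9, -9⟩ ∧ p' = ⟨9, -9⟩

/-- The approximate description of all pairs that occur. -/
structure Rels (β : ℂ) (h : ℂ → ℂ) (ε : ℝ) : Prop where
  eq : Rel h ε 1 0 Eq
  oppH : Rel h ε 1 1 OppH
  oppV : Rel h ε 1 β OppV
  oppS : Rel h ε 1 (1 - β + β ^ 2) OppS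
  diagA : Rel h ε 1 (1 + β) DiagA
  diagB : Rel h ε 1 (1 - β) DiagB
  glueLR : Rel h ε 1 (β ^ 2 - β) GlueLR

section

variable {ε : ℝ} (hβ : β ^ 3 - 2 * β ^ 2 - 1 = 0) (hi : β.im ≠ 0) (H : IsTile β q h)
  (R : Rels β h ε)
include hβ hi H R

/-- Comparing a piece of factor β with one of factor β³ leaves a relation between D and β²D. This
and the similar lemmas resolve such unequal scales: p is subdivided until both sides have equal
scale. Here only the left piece can contain p, and cancelling β leads back to a vector of `Rels`. -/
theorem Rels.leftBot : Rel h ε β ((β ^ 2 - 1) / 2) LeftBot := by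
  intro p hp p' hp' e
  have h0 := WindowRoot.ne_zero hβ
  have hn := (WindowRoot.norm_bounds hβ hi).2.le
  obtain ⟨k, a, ha, rfl, ea⟩ := H.exists_digit hp
  rw [ea] at e
  by_cases hk : k = 0
  · subst hk
    simp [sgn, expo] at e
    refine (R.oppV a ha p' hp' (mul_left_cancel₀ h0 ?_)).map_left 0 ?_
    · linear_combination e
    · rintro ⟨x, y⟩ ⟨hx, -⟩ b - ⟨h1, h2, h3⟩
      obtain rfl : y = 9 := h1
      show LeftBot (Model.gm _) _
      rw [Model.gm_top x hx.1 hx.2]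
      exact ⟨rfl, h2, h3⟩
  · refine (H.not_digit hβ hi ha hp' (k := k) (c₀ := -1 / 2) (c₁ := 0) (c₂ := 1 / 2) hn ?_
      fun x n _ _ _ _ => ?_).elim
    · rw [e]; push_cast; ring
    · fin_cases k <;> simp [sgn, rad] at hk ⊢ <;> norm_num <;> linarith

theorem Rels.topLeft : Rel h ε β ((-1 + 2 * β - β ^ 2) / 2) TopLeft := by
  intro p hp p' hp' e
  have h0 := WindowRoot.ne_zero hβ
  have hn := (WindowRoot.norm_bounds hβ hi).2.le
  obtain ⟨k, a, ha, rfl, ea⟩ := H.exists_digit hp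
  rw [ea] at e
  by_cases hk : k = 0
  · subst hk
    simp [sgn, expo] at e
    refine (R.oppH a ha p' hp' (mul_left_cancel₀ h0 ?_)).map_left 0 ?_
    · linear_combination e
    · rintro ⟨x, y⟩ ⟨-, hy⟩ b - ⟨h1, h2, h3⟩
      obtain rfl : x = 9 := h1
      show TopLeft (Model.gm _) _
      rw [Model.gm_right y hy.1 hy.2]
      exact ⟨rfl, h2, by dsimp only at h3; rw [h3]⟩
  · refine (H.not_digit hβ hi ha hp' (k := k) (c₀ := -1 / 2) (c₁ := 1) (c₂ := -1 / 2) hn ?_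
      fun x n _ _ _ _ => ?_).elim
    · rw [e]; push_cast; ring
    · fin_cases k <;> simp [sgn, rad] at hk ⊢ <;> norm_num <;> linarith

theorem Rels.botEnds : Rel h ε β ((-1 - 2 * β + β ^ 2) / 2) BotEnds := by
  intro p hp p' hp' e
  have h0 := WindowRoot.ne_zero hβ
  have hn := (WindowRoot.norm_bounds hβ hi).2.le
  obtain ⟨k, a, ha, rfl, ea⟩ := H.exists_digit hp
  rw [ea] at e
  by_cases hk : k = 0
  · subst hk
    simp [sgn, expo] at e
    refine (R.diagB p' hp' a ha (mul_left_cancel₀ h0 ?_)).symm.map_left 0 ?_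
    · linear_combination -e
    · rintro a - b - ⟨rfl, rfl⟩
      refine ⟨(Model.gm_left 9 (by norm_num) le_rfl).trans ?_, rfl⟩
      exact congrArg (Complex.mk · (-9)) (by norm_num)
  · refine (H.not_digit hβ hi ha hp' (k := k) (c₀ := -1 / 2) (c₁ := -1) (c₂ := 1 / 2) hn ?_
      fun x n _ _ _ _ => ?_).elim
    · rw [e]; push_cast; ring
    · fin_cases k <;> simp [sgn, rad] at hk ⊢ <;> norm_num <;> linarith

theorem Rels.corner : Rel h ε (β ^ 2) ((2 - β + β ^ 2) / 2) Corner := by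
  intro p hp p' hp' e
  have h0 := WindowRoot.ne_zero hβ
  have hn : ‖β ^ 2‖ ≤ 0.4535 := by rw [norm_pow]; exact (WindowRoot.normSq_bounds hβ hi).2.le
  obtain ⟨k, a, ha, rfl, ea⟩ := H.exists_digit hp
  rw [ea] at e
  by_cases hk : k = 1
  · subst hk
    simp [sgn, expo] at e
    refine (R.botEnds hβ hi H a ha p' hp' (mul_left_cancel₀ h0 ?_)).map_left 1 ?_
    · linear_combination e - hβ / 2
    · rintro a - b - ⟨rfl, rfl⟩
      exact ⟨Model.gp_left (-9) le_rfl (by norm_num) |>.trans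
        (congrArg (Complex.mk · (-9)) (by norm_num)), rfl⟩
  · refine (H.not_digit hβ hi ha hp' (k := k) (c₀ := 1) (c₁ := -1 / 2) (c₂ := 1 / 2) hn ?_
      fun x n _ _ _ _ => ?_).elim
    · rw [e]; push_cast; ring
    · fin_cases k <;> simp [sgn, rad] at hk ⊢ <;> norm_num <;> linarith

/-- The only relation of unequal scale in which p can lie in any of the three pieces. The overlap of
the left and the middle piece is a broken line, of which the pieces give the two segments and an end
point. -/
theorem Rels.glueLM : Rel h ε (β ^ 2) ((β ^ 2 - β) / 2) GlueLM := by
  intro p hp p' hp' e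
  have h0 := WindowRoot.ne_zero hβ
  obtain ⟨k, a, ha, rfl, ea⟩ := H.exists_digit hp
  rw [ea] at e
  fin_cases k <;> simp [sgn, expo] at e
  · refine (R.leftBot hβ hi H a ha p' hp' (mul_left_cancel₀ h0 ?_)).map_left 0 ?_
    · linear_combination e - hβ / 2
    · rintro ⟨x, w⟩ ⟨-, h1, h2⟩ ⟨w', y⟩ - ⟨h3, h4, h5⟩
      dsimp only at h1 h2 h3 h4 h5
      subst h3 h4 h5
      show Model.gm (Model.gm _) = Model.gz _
      rw [Model.gm_left _ h1 h2, Model.gm_bot₁ _ (by linarith) (by linarith)]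
      apply Complex.ext <;> simp only [Model.gz] <;> ring
  · refine (R.topLeft hβ hi H a ha p' hp' (mul_left_cancel₀ h0 ?_)).map_left 1 ?_
    · linear_combination e + hβ / 2
    · rintro ⟨x, y⟩ - ⟨x', y'⟩ ⟨-, h1, h2⟩ ⟨h3, h4, h5⟩
      dsimp only at h1 h2 h3 h4 h5
      subst h3 h4 h5
      show Model.gm (Model.gp _) = Model.gz _
      rw [Model.gp_top₃ _ (by linarith) (by linarith), Model.gm_bot₂ _ (by linarith) (by linarith)]
      apply Complex.ext <;> simp only [Model.gz] <;> ring
  · refine (R.botEnds hβ hi H p' hp' a ha (mul_left_cancel₀ (pow_ne_zero 2 h0) ?_)).symm.map_left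
      2 ?_
    · linear_combination -e - (β / 2) * hβ
    · rintro a - b - ⟨rfl, rfl⟩
      show Model.gm (Model.gz _) = Model.gz _
      rw [show Model.gz ⟨9, -9⟩ = ⟨-1, -9⟩ by apply Complex.ext <;> norm_num [Model.gz],
        Model.gm_bot₁ _ (by norm_num) (by norm_num)]
      apply Complex.ext <;> norm_num [Model.gz]

/-- For each vector t and each pair of pieces, dividing by a power of β gives either a vector of the
list, directly or through a relation of unequal scale, or a vector that is too long. In the first
case the model maps carry the relation of the preimages to that of the points, and shrink the error.
-/
theorem Rels.step : Rels β h (0.992 * ε) := by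
  have h0 := WindowRoot.ne_zero hβ
  refine ⟨?_, ?_, ?_, ?_, ?_, ?_, ?_⟩ <;> intro p hp p' hp' e <;>
    obtain ⟨k, a, ha, rfl, ea⟩ := H.exists_digit hp <;>
    obtain ⟨l, b, hb, rfl, eb⟩ := H.exists_digit hp' <;> rw [ea, eb] at e <;> clear ea eb
  · fin_cases k <;> fin_cases l <;> simp [sgn, expo] at e
    · refine (R.eq a ha b hb ?_).map 0 0 ?_
      · rw [(e : h a = h b ∨ β = 0).resolve_right h0]; ring
      · rintro a - b - rfl; rfl
    · refine (R.glueLR a ha b hb (mul_left_cancel₀ h0 ?_)).map 0 1 fun a _ b _ hG => hG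
      linear_combination e - hβ
    · refine (R.glueLM hβ hi H a ha b hb (mul_left_cancel₀ h0 ?_)).map 0 2 fun a _ b _ hG => hG
      linear_combination e - hβ / 2
    · refine (R.glueLR b hb a ha (mul_left_cancel₀ h0 ?_)).symm.map 1 0 fun a _ b _ hG =>
        Eq.symm hG
      linear_combination -e - hβ
    · refine (R.eq a ha b hb ?_).map 1 1 ?_
      · rw [(e : h a = h b ∨ β = 0).resolve_right h0]; ring
      · rintro a - b - rfl; rfl
    · refine (R.glueLM hβ hi H (-a) (Model.neg_mem_Sq ha) (-b) (Model.neg_mem_Sq hb)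
        (mul_left_cancel₀ h0 ?_)).neg.map 1 2 fun a _ b _ hG => ?_
      · rw [H.odd _ ha, H.odd _ hb]
        linear_combination -e - hβ / 2
      · have : Model.gm (-a) = Model.gz (-b) := hG
        rwa [Model.gm_neg, Model.gz_neg, neg_inj] at this
    · refine (R.glueLM hβ hi H b hb a ha (mul_left_cancel₀ h0 ?_)).symm.map 2 0 fun a _ b _ hG =>
        Eq.symm hG
      linear_combination -e - hβ / 2
    · refine (R.glueLM hβ hi H (-b) (Model.neg_mem_Sq hb) (-a) (Model.neg_mem_Sq ha)
        (mul_left_cancel₀ h0 ?_)).neg.symm.map 2 1 fun a _ b _ hG => ?_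
      · rw [H.odd _ ha, H.odd _ hb]
        linear_combination e - hβ / 2
      · have : Model.gm (-b) = Model.gz (-a) := hG
        rw [Model.gm_neg, Model.gz_neg, neg_inj] at this
        exact this.symm
    · refine (R.eq a ha b hb ?_).map 2 2 ?_
      · rw [(e : h a = h b ∨ β = 0).resolve_right h0]; ring
      · rintro a - b - rfl; rfl
  -- For t = 1 only the right piece of p and the left piece of p' are close enough; their vector is
  -- −β, a reversed vertical neighbour.
  · by_cases hkl : k = 1 ∧ l = 0
    · obtain ⟨rfl, rfl⟩ := hkl
      simp [sgn, expo] at e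
      refine (R.oppV b hb a ha (mul_left_cancel₀ h0 ?_)).symm.map 1 0 ?_
      · linear_combination -e
      · rintro ⟨x, y⟩ ⟨hx, -⟩ ⟨x', y'⟩ - ⟨h1, h2, h3⟩
        dsimp only at h1 h2 h3
        subst h1 h2 h3
        show OppH (Model.gp _) (Model.gm _)
        rw [Model.gp_bot _ hx.1 hx.2, Model.gm_top _ hx.1 hx.2]
        exact ⟨rfl, rfl, rfl⟩
    · refine (H.not_digits hβ hi ha hb (k := k) (l := l) (c₀ := 1) (c₁ := 0) (c₂ := 0) ?_
        fun x n _ _ _ _ => ?_).elim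
      · rw [e]; push_cast; ring
      · fin_cases k <;> fin_cases l <;> simp [sgn, rad] at hkl ⊢ <;> norm_num <;> linarith
  · by_cases hkl : (k = 1 ∧ l = 0) ∨ (k = 1 ∧ l = 2) ∨ (k = 2 ∧ l = 0) ∨ (k = 2 ∧ l = 2)
    · refine (H.not_digits hβ hi ha hb (k := k) (l := l) (c₀ := 0) (c₁ := 1) (c₂ := 0) ?_
        fun x n _ _ _ _ => ?_).elim
      · rw [e]; push_cast; ring
      · rcases hkl with ⟨rfl, rfl⟩ | ⟨rfl, rfl⟩ | ⟨rfl, rfl⟩ | ⟨rfl, rfl⟩ <;>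
          simp [sgn, rad] <;> norm_num <;> linarith
    · fin_cases k <;> fin_cases l <;> simp [sgn, expo] at hkl e
      · refine (R.oppH a ha b hb (mul_left_cancel₀ h0 ?_)).map 0 0 ?_
        · linear_combination e
        · rintro ⟨x, y⟩ ⟨-, hy⟩ ⟨x', y'⟩ - ⟨h1, h2, h3⟩
          dsimp only at h1 h2 h3
          subst h1 h2 h3
          show OppV (Model.gm _) (Model.gm _)
          rw [Model.gm_right _ hy.1 hy.2, Model.gm_left _ hy.1 hy.2]
          exact ⟨rfl, rfl, rfl⟩
      · refine (R.oppS a ha b hb (mul_left_cancel₀ h0 ?_)).map 0 1 ?_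
        · linear_combination e - hβ
        · rintro ⟨x, y⟩ ⟨hx, -⟩ ⟨x', y'⟩ ⟨hx', -⟩ ⟨h1, h2, h3⟩
          dsimp only at h1 h2 h3 hx hx'
          subst h1 h2 h3
          show OppV (Model.gm _) (Model.gp _)
          rw [Model.gm_bot₃ _ (by linarith) (by linarith),
            Model.gp_top₃ _ (by linarith) (by linarith)]
          exact ⟨rfl, rfl, by ring⟩
      · refine (R.corner hβ hi H a ha b hb (mul_left_cancel₀ h0 ?_)).map 0 2 ?_
        · linear_combination e - hβ / 2
        · rintro a - b - ⟨rfl, rfl⟩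
          show OppV (Model.gm _) (Model.gz _)
          rw [Model.gm_right _ (by norm_num) (by norm_num)]
          norm_num [OppV, Model.gz]
      · refine (R.oppH a ha b hb (mul_left_cancel₀ h0 ?_)).map 1 1 ?_
        · linear_combination e
        · rintro ⟨x, y⟩ ⟨-, hy⟩ ⟨x', y'⟩ - ⟨h1, h2, h3⟩
          dsimp only at h1 h2 h3
          subst h1 h2 h3
          show OppV (Model.gp _) (Model.gp _)
          rw [Model.gp_right _ hy.1 hy.2, Model.gp_left _ hy.1 hy.2]
          exact ⟨rfl, rfl, rfl⟩
      · refine (R.corner hβ hi H (-b) (Model.neg_mem_Sq hb) (-a) (Model.neg_mem_Sq ha)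
          (mul_left_cancel₀ h0 ?_)).symm.neg.map 2 1 ?_
        · rw [H.odd _ ha, H.odd _ hb]
          linear_combination e - hβ / 2
        · rintro a - b - ⟨h1, h2⟩
          obtain rfl : a = -⟨9, -9⟩ := by rw [← h2, neg_neg]
          obtain rfl : b = -⟨9, -9⟩ := by rw [← h1, neg_neg]
          show OppV (Model.gz _) (Model.gp _)
          rw [Model.gz_neg, Model.gp_neg, Model.gm_right _ (by norm_num) (by norm_num)]
          norm_num [OppV, Model.gz]
  · by_cases hkl : k = 1 ∧ l = 0
    · obtain ⟨rfl, rfl⟩ := hkl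
      simp [sgn, expo] at e
      refine (R.oppH b hb a ha (mul_left_cancel₀ h0 ?_)).symm.map 1 0 ?_
      · linear_combination -e
      · rintro ⟨x, y⟩ ⟨-, hy⟩ ⟨x', y'⟩ - ⟨h1, h2, h3⟩
        dsimp only at h1 h2 h3
        subst h1 h2 h3
        show OppS (Model.gp _) (Model.gm _)
        rw [Model.gp_left _ hy.1 hy.2, Model.gm_right _ hy.1 hy.2]
        exact ⟨rfl, rfl, by ring⟩
    · refine (H.not_digits hβ hi ha hb (k := k) (l := l) (c₀ := 1) (c₁ := -1) (c₂ := 1) ?_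
        fun x n _ _ _ _ => ?_).elim
      · rw [e]; push_cast; ring
      · fin_cases k <;> fin_cases l <;> simp [sgn, rad] at hkl ⊢ <;> norm_num <;> linarith
  · by_cases hkl : k = 1 ∧ l = 0
    · obtain ⟨rfl, rfl⟩ := hkl
      simp [sgn, expo] at e
      refine (R.diagB a ha b hb (mul_left_cancel₀ h0 ?_)).map 1 0 ?_
      · linear_combination e
      · rintro a - b - ⟨rfl, rfl⟩
        refine ⟨Model.gp_bot 9 (by norm_num) le_rfl, ?_⟩
        exact (Model.gm_left 9 (by norm_num) le_rfl).trans
          (congrArg (Complex.mk · (-9)) (by norm_num))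
    · refine (H.not_digits hβ hi ha hb (k := k) (l := l) (c₀ := 1) (c₁ := 1) (c₂ := 0) ?_
        fun x n _ _ _ _ => ?_).elim
      · rw [e]; push_cast; ring
      · fin_cases k <;> fin_cases l <;> simp [sgn, rad] at hkl ⊢ <;> norm_num <;> linarith
  · by_cases hkl : k = 1 ∧ l = 0
    · obtain ⟨rfl, rfl⟩ := hkl
      simp [sgn, expo] at e
      refine (R.diagA b hb a ha (mul_left_cancel₀ h0 ?_)).symm.map 1 0 ?_
      · linear_combination -e
      · rintro a - b - ⟨rfl, rfl⟩
        exact ⟨Model.gp_bot (-9) le_rfl (by norm_num), Model.gm_top 9 (by norm_num) le_rfl⟩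
    · refine (H.not_digits hβ hi ha hb (k := k) (l := l) (c₀ := 1) (c₁ := -1) (c₂ := 0) ?_
        fun x n _ _ _ _ => ?_).elim
      · rw [e]; push_cast; ring
      · fin_cases k <;> fin_cases l <;> simp [sgn, rad] at hkl ⊢ <;> norm_num <;> linarith
  -- The left and the right piece share just two points. They come from the same corner pair, placed
  -- in the left pieces or in the right pieces.
  · by_cases hkl : (k = 0 ∧ l = 0) ∨ (k = 1 ∧ l = 1)
    · rcases hkl with ⟨rfl, rfl⟩ | ⟨rfl, rfl⟩ <;> simp [sgn, expo] at e
      · refine (R.diagB b hb a ha (mul_left_cancel₀ h0 ?_)).symm.map 0 0 ?_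
        · linear_combination -e
        · rintro a - b - ⟨rfl, rfl⟩
          show Model.gm (Model.gm _) = Model.gp (Model.gm _)
          rw [Model.gm_left _ (by norm_num) (by norm_num),
            Model.gm_right _ (by norm_num) (by norm_num),
            Model.gm_bot₁ _ (by norm_num) (by norm_num),
            Model.gp_top₃ _ (by norm_num) (by norm_num)]
          norm_num
      · refine (R.diagB b hb a ha (mul_left_cancel₀ h0 ?_)).symm.map 1 1 ?_
        · linear_combination -e
        · rintro a - b - ⟨rfl, rfl⟩
          show Model.gm (Model.gp _) = Model.gp (Model.gp _)
          rw [Model.gp_left _ (by norm_num) (by norm_num),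
            Model.gp_right _ (by norm_num) (by norm_num),
            Model.gm_bot₃ _ (by norm_num) (by norm_num),
            show (5 - 4 * -9 / 9 : ℝ) = 9 by norm_num,
            Model.gp_right _ (by norm_num) (by norm_num)]
          norm_num
    · refine (H.not_digits hβ hi ha hb (k := k) (l := l) (c₀ := 0) (c₁ := -1) (c₂ := 1) ?_
        fun x n _ _ _ _ => ?_).elim
      · rw [e]; push_cast; ring
      · fin_cases k <;> fin_cases l <;> simp [sgn, rad] at hkl ⊢ <;> norm_num <;> linarith

end

end IsTile

/-! ### Bounded perturbations of the identity of the plane -/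

/-- There is no continuous logarithm on the circle. -/
theorem not_exists_log_circle {g : ℝ → ℂ} (hg : Continuous g)
    (hexp : ∀ θ : ℝ, Complex.exp (g θ) = Complex.exp (θ * Complex.I))
    (hper : g (2 * Real.pi) = g 0) : False := by
  have hmem : ∀ θ : ℝ, ∃ n : ℤ, g θ = θ * Complex.I + n * (2 * Real.pi * Complex.I) := fun θ =>
    Complex.exp_eq_exp_iff_exists_int.1 (hexp θ)
  choose n hn using hmem
  have hpi := Real.pi_pos
  have hn' : ∀ θ, (n θ : ℝ) = ((g θ).im - θ) / (2 * Real.pi) := by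
    intro θ
    have := congrArg Complex.im (hn θ)
    simp at this
    rw [this]
    field_simp
    ring
  have hcont : Continuous fun θ => (n θ : ℝ) := by
    simp only [hn']
    fun_prop
  have hnc : Continuous n := Int.isClosedEmbedding_coe_real.continuous_iff.2 hcont
  -- The winding index is continuous and integer-valued, hence constant, but one turn of θ with g
  -- unchanged lowers it by 1.
  have hconst := PreconnectedSpace.constant inferInstance hnc (x := 0) (y := 2 * Real.pi)
  have h1 := hn' 0
  have h2 := hn' (2 * Real.pi)
  rw [hper, ← hconst, h1] at h2
  field_simp at h2
  linarith

/-- If c were omitted, F − c would have a continuous logarithm on the plane. On a large circle (F(w)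
− c)/w stays within distance 1 of 1, so its principal logarithm is continuous. Subtracting it and
log R would leave a continuous logarithm of the identity of the unit circle. -/
theorem surjective_of_norm_sub_le {F : ℂ → ℂ} (hF : Continuous F) {C : ℝ}
    (hC : ∀ w, ‖F w - w‖ ≤ C) : Function.Surjective F := by
  intro c
  by_contra hc
  push Not at hc
  have hsc : IsSimplyConnected (Set.univ : Set ℂ) := by
    exact (Homeomorph.Set.univ ℂ).toHomotopyEquiv.simplyConnectedSpace
  obtain ⟨L, hL, hexp⟩ := Complex.exists_continuousOn_eqOn_exp_comp hsc isOpen_univ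
    (g := fun w => F w - c) (by fun_prop) (by
      rintro ⟨w, -, hw⟩
      exact hc w (sub_eq_zero.1 hw))
  rw [continuousOn_univ] at hL
  have hexp' : ∀ w, Complex.exp (L w) = F w - c := fun w => hexp (Set.mem_univ w)
  have hC0 : 0 ≤ C := (norm_nonneg _).trans (hC 0)
  set R : ℝ := C + ‖c‖ + 1 with hR
  have hRpos : 0 < R := by positivity
  let w : ℝ → ℂ := fun θ => R * Complex.exp (θ * Complex.I)
  have hw : ∀ θ, ‖w θ‖ = R := fun θ => by
    simp only [w, norm_mul, Complex.norm_exp_ofReal_mul_I, mul_one, Complex.norm_real,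
      Real.norm_eq_abs, abs_of_pos hRpos]
  have hw0 : ∀ θ, w θ ≠ 0 := fun θ => by
    rw [← norm_ne_zero_iff, hw]; exact hRpos.ne'
  have hslit : ∀ θ, (F (w θ) - c) / w θ ∈ Complex.slitPlane := by
    intro θ
    left
    have h1 : ‖(F (w θ) - c) / w θ - 1‖ < 1 := by
      rw [show (F (w θ) - c) / w θ - 1 = (F (w θ) - w θ - c) / w θ by
        field_simp [hw0 θ]; ring, norm_div, hw, div_lt_one hRpos]
      have := norm_sub_le (F (w θ) - w θ) c
      have := hC (w θ)
      linarith
    have h2 := Complex.abs_re_le_norm ((F (w θ) - c) / w θ - 1)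
    rw [Complex.sub_re, Complex.one_re] at h2
    have := neg_abs_le (((F (w θ) - c) / w θ).re - 1)
    linarith
  have hwc : Continuous w := by fun_prop
  refine not_exists_log_circle
    (g := fun θ => L (w θ) - Complex.log ((F (w θ) - c) / w θ) - Complex.log R) ?_ ?_ ?_
  · refine ((hL.comp hwc).sub (Continuous.clog ?_ hslit)).sub continuous_const
    exact ((hF.comp hwc).sub continuous_const).div hwc hw0
  · intro θ
    have hne : F (w θ) - c ≠ 0 := sub_ne_zero.2 (hc _)
    have hR' : (R : ℂ) ≠ 0 := by exact_mod_cast hRpos.ne'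
    rw [Complex.exp_sub, Complex.exp_sub, hexp', Complex.exp_log (div_ne_zero hne (hw0 θ)),
      Complex.exp_log hR', div_div_cancel₀ hne]
    simp only [w]
    field_simp
  · have : w (2 * Real.pi) = w 0 := by
      simp only [w]
      push_cast
      rw [Complex.exp_two_pi_mul_I]
      simp
    simp only [this]

/-- An injective bounded continuous perturbation of the identity is a homeomorphism. -/
theorem isHomeomorph_of_norm_sub_le {F : ℂ → ℂ} (hF : Continuous F) (hinj : Function.Injective F)
    {C : ℝ} (hC : ∀ w, ‖F w - w‖ ≤ C) : IsHomeomorph F := by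
  have hprop : IsProperMap F := by
    refine isProperMap_iff_tendsto_cocompact.2 ⟨hF, ?_⟩
    rw [← Metric.cobounded_eq_cocompact, ← tendsto_norm_atTop_iff_cobounded]
    have h1 : Filter.Tendsto (fun w : ℂ => ‖w‖ - C) (Bornology.cobounded ℂ) Filter.atTop :=
      Filter.tendsto_atTop_add_const_right _ _ tendsto_norm_cobounded_atTop
    refine Filter.tendsto_atTop_mono (fun w => ?_) h1
    have := norm_sub_norm_le w (F w)
    rw [norm_sub_rev] at this
    have := hC w
    linarith
  exact isHomeomorph_iff_continuous_isClosedMap_bijective.2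
    ⟨hF, hprop.isClosedMap, hinj, surjective_of_norm_sub_le hF hC⟩

/-! ### Exact relations -/

namespace IsTile

variable {β : ℂ} {q : ℝ → ℂ} {h : ℂ → ℂ}

theorem rels (hβ : β ^ 3 - 2 * β ^ 2 - 1 = 0) (hi : β.im ≠ 0) (H : IsTile β q h) (n : ℕ) :
    Rels β h (500 * 0.992 ^ n) := by
  have mem : ∀ x y : ℝ, x ∈ Set.Icc (-9 : ℝ) 9 → y ∈ Set.Icc (-9 : ℝ) 9 →
      (⟨x, y⟩ : ℂ) ∈ Model.Sq := fun x y hx hy => ⟨hx, hy⟩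
  have i9 : (9 : ℝ) ∈ Set.Icc (-9 : ℝ) 9 := by norm_num
  have im9 : (-9 : ℝ) ∈ Set.Icc (-9 : ℝ) 9 := by norm_num
  have im1 : (-1 : ℝ) ∈ Set.Icc (-9 : ℝ) 9 := by norm_num
  induction n with
  | zero =>
    rw [pow_zero, mul_one]
    refine ⟨?_, ?_, ?_, ?_, ?_, ?_, ?_⟩ <;> intro p hp p' hp' _
    · exact .of_mem hp hp' hp hp rfl
    · exact .of_mem hp hp' (mem 9 9 i9 i9) (mem (-9) 9 im9 i9) ⟨rfl, rfl, rfl⟩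
    · exact .of_mem hp hp' (mem 9 9 i9 i9) (mem 9 (-9) i9 im9) ⟨rfl, rfl, rfl⟩
    · exact .of_mem hp hp' (mem 9 (-9) i9 im9) (mem (-1) 9 im1 i9) ⟨rfl, rfl, by norm_num⟩
    · exact .of_mem hp hp' (mem 9 9 i9 i9) (mem (-9) (-9) im9 im9) ⟨rfl, rfl⟩
    · exact .of_mem hp hp' (mem 9 (-9) i9 im9) (mem (-9) 9 im9 i9) ⟨rfl, rfl⟩
    · refine .of_mem hp hp' (mem (-9) (-9) im9 im9) (mem (-1) 9 im1 i9) ?_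
      rw [GlueLR, Model.gm_bot₁ _ (by norm_num) (by norm_num),
        Model.gp_top₃ _ (by norm_num) (by norm_num)]
      norm_num
  | succ n ih =>
    have := ih.step hβ hi H
    rwa [show (0.992 : ℝ) * (500 * 0.992 ^ n) = 500 * 0.992 ^ (n + 1) by ring] at this

variable (hβ : β ^ 3 - 2 * β ^ 2 - 1 = 0) (hi : β.im ≠ 0) (H : IsTile β q h) {p p' : ℂ}
  (hp : p ∈ Model.Sq) (hp' : p' ∈ Model.Sq)
include hβ hi H hp hp'

theorem eq_of_eq (e : h p = h p') : p = p' :=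
  Near.of_forall_near (isClosed_eq continuous_fst continuous_snd) fun n =>
    (H.rels hβ hi n).eq p hp p' hp' (by rw [e]; ring)

theorem oppH_of_eq (e : h p = h p' + 1) : OppH p p' := by
  refine Near.of_forall_near (C := 500) ?_ fun n =>
    (H.rels hβ hi n).oppH p hp p' hp' (by rw [e]; ring)
  simp only [OppH, Set.ofPred_and]
  refine .inter ?_ (.inter ?_ ?_) <;> exact isClosed_eq (by fun_prop) (by fun_prop)

theorem oppV_of_eq (e : h p = h p' + β) : OppV p p' := by
  refine Near.of_forall_near (C := 500) ?_ fun n =>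
    (H.rels hβ hi n).oppV p hp p' hp' (by rw [e]; ring)
  simp only [OppV, Set.ofPred_and]
  refine .inter ?_ (.inter ?_ ?_) <;> exact isClosed_eq (by fun_prop) (by fun_prop)

theorem diagA_of_eq (e : h p = h p' + (1 + β)) : DiagA p p' := by
  refine Near.of_forall_near (C := 500) ?_ fun n =>
    (H.rels hβ hi n).diagA p hp p' hp' (by rw [e]; ring)
  simp only [DiagA, Set.ofPred_and]
  refine .inter ?_ ?_ <;> exact isClosed_eq (by fun_prop) (by fun_prop)

theorem diagB_of_eq (e : h p = h p' + (1 - β)) : DiagB p p' := by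
  refine Near.of_forall_near (C := 500) ?_ fun n =>
    (H.rels hβ hi n).diagB p hp p' hp' (by rw [e]; ring)
  simp only [DiagB, Set.ofPred_and]
  refine .inter ?_ ?_ <;> exact isClosed_eq (by fun_prop) (by fun_prop)

/-- The vector 2β is shorter than 1.4, so the norm bound alone does not exclude it, but one level of
subdivision does. -/
theorem ne_add_two_mul : h p ≠ h p' + 2 * β := by
  intro e
  obtain ⟨k, a, ha, rfl, ea⟩ := H.exists_digit hp
  obtain ⟨l, b, hb, rfl, eb⟩ := H.exists_digit hp'
  rw [ea, eb] at e
  refine H.not_digits hβ hi ha hb (k := k) (l := l) (c₀ := 0) (c₁ := 2) (c₂ := 0) ?_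
    fun x n _ _ _ _ => ?_
  · rw [e]; push_cast; ring
  · fin_cases k <;> fin_cases l <;> simp [sgn, rad] <;> norm_num <;> linarith

/-- Two points of the square whose images differ by a vector of `ℤ + ℤ β` differ by the
corresponding vector of the model lattice. -/
theorem eq_add_of_eq (a b : ℤ) (e : h p = h p' + (a + b * β)) :
    p = p' + 18 * (a + b * Complex.I) := by
  -- Two points of the tile are at most 1.4 apart. This forces |a| ≤ 1 and |b| ≤ 2, and the
  -- remaining vectors are the neighbours treated above, ±2β, or still too long.
  have hab : (a : ℝ) ^ 2 + b ^ 2 * ‖β‖ ^ 2 + 2 * a * b * β.re ≤ 1.96 := by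
    have h1 := WindowRoot.normSq_quad hβ hi a b 0
    have h2 : ‖((a : ℝ) + (b : ℝ) * β + (0 : ℝ) * β ^ 2 : ℂ)‖ ≤ 1.4 := by
      rw [show ((a : ℝ) + (b : ℝ) * β + (0 : ℝ) * β ^ 2 : ℂ) = h p - h p' by
        rw [e]; push_cast; ring]
      refine (norm_sub_le _ _).trans ?_
      linarith [H.norm_le hβ hi hp, H.norm_le hβ hi hp']
    have h3 := norm_nonneg ((a : ℝ) + (b : ℝ) * β + (0 : ℝ) * β ^ 2 : ℂ)
    nlinarith
  have hx := WindowRoot.re_bounds hβ hi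
  have hn := WindowRoot.normSq_bounds hβ hi
  have ha : (a : ℝ) ^ 2 < 4 := by
    nlinarith [sq_nonneg ((b : ℝ) + a * β.re / 0.453), sq_nonneg (a : ℝ), sq_nonneg (b : ℝ),
      mul_nonneg (sq_nonneg (b : ℝ)) (by linarith : 0 ≤ ‖β‖ ^ 2 - 0.453),
      mul_nonneg (sq_nonneg (a : ℝ)) (by nlinarith : 0 ≤ 0.02 - β.re ^ 2)]
  have hb : (b : ℝ) ^ 2 < 9 := by
    nlinarith [sq_nonneg ((a : ℝ) + b * β.re), sq_nonneg (a : ℝ), sq_nonneg (b : ℝ),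
      mul_nonneg (sq_nonneg (b : ℝ)) (by linarith : 0 ≤ ‖β‖ ^ 2 - 0.453),
      mul_nonneg (sq_nonneg (b : ℝ)) (by nlinarith : 0 ≤ 0.02 - β.re ^ 2)]
  have ha' : a ^ 2 < 4 := by exact_mod_cast ha
  have hb' : b ^ 2 < 9 := by exact_mod_cast hb
  have a1 : -2 < a := by nlinarith
  have a2 : a < 2 := by nlinarith
  have b1 : -3 < b := by nlinarith
  have b2 : b < 3 := by nlinarith
  clear ha hb ha' hb'
  interval_cases a <;> interval_cases b <;> norm_num at hab e
  · linarith
  · obtain ⟨rfl, rfl⟩ := H.diagA_of_eq hβ hi hp' hp (by rw [e]; ring)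
    apply Complex.ext <;> norm_num
  · obtain ⟨h1, h2, h3⟩ := H.oppH_of_eq hβ hi hp' hp (by rw [e]; ring)
    apply Complex.ext <;> norm_num <;> linarith
  · obtain ⟨rfl, rfl⟩ := H.diagB_of_eq hβ hi hp' hp (by rw [e]; ring)
    apply Complex.ext <;> norm_num
  · linarith
  · exact (H.ne_add_two_mul hβ hi hp' hp (by rw [e]; ring)).elim
  · obtain ⟨h1, h2, h3⟩ := H.oppV_of_eq hβ hi hp' hp (by rw [e]; ring)
    apply Complex.ext <;> norm_num <;> linarith
  · simpa using H.eq_of_eq hβ hi hp hp' e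
  · obtain ⟨h1, h2, h3⟩ := H.oppV_of_eq hβ hi hp hp' e
    apply Complex.ext <;> norm_num <;> linarith
  · exact (H.ne_add_two_mul hβ hi hp hp' e).elim
  · linarith
  · obtain ⟨rfl, rfl⟩ := H.diagB_of_eq hβ hi hp hp' (by rw [e]; ring)
    apply Complex.ext <;> norm_num
  · obtain ⟨h1, h2, h3⟩ := H.oppH_of_eq hβ hi hp hp' e
    apply Complex.ext <;> norm_num <;> linarith
  · obtain ⟨rfl, rfl⟩ := H.diagA_of_eq hβ hi hp hp' e
    apply Complex.ext <;> norm_num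
  · linarith

end IsTile

/-! ### The extension of the parametrization to the plane -/

namespace Model

theorem isClosed_Sq : IsClosed Sq := isCompact_Sq.isClosed

/-- The translates of the square cover the plane. -/
theorem exists_sub_mem_Sq (z : ℂ) :
    ∃ a b : ℤ, z - 18 * (a + b * Complex.I) ∈ Sq := by
  refine ⟨round (z.re / 18), round (z.im / 18), ?_⟩
  have h1 := abs_le.1 (abs_sub_round (z.re / 18))
  have h2 := abs_le.1 (abs_sub_round (z.im / 18))
  refine ⟨⟨?_, ?_⟩, ?_, ?_⟩ <;> simp <;> linarith

theorem locallyFinite_Sq :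
    LocallyFinite fun i : ℤ × ℤ => {z : ℂ | z - 18 * (i.1 + i.2 * Complex.I) ∈ Sq} := by
  intro z
  refine ⟨Metric.ball z 1, Metric.ball_mem_nhds z one_pos, ?_⟩
  refine ((Set.finite_Icc (⌈(z.re - 10) / 18⌉) (⌊(z.re + 10) / 18⌋)).prod
    (Set.finite_Icc (⌈(z.im - 10) / 18⌉) (⌊(z.im + 10) / 18⌋))).subset ?_
  rintro ⟨a, b⟩ ⟨w, ⟨⟨h1, h2⟩, h3, h4⟩, h5⟩
  rw [Metric.mem_ball, dist_eq_norm] at h5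
  have h6 := abs_le.1 ((Complex.abs_re_le_norm (w - z)).trans h5.le)
  have h7 := abs_le.1 ((Complex.abs_im_le_norm (w - z)).trans h5.le)
  simp at h1 h2 h3 h4 h6 h7
  refine ⟨⟨Int.ceil_le.2 ?_, Int.le_floor.2 ?_⟩, Int.ceil_le.2 ?_, Int.le_floor.2 ?_⟩ <;>
    dsimp only <;> linarith

end Model

namespace IsTile

variable {β : ℂ} {q : ℝ → ℂ} {h : ℂ → ℂ}

theorem top (hq : IsArc β q) (H : IsTile β q h) {x : ℝ} (hx : x ∈ Set.Icc (-9 : ℝ) 9) :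
    h ⟨x, 9⟩ = q x + β / 2 := by
  have hx' : -x ∈ Set.Icc (-9 : ℝ) 9 := ⟨by linarith [hx.2], by linarith [hx.1]⟩
  have e := H.odd ⟨-x, -9⟩ ⟨hx', by norm_num⟩
  rw [H.bot _ hx', hq.odd x hx, show -(⟨-x, -9⟩ : ℂ) = ⟨x, 9⟩ by apply Complex.ext <;> simp] at e
  rw [e]
  ring

theorem right (hq : IsArc β q) (H : IsTile β q h) {y : ℝ} (hy : y ∈ Set.Icc (-9 : ℝ) 9) :
    h ⟨9, y⟩ = β * q y + 1 / 2 := by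
  have hy' : -y ∈ Set.Icc (-9 : ℝ) 9 := ⟨by linarith [hy.2], by linarith [hy.1]⟩
  have e := H.odd ⟨-9, -y⟩ ⟨by norm_num, hy'⟩
  rw [H.left _ hy', hq.odd y hy, show -(⟨-9, -y⟩ : ℂ) = ⟨9, y⟩ by apply Complex.ext <;> simp] at e
  rw [e]
  ring

/-- Compatibility of the tile with the translations of the model lattice, in one direction. -/
theorem apply_add_re (hq : IsArc β q) (H : IsTile β q h) {p p' : ℂ} (hp : p ∈ Model.Sq)
    (hp' : p' ∈ Model.Sq) (a : ℤ) (him : p'.im = p.im) (hre : p'.re = p.re + 18 * a) :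
    h p = h p' - a := by
  obtain ⟨x, y⟩ := p
  obtain ⟨x', y'⟩ := p'
  obtain ⟨⟨h1, h2⟩, hy⟩ := hp
  obtain ⟨⟨h3, h4⟩, -⟩ := hp'
  dsimp only at *
  subst him hre
  have a1 : a < 2 := by
    have : (a : ℝ) < 2 := by linarith
    exact_mod_cast this
  have a2 : -2 < a := by
    have : (-2 : ℝ) < a := by linarith
    exact_mod_cast this
  interval_cases a <;> norm_num at *
  · obtain rfl : x = 9 := by linarith
    norm_num
    rw [H.right hq hy, H.left _ hy]
    ring
  · obtain rfl : x = -9 := by linarith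
    norm_num
    rw [H.right hq hy, H.left _ hy]
    ring

theorem apply_add_im (hq : IsArc β q) (H : IsTile β q h) {p p' : ℂ} (hp : p ∈ Model.Sq)
    (hp' : p' ∈ Model.Sq) (b : ℤ) (hre : p'.re = p.re) (him : p'.im = p.im + 18 * b) :
    h p = h p' - b * β := by
  obtain ⟨x, y⟩ := p
  obtain ⟨x', y'⟩ := p'
  obtain ⟨hx, h1, h2⟩ := hp
  obtain ⟨-, h3, h4⟩ := hp'
  dsimp only at *
  subst him hre
  have a1 : b < 2 := by
    have : (b : ℝ) < 2 := by linarith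
    exact_mod_cast this
  have a2 : -2 < b := by
    have : (-2 : ℝ) < b := by linarith
    exact_mod_cast this
  interval_cases b <;> norm_num at *
  · obtain rfl : y = 9 := by linarith
    norm_num
    rw [H.top hq hx, H.bot _ hx]
    ring
  · obtain rfl : y = -9 := by linarith
    norm_num
    rw [H.top hq hx, H.bot _ hx]
    ring

theorem apply_add (hq : IsArc β q) (H : IsTile β q h) {p p' : ℂ} (hp : p ∈ Model.Sq)
    (hp' : p' ∈ Model.Sq) (a b : ℤ) (e : p' = p + 18 * (a + b * Complex.I)) :
    h p = h p' - (a + b * β) := by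
  have e1 := congrArg Complex.re e
  have e2 := congrArg Complex.im e
  simp at e1 e2
  have hm : (⟨p'.re, p.im⟩ : ℂ) ∈ Model.Sq := ⟨hp'.1, hp.2⟩
  rw [H.apply_add_re hq hp hm a rfl e1, H.apply_add_im hq hm hp' b rfl e2]
  ring

/-- The parametrization of the tile extends to a homeomorphism of the plane that is compatible
with the model lattice and the lattice `ℤ + ℤ β`. -/
theorem exists_plane (hβ : β ^ 3 - 2 * β ^ 2 - 1 = 0) (hi : β.im ≠ 0) (hq : IsArc β q)
    (H : IsTile β q h) : ∃ P : ℂ ≃ₜ ℂ,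
      (∀ p ∈ Model.Sq, ∀ a b : ℤ, P (p + 18 * (a + b * Complex.I)) = h p + (a + b * β)) ∧
      ∀ z, ‖P z - (z.re + z.im * β) / 18‖ ≤ 2 := by
  choose A B hAB using Model.exists_sub_mem_Sq
  -- The choice of the square that contains z does not matter: on common sides and corners
  -- `apply_add` identifies the values. So F is continuous on a locally finite closed cover.
  let F : ℂ → ℂ := fun z => h (z - 18 * (A z + B z * Complex.I)) + (A z + B z * β)
  have hF : ∀ p ∈ Model.Sq, ∀ a b : ℤ, F (p + 18 * (a + b * Complex.I)) = h p + (a + b * β) := by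
    intro p hp a b
    set z := p + 18 * (a + b * Complex.I) with hz
    have := H.apply_add hq hp (hAB z) (a - A z) (b - B z) (by rw [hz]; push_cast; ring)
    rw [this]
    simp only [F]
    push_cast
    ring
  have hcont : Continuous F := by
    refine Model.locallyFinite_Sq.continuous ?_ ?_ ?_
    · refine Set.eq_univ_of_forall fun z => Set.mem_iUnion.2 ⟨(A z, B z), hAB z⟩
    · exact fun i => Model.isClosed_Sq.preimage (by fun_prop)
    · intro i
      have hc : Continuous fun z => h (z - 18 * (i.1 + i.2 * Complex.I)) + (i.1 + i.2 * β) := by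
        have := H.continuous
        fun_prop
      refine hc.continuousOn.congr fun z hz => ?_
      have := hF _ hz i.1 i.2
      rwa [sub_add_cancel] at this
  have hinj : Function.Injective F := by
    intro z z' e
    have := H.eq_add_of_eq hβ hi (hAB z) (hAB z') (A z' - A z) (B z' - B z) (by
      simp only [F] at e
      push_cast
      linear_combination e)
    push_cast at this
    linear_combination this
  have hbound : ∀ z, ‖F z - (z.re + z.im * β) / 18‖ ≤ 2 := by
    intro z
    set p := z - 18 * (A z + B z * Complex.I) with hp
    have e1 := congrArg Complex.re hp
    have e2 := congrArg Complex.im hp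
    simp at e1 e2
    have e : F z - (z.re + z.im * β) / 18 = h p - (p.re / 18 : ℝ) - (p.im / 18 : ℝ) * β := by
      simp only [F]
      rw [← hp, e1, e2]
      push_cast
      ring
    obtain ⟨⟨h1, h2⟩, h3, h4⟩ := hAB z
    rw [← hp] at h1 h2 h3 h4
    have n1 : ‖((p.re / 18 : ℝ) : ℂ)‖ ≤ 1 / 2 := by
      rw [Complex.norm_real, Real.norm_eq_abs, abs_le]
      constructor <;> linarith
    have n2 : ‖((p.im / 18 : ℝ) : ℂ)‖ ≤ 1 / 2 := by
      rw [Complex.norm_real, Real.norm_eq_abs, abs_le]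
      constructor <;> linarith
    have n3 := H.norm_le hβ hi (hAB z)
    rw [← hp] at n3
    rw [e]
    refine (norm_sub_le _ _).trans ?_
    have := norm_sub_le (h p) (p.re / 18 : ℝ)
    rw [norm_mul]
    nlinarith [WindowRoot.norm_bounds hβ hi, norm_nonneg β]
  -- The linear map that takes the model lattice to ℤ + ℤβ. After composition with its inverse, F is
  -- a bounded perturbation of the identity.
  let ℓ : ℂ ≃ₜ ℂ :=
    { toFun := fun z => (z.re + z.im * β) / 18
      invFun := fun w => 18 * ((w.re - w.im / β.im * β.re : ℝ) + (w.im / β.im : ℝ) * Complex.I)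
      left_inv := fun z => by apply Complex.ext <;> simp <;> field_simp <;> ring
      right_inv := fun w => by
        apply Complex.ext <;> simp <;> field_simp; ring
      continuous_toFun := by fun_prop
      continuous_invFun := by fun_prop }
  have hhom : IsHomeomorph (F ∘ ℓ.symm) := by
    refine isHomeomorph_of_norm_sub_le (C := 2) (hcont.comp ℓ.symm.continuous)
      (hinj.comp ℓ.symm.injective) fun w => ?_
    have := hbound (ℓ.symm w)
    rwa [show (((ℓ.symm w).re + (ℓ.symm w).im * β) / 18 : ℂ) = w from ℓ.apply_symm_apply w] at this
  have hF' : ∀ z, (ℓ.trans hhom.homeomorph) z = F z := fun z => by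
    change F (ℓ.symm (ℓ z)) = F z
    rw [ℓ.symm_apply_apply]
  exact ⟨ℓ.trans hhom.homeomorph, fun p hp a b => by rw [hF', hF p hp], fun z => by
    rw [hF']; exact hbound z⟩

end IsTile

/-! ### The column of windows and its two sides -/

namespace Model

/-- The model of the window, the union of the left and the middle piece. -/
def Win : Set ℂ := {p | p ∈ Sq ∧ p.re ≤ 1 ∧ 3 * p.re ≤ 2 * p.im + 15}

/-- The right piece. -/
def RightPiece : Set ℂ := {p | p ∈ Sq ∧ (1 ≤ p.re ∨ 2 * p.im + 15 ≤ 3 * p.re)}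

/-- The part of the plane to the left of the column of right pieces. -/
def LeftPart : Set ℂ := {z | z.re ≤ -9} ∪ ⋃ b : ℤ, {z | z - 18 * (b * Complex.I) ∈ Win}

/-- The part of the plane to the right of the column of windows. -/
def RightPart : Set ℂ := {z | 9 ≤ z.re} ∪ ⋃ b : ℤ, {z | z - 18 * (b * Complex.I) ∈ RightPiece}

theorem image_gm_union_image_gz : gm '' Sq ∪ gz '' Sq = Win := by
  ext p
  constructor
  · rintro (⟨a, ha, rfl⟩ | ⟨a, ha, rfl⟩)
    · obtain ⟨h1, h2⟩ := gm_mem ha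
      refine ⟨h1, ?_⟩
      obtain ⟨⟨h3, h4⟩, h5, h6⟩ := h1
      rcases h2 with h2 | h2 <;> constructor <;> linarith
    · obtain ⟨h1, h2, h3, h4⟩ := gz_mem ha
      exact ⟨h1, h2.2, h4⟩
  · rintro ⟨h1, h2, h3⟩
    by_cases hl : p.re ≤ -1 ∨ 3 * p.re ≤ 2 * p.im - 15
    · obtain ⟨a, ha, e⟩ := exists_gm_eq h1 hl
      exact .inl ⟨a, ha, e⟩
    · push Not at hl
      obtain ⟨a, ha, e⟩ := exists_gz_eq hl.1.le h2 hl.2.le h3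
      exact .inr ⟨a, ha, e⟩

theorem isClosed_Win : IsClosed Win := by
  refine isClosed_Sq.inter (.inter ?_ ?_)
  · exact isClosed_le (f := Complex.re) (g := fun _ => 1) (by fun_prop) (by fun_prop)
  · exact isClosed_le (f := fun p : ℂ => 3 * p.re) (g := fun p : ℂ => 2 * p.im + 15)
      (by fun_prop) (by fun_prop)

theorem isClosed_iUnion_column {s : Set ℂ} (hs : IsClosed s) (hsub : s ⊆ Sq) :
    IsClosed (⋃ b : ℤ, {z : ℂ | z - 18 * (b * Complex.I) ∈ s}) := by
  refine LocallyFinite.isClosed_iUnion ?_ fun b => hs.preimage (by fun_prop)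
  have h1 := locallyFinite_Sq.comp_injective (g := fun b : ℤ => ((0 : ℤ), b))
    fun b b' h => congrArg Prod.snd h
  refine h1.subset fun b z hz => ?_
  simpa using hsub hz

theorem isClosed_LeftPart : IsClosed LeftPart :=
  (isClosed_le (by fun_prop) (by fun_prop)).union
    (isClosed_iUnion_column isClosed_Win fun _ h => h.1)

theorem isClosed_RightPart : IsClosed RightPart := by
  refine (isClosed_le (by fun_prop) (by fun_prop)).union (isClosed_iUnion_column ?_ fun _ h => h.1)
  refine isClosed_Sq.inter (.union ?_ ?_)
  · exact isClosed_le (f := fun _ => 1) (g := Complex.re) (by fun_prop) (by fun_prop)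
  · exact isClosed_le (f := fun p : ℂ => 2 * p.im + 15) (g := fun p : ℂ => 3 * p.re)
      (by fun_prop) (by fun_prop)

theorem exists_sub_mem_column (z : ℂ) :
    ∃ b : ℤ, (z - 18 * (b * Complex.I)).re = z.re ∧ -9 ≤ (z - 18 * (b * Complex.I)).im ∧
      (z - 18 * (b * Complex.I)).im ≤ 9 := by
  obtain ⟨a, b, h1, h2, h3⟩ := exists_sub_mem_Sq z
  refine ⟨b, by simp, ?_, ?_⟩ <;> simp at h2 h3 ⊢ <;> linarith

theorem mem_LeftPart_or_RightPart (z : ℂ) : z ∈ LeftPart ∨ z ∈ RightPart := by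
  rcases le_total z.re (-9) with h | h
  · exact .inl (.inl h)
  rcases le_total 9 z.re with h' | h'
  · exact .inr (.inl h')
  obtain ⟨b, h1, h2⟩ := exists_sub_mem_column z
  have hS : z - 18 * (b * Complex.I) ∈ Sq := ⟨by rw [h1]; exact ⟨h, h'⟩, h2⟩
  by_cases hr : 1 ≤ (z - 18 * (b * Complex.I)).re ∨
    2 * (z - 18 * (b * Complex.I)).im + 15 ≤ 3 * (z - 18 * (b * Complex.I)).re
  · exact .inr (.inr (Set.mem_iUnion.2 ⟨b, hS, hr⟩))
  · push Not at hr
    exact .inl (.inr (Set.mem_iUnion.2 ⟨b, hS, hr.1.le, hr.2.le⟩))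

theorem exists_mem_Win {z : ℂ} (hz : z ∈ LeftPart) (h9 : -9 ≤ z.re) :
    ∃ b : ℤ, z - 18 * (b * Complex.I) ∈ Win := by
  rcases hz with h | h
  · obtain ⟨b, h1, h2⟩ := exists_sub_mem_column z
    have h' : z.re ≤ -9 := h
    refine ⟨b, ⟨⟨by linarith, by linarith⟩, h2⟩, by linarith, by linarith [h2.1]⟩
  · exact Set.mem_iUnion.1 h

/-- The common boundary of the two parts. -/
theorem of_mem_LeftPart_of_mem_RightPart {z : ℂ} (hl : z ∈ LeftPart) (hr : z ∈ RightPart) :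
    ∃ b : ℤ, ∃ u ∈ Set.Icc (-9 : ℝ) 9, z - 18 * (b * Complex.I) = ⟨u / 9, 9⟩ ∨
      z - 18 * (b * Complex.I) = gz ⟨u, 9⟩ ∨ z - 18 * (b * Complex.I) = gz ⟨9, u⟩ := by
  obtain ⟨x, y⟩ := z
  rcases hl with hl | hl <;> rcases hr with hr | hr
  · simp only [Set.mem_ofPred_eq] at hl hr
    linarith
  · obtain ⟨b, ⟨-, h2, h3⟩, h4⟩ := Set.mem_iUnion.1 hr
    simp at hl h2 h3 h4
    rcases h4 with h4 | h4 <;> linarith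
  · obtain ⟨b, -, h2, h3⟩ := Set.mem_iUnion.1 hl
    simp at hr h2
    linarith
  · obtain ⟨b, ⟨⟨h1, h2⟩, h3, h4⟩, h5, h6⟩ := Set.mem_iUnion.1 hl
    obtain ⟨b', ⟨-, h3', h4'⟩, h5'⟩ := Set.mem_iUnion.1 hr
    simp at h1 h2 h3 h4 h5 h6 h3' h4' h5'
    have hb1 : b ≤ b' + 1 := by
      have : (b : ℝ) < b' + 2 := by linarith
      have : b < b' + 2 := by exact_mod_cast this
      omega
    have hb2 : b' ≤ b + 1 := by
      have : (b' : ℝ) < b + 2 := by linarith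
      have : b' < b + 2 := by exact_mod_cast this
      omega
    -- In the same square the window meets the right piece along a slanted and a vertical segment.
    -- The right piece of the square above meets the window in the segment −1 ≤ x ≤ 1 of the top
    -- side. The right piece of the square below does not meet it.
    obtain rfl | rfl | rfl : b' = b ∨ b' = b + 1 ∨ b = b' + 1 := by omega
    · rcases le_total x 1 with hx | hx
      · rcases h5' with h7 | h7
        · refine ⟨b', 9 - 6 / 5 * (y - 18 * b' + 6), ⟨?_, ?_⟩, .inr (.inl ?_)⟩
          · linarith
          · linarith
          · apply Complex.ext <;> simp [gz] <;> linarith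
        · refine ⟨b', 9 * x, ⟨?_, ?_⟩, .inr (.inr ?_)⟩
          · linarith
          · linarith
          · apply Complex.ext <;> simp [gz] <;> linarith
      · refine ⟨b', 9 - 6 / 5 * (y - 18 * b' + 6), ⟨?_, ?_⟩, .inr (.inl ?_)⟩
        · linarith
        · linarith
        · apply Complex.ext <;> simp [gz] <;> linarith
    · push_cast at h3' h4' h5'
      refine ⟨b, 9 * x, ⟨?_, ?_⟩, .inl ?_⟩
      · rcases h5' with h7 | h7 <;> linarith
      · linarith
      · apply Complex.ext <;> simp <;> linarith
    · push_cast at h3 h4 h6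
      exfalso
      rcases h5' with h7 | h7 <;> linarith

end Model

/-! ### Translating the column of windows -/

namespace IsTile

variable {β : ℂ} {q : ℝ → ℂ} {h : ℂ → ℂ}

/-- The translate of the left boundary line of the column of windows is the right one. -/
theorem exists_line (hβ : β ^ 3 - 2 * β ^ 2 - 1 = 0) (hq : IsArc β q)
    (H : IsTile β q h) {P : ℂ ≃ₜ ℂ}
    (hP : ∀ p ∈ Model.Sq, ∀ a b : ℤ, P (p + 18 * (a + b * Complex.I)) = h p + (a + b * β)) {z : ℂ}
    (hl : z ∈ Model.LeftPart) (hr : z ∈ Model.RightPart) :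
    ∃ v : ℂ, v.re = -9 ∧ P z = P v + (1 + β ^ 2) := by
  have i9 : (9 : ℝ) ∈ Set.Icc (-9 : ℝ) 9 := by norm_num
  have im9 : (-9 : ℝ) ∈ Set.Icc (-9 : ℝ) 9 := by norm_num
  have line : ∀ y ∈ Set.Icc (-9 : ℝ) 9, ∀ b : ℤ, P z = β * q y - 1 / 2 + b * β + (1 + β ^ 2) →
      ∃ v : ℂ, v.re = -9 ∧ P z = P v + (1 + β ^ 2) := by
    intro y hy b e
    refine ⟨⟨-9, y⟩ + 18 * ((0 : ℤ) + b * Complex.I), by simp, ?_⟩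
    rw [hP ⟨-9, y⟩ ⟨im9, hy⟩, H.left y hy, e]
    push_cast
    ring
  obtain ⟨b, u, hu, e⟩ := Model.of_mem_LeftPart_of_mem_RightPart hl hr
  obtain ⟨u1, u2⟩ := hu
  have hu : u ∈ Set.Icc (-9 : ℝ) 9 := ⟨u1, u2⟩
  have hnu : -u ∈ Set.Icc (-9 : ℝ) 9 := ⟨by linarith, by linarith⟩
  have hz : ∀ p ∈ Model.Sq, z - 18 * (b * Complex.I) = p → P z = h p + b * β := by
    intro p hp e
    have := hP p hp 0 b
    rwa [← e, Int.cast_zero, zero_add, zero_add, sub_add_cancel, e] at this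
  -- The three segments of the right boundary of the column are translates of the left, the right
  -- and the middle part of the arc on the line Re = −9.
  rcases e with e | e | e
  · have hu9 : u / 9 ∈ Set.Icc (-9 : ℝ) 9 := ⟨by linarith, by linarith⟩
    refine line (-5 + 4 * (-u) / 9) ⟨by linarith, by linarith⟩ (b + 1) ?_
    rw [hz ⟨u / 9, 9⟩ ⟨hu9, i9⟩ e, H.top hq hu9, hq.mid u hu, hq.left hnu, hq.odd u hu]
    push_cast
    linear_combination hβ / 2
  · have hS : (⟨u, 9⟩ : ℂ) ∈ Model.Sq := ⟨hu, i9⟩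
    refine line (5 + 4 * (-u) / 9) ⟨by linarith, by linarith⟩ b ?_
    rw [hz _ (Model.gz_mem hS).1 e, H.gz _ hS, H.top hq hu, hq.right (-u) hnu, hq.odd u hu]
    linear_combination (β / 2 + 1 / 2) * hβ
  · have hS : (⟨9, u⟩ : ℂ) ∈ Model.Sq := ⟨i9, hu⟩
    refine line (u / 9) ⟨by linarith, by linarith⟩ b ?_
    rw [hz _ (Model.gz_mem hS).1 e, H.gz _ hS, H.right hq hu, hq.mid u hu]
    linear_combination hβ / 2

variable (hβ : β ^ 3 - 2 * β ^ 2 - 1 = 0) (hi : β.im ≠ 0) {P : ℂ ≃ₜ ℂ}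
  (hb : ∀ z, ‖P z - (z.re + z.im * β) / 18‖ ≤ 2)

include hβ hi hb in
/-- Translations of the image displace the real part by a multiple of a positive number, up to a
bounded error. -/
theorem abs_re_sub_le (k : ℤ) {u v : ℂ} (e : P u = P v + k * (1 + β ^ 2)) :
    |u.re - v.re - 18 * k * (1 - ‖β‖ ^ 2)| ≤ 144 := by
  have hx := WindowRoot.re_bounds hβ hi
  have hn := WindowRoot.normSq_bounds hβ hi
  have hsq : β ^ 2 = 2 * β.re * β - ‖β‖ ^ 2 := by
    have h1 : β * (starRingEnd ℂ) β = ‖β‖ ^ 2 := Complex.mul_conj' β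
    have h2 : β + (starRingEnd ℂ) β = 2 * β.re := by
      rw [Complex.add_conj]; push_cast; ring
    linear_combination β * h2 - h1
  -- By the quadratic equation of β over ℝ, 1 + β² has coordinates 1 − |β|² and 2 Re β in the basis
  -- 1, β. So a + cβ is a difference of two errors of norm at most 2; this yields |a| ≤ 8, and 144 =
  -- 18 · 8.
  set a : ℝ := (u.re - v.re) / 18 - k * (1 - ‖β‖ ^ 2) with ha
  set c : ℝ := (u.im - v.im) / 18 - k * (2 * β.re) with hc
  have h1 : ‖(a + c * β + (0 : ℝ) * β ^ 2 : ℂ)‖ ≤ 4 := by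
    rw [show (a + c * β + (0 : ℝ) * β ^ 2 : ℂ) = (P v - (v.re + v.im * β) / 18) -
      (P u - (u.re + u.im * β) / 18) by
        rw [e, ha, hc]; push_cast; linear_combination k * hsq]
    refine (norm_sub_le _ _).trans ?_
    linarith [hb u, hb v]
  have h2 := WindowRoot.normSq_quad hβ hi a c 0
  have h3 := norm_nonneg (a + c * β + (0 : ℝ) * β ^ 2 : ℂ)
  have h6 := pow_le_pow_left₀ h3 h1 2
  rw [h2] at h6
  have h4 : a ^ 2 ≤ 64 := by
    nlinarith [sq_nonneg (c + a * β.re / 0.453), sq_nonneg a, sq_nonneg c,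
      mul_nonneg (sq_nonneg c) (by linarith : 0 ≤ ‖β‖ ^ 2 - 0.453),
      mul_nonneg (sq_nonneg a) (by nlinarith : 0 ≤ 0.02 - β.re ^ 2)]
  have h5 := abs_le.1 (abs_le_of_sq_le_sq (show a ^ 2 ≤ 8 ^ 2 by linarith) (by norm_num))
  rw [abs_le]
  constructor <;> linarith

variable (hq : IsArc β q) (H : IsTile β q h)
  (hP : ∀ p ∈ Model.Sq, ∀ a b : ℤ, P (p + 18 * (a + b * Complex.I)) = h p + (a + b * β))

include hβ hq H hP in
-- The translation Φ, read in the model, reaches the common boundary of the two closed parts only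
-- from the line Re = −9. A connected set that avoids this line is therefore mapped into a single
-- part.
theorem image_disjoint {s : Set ℂ} (hs : IsPreconnected s) (h9 : ∀ v ∈ s, v.re ≠ -9)
    (hl : ∃ v ∈ s, ∃ u ∈ Model.LeftPart, P u = P v + (1 + β ^ 2)) {u v : ℂ} (hv : v ∈ s)
    (e : P u = P v + (1 + β ^ 2)) : u ∉ Model.RightPart := by
  intro hu
  let Φ : ℂ → ℂ := fun v => P.symm (P v + (1 + β ^ 2))
  have hΦ : Continuous Φ := P.symm.continuous.comp (P.continuous.add continuous_const)
  have hΦe : ∀ {u v}, P u = P v + (1 + β ^ 2) → Φ v = u := fun e => by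
    simp only [Φ, ← e, P.symm_apply_apply]
  obtain ⟨v', hv', u', hu', e'⟩ := hl
  obtain ⟨_, ⟨w, hw, rfl⟩, hw1, hw2⟩ := isPreconnected_closed_iff.1 (hs.image Φ hΦ.continuousOn)
    _ _ Model.isClosed_LeftPart Model.isClosed_RightPart
    (fun z _ => Model.mem_LeftPart_or_RightPart z)
    ⟨u', ⟨v', hv', hΦe e'⟩, hu'⟩ ⟨u, ⟨v, hv, hΦe e⟩, hu⟩
  obtain ⟨x, hx, ex⟩ := H.exists_line hβ hq hP hw1 hw2
  simp only [Φ, P.apply_symm_apply, add_left_inj] at ex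
  exact h9 w hw (by rw [P.injective ex, hx])

include hβ hq H hP in
theorem image_disjoint' {s : Set ℂ} (hs : IsPreconnected s) (h9 : ∀ v ∈ s, v.re ≠ -9)
    (hl : ∃ v ∈ s, ∃ u ∈ Model.RightPart, P u = P v + (1 + β ^ 2)) {u v : ℂ} (hv : v ∈ s)
    (e : P u = P v + (1 + β ^ 2)) : u ∉ Model.LeftPart := by
  intro hu
  obtain ⟨v', hv', u', hu', e'⟩ := hl
  exact image_disjoint hβ hq H hP hs h9 ⟨v, hv, u, hu, e⟩ hv' e' hu'

include hβ hi hb hq H hP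

theorem not_mem_RightPart {u v : ℂ} (hv : v.re < -9) (e : P u = P v + (1 + β ^ 2)) :
    u ∉ Model.RightPart := by
  refine image_disjoint hβ hq H hP (s := {v | v.re < -9})
    (convex_halfSpace_re_lt _).isPreconnected (fun v hv => ne_of_lt hv) ?_ hv e
  -- A test point so far to the left that the bounded error of 144 cannot bring its image past −9.
  refine ⟨((-200 : ℝ) : ℂ), by norm_num, P.symm (P ((-200 : ℝ) : ℂ) + (1 + β ^ 2)), .inl ?_,
    P.apply_symm_apply _⟩
  have := abs_le.1 (abs_re_sub_le hβ hi hb 1 (u := P.symm (P ((-200 : ℝ) : ℂ) + (1 + β ^ 2)))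
    (v := ((-200 : ℝ) : ℂ)) (by rw [P.apply_symm_apply]; push_cast; ring))
  have hn := WindowRoot.normSq_bounds hβ hi
  rw [Complex.ofReal_re, Int.cast_one] at this
  show Complex.re _ ≤ -9
  linarith

theorem not_mem_LeftPart {u v : ℂ} (hv : -9 < v.re) (e : P u = P v + (1 + β ^ 2)) :
    u ∉ Model.LeftPart := by
  refine image_disjoint' hβ hq H hP (s := {v | -9 < v.re})
    (convex_halfSpace_re_gt _).isPreconnected (fun v hv => ne_of_gt hv) ?_ hv e
  refine ⟨((200 : ℝ) : ℂ), by norm_num, P.symm (P ((200 : ℝ) : ℂ) + (1 + β ^ 2)), .inl ?_,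
    P.apply_symm_apply _⟩
  have := abs_le.1 (abs_re_sub_le hβ hi hb 1 (u := P.symm (P ((200 : ℝ) : ℂ) + (1 + β ^ 2)))
    (v := ((200 : ℝ) : ℂ)) (by rw [P.apply_symm_apply]; push_cast; ring))
  have hn := WindowRoot.normSq_bounds hβ hi
  rw [Complex.ofReal_re, Int.cast_one] at this
  show 9 ≤ Complex.re _
  linarith

/-- The translates of the image of the window cover the plane. -/
theorem exists_mem_window (z : ℂ) :
    ∃ a k : ℤ, ∃ p ∈ Model.Win, z = h p + a * β + k * (1 + β ^ 2) := by
  have hn := WindowRoot.normSq_bounds hβ hi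
  let Φ : ℤ → ℂ := fun k => P.symm (z - k * (1 + β ^ 2))
  have hΦ : ∀ k, P (Φ k) = z - k * (1 + β ^ 2) := fun k => P.apply_symm_apply _
  have hre : ∀ k : ℤ, |(Φ k).re - (Φ 0).re + 18 * k * (1 - ‖β‖ ^ 2)| ≤ 144 := by
    intro k
    have := abs_re_sub_le hβ hi hb (-k) (u := Φ k) (v := Φ 0) (by
      rw [hΦ, hΦ]; push_cast; ring)
    push_cast at this
    rwa [show (Φ k).re - (Φ 0).re + 18 * k * (1 - ‖β‖ ^ 2) =
      (Φ k).re - (Φ 0).re - 18 * -(k : ℝ) * (1 - ‖β‖ ^ 2) by ring]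
  -- Take the first translate of z to the left of the line Re = −9. The preceding one is not to the
  -- left of that line, and not in the right part since it is the image under Φ of a point left of
  -- the line. So it lies in the column of windows.
  obtain ⟨k, hk, hmin⟩ : ∃ k : ℤ, (Φ k).re < -9 ∧ ∀ j : ℤ, (Φ j).re < -9 → k ≤ j := by
    refine Int.exists_least_of_bdd ⟨⌊((Φ 0).re - 200) / 9⌋ ⊓ 0, fun j hj => ?_⟩
      ⟨⌈((Φ 0).re + 200) / 9⌉ ⊔ 0, ?_⟩
    · have h1 := (abs_le.1 (hre j)).1
      by_contra hcon
      push Not at hcon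
      rw [lt_inf_iff] at hcon
      have h2 : (j : ℝ) < ((Φ 0).re - 200) / 9 := by
        have := Int.floor_le (((Φ 0).re - 200) / 9)
        have : (j : ℝ) < ⌊((Φ 0).re - 200) / 9⌋ := by exact_mod_cast hcon.1
        linarith
      have h3 : (j : ℝ) < 0 := by exact_mod_cast hcon.2
      nlinarith
    · set k : ℤ := ⌈((Φ 0).re + 200) / 9⌉ ⊔ 0
      have h1 := (abs_le.1 (hre k)).2
      have h2 : ((Φ 0).re + 200) / 9 ≤ k :=
        (Int.le_ceil _).trans (by exact_mod_cast le_sup_left)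
      have h3 : (0 : ℝ) ≤ k := by exact_mod_cast le_sup_right
      nlinarith
  have hk1 : -9 ≤ (Φ (k - 1)).re := by
    by_contra hcon
    have := hmin _ (not_le.1 hcon)
    omega
  have hnr := not_mem_RightPart hβ hi hb hq H hP hk (u := Φ (k - 1)) (by
    rw [hΦ, hΦ]; push_cast; ring)
  obtain ⟨b, hbW⟩ :=
    Model.exists_mem_Win ((Model.mem_LeftPart_or_RightPart _).resolve_right hnr) hk1
  refine ⟨b, k - 1, _, hbW, ?_⟩
  have := hP _ hbW.1 0 b
  rw [Int.cast_zero, zero_add, zero_add, sub_add_cancel, hΦ] at this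
  linear_combination this

/-- Translates of the image of the window meet only in boundary points. -/
theorem eq_zero_of_mem_window {p p' : ℂ} (hp : p ∈ Model.Win) (hp' : p' ∈ Model.Win)
    (hre : -9 < p.re) (hre' : -9 < p'.re) (him : |p.im| < 9) (him' : |p'.im| < 9) {a k : ℤ}
    (e : h p = h p' + a * β + k * (1 + β ^ 2)) : a = 0 ∧ k = 0 := by
  have hP0 : ∀ p ∈ Model.Sq, ∀ b : ℤ, P (p + 18 * (b * Complex.I)) = h p + b * β := by
    intro p hp b
    simpa using hP p hp 0 b
  have hPh : ∀ p ∈ Model.Sq, P p = h p := fun p hp => by simpa using hP p hp 0 0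
  -- a positive translate lies to the right
  have hpos : ∀ n : ℕ, ∀ u v : ℂ, -9 < v.re → P u = P v + (n + 1 : ℕ) * (1 + β ^ 2) →
      u ∉ Model.LeftPart := by
    intro n
    induction n with
    | zero =>
      intro u v hv e
      exact not_mem_LeftPart hβ hi hb hq H hP hv (by rw [e]; push_cast; ring)
    | succ n ih =>
      intro u v hv e
      have h1 := ih (P.symm (P v + (n + 1 : ℕ) * (1 + β ^ 2))) v hv (P.apply_symm_apply _)
      refine not_mem_LeftPart hβ hi hb hq H hP
        (v := P.symm (P v + (n + 1 : ℕ) * (1 + β ^ 2))) ?_ ?_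
      · by_contra hcon
        exact h1 (.inl (not_lt.1 hcon))
      · rw [P.apply_symm_apply, e]; push_cast; ring
  have hside : ∀ p ∈ Model.Win, ∀ p' ∈ Model.Win, -9 < p'.re → ∀ a k : ℤ,
      h p = h p' + a * β + k * (1 + β ^ 2) → k ≤ 0 := by
    intro p hp p' hp' hre' a k e
    by_contra hk
    push Not at hk
    obtain ⟨n, hn⟩ := Int.eq_ofNat_of_zero_le (show 0 ≤ k - 1 by omega)
    obtain rfl : k = n + 1 := by omega
    refine hpos n p (p' + 18 * (a * Complex.I)) (by simpa using hre') ?_ ?_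
    · rw [hPh p hp.1, hP0 p' hp'.1, e]; push_cast; ring
    · exact .inr (Set.mem_iUnion.2 ⟨0, by simpa using hp⟩)
  have h1 := hside p hp p' hp' hre' a k e
  have h2 := hside p' hp' p hp hre (-a) (-k) (by rw [e]; push_cast; ring)
  obtain rfl : k = 0 := by omega
  refine ⟨?_, rfl⟩
  have h3 : p = p' + 18 * (a * Complex.I) := by
    apply P.injective
    rw [hPh p hp.1, hP0 p' hp'.1, e]
    simp
  have h4 := congrArg Complex.im h3
  simp at h4
  rw [abs_lt] at him him'
  have a1 : (a : ℝ) < 1 := by linarith [him.1, him.2, him'.1, him'.2]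
  have a2 : (-1 : ℝ) < a := by linarith [him.1, him.2, him'.1, him'.2]
  have a1' : a < 1 := by exact_mod_cast a1
  have a2' : -1 < a := by exact_mod_cast a2
  omega

end IsTile

/-! ### Measure and dimension of the boundary arc -/

theorem volume_image_mul_add (c b : ℂ) (s : Set ℂ) :
    MeasureTheory.volume ((fun z => c * z + b) '' s) =
      ENNReal.ofReal (‖c‖ ^ 2) * MeasureTheory.volume s := by
  have h1 : (fun z => c * z + b) '' s = (fun z => z + b) '' (Algebra.lmul ℝ ℂ c '' s) := by
    rw [Set.image_image]
    rfl
  rw [h1, Set.image_add_right, MeasureTheory.measure_preimage_add_right,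
    MeasureTheory.Measure.addHaar_image_linearMap]
  congr 2
  rw [← Algebra.norm_apply, Algebra.norm_complex_apply, Complex.normSq_eq_norm_sq,
    abs_of_nonneg (sq_nonneg _)]

/-- Reduces the comparison of a rational power to integer powers, which can be evaluated. -/
theorem le_rpow_of_pow_le {a b : ℝ} (ha : 0 ≤ a) (hb : 0 ≤ b) {n m : ℕ} (hn : n ≠ 0)
    (hab : a ^ n ≤ b ^ m) : a ≤ b ^ ((m : ℝ) / n) := by
  calc a = (a ^ n) ^ (n : ℝ)⁻¹ := (Real.pow_rpow_inv_natCast ha hn).symm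
    _ ≤ (b ^ m) ^ (n : ℝ)⁻¹ := Real.rpow_le_rpow (by positivity) hab (by positivity)
    _ = b ^ ((m : ℝ) / n) := by
      rw [← Real.rpow_natCast, ← Real.rpow_mul hb, div_eq_mul_inv]

namespace IsArc

variable {β : ℂ} {q : ℝ → ℂ}

theorem volume_image (hβ : β ^ 3 - 2 * β ^ 2 - 1 = 0) (hi : β.im ≠ 0) (hq : IsArc β q) :
    MeasureTheory.volume (q '' Set.Icc (-9) 9) = 0 := by
  set Q := q '' Set.Icc (-9) 9 with hQ
  have hfin : MeasureTheory.volume Q ≠ ⊤ :=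
    (isCompact_Icc.image hq.continuous).measure_lt_top.ne
  have hsub : Q ⊆ (fun z => β ^ 3 * z + 0) '' Q ∪ ((fun z => -β ^ 2 * z + (1 + β ^ 2) / 2) '' Q ∪
      (fun z => -β ^ 2 * z + -((1 + β ^ 2) / 2)) '' Q) := by
    rintro _ ⟨u, ⟨h1, h2⟩, rfl⟩
    rcases le_total u (-1) with h | h
    · have hv : 9 / 4 * (u + 5) ∈ Set.Icc (-9 : ℝ) 9 := ⟨by linarith, by linarith⟩
      refine .inr (.inr ⟨_, ⟨_, hv, rfl⟩, ?_⟩)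
      dsimp only
      rw [← sub_eq_add_neg, ← hq.left hv]
      congr 1; ring
    rcases le_total u 1 with h' | h'
    · have hv : 9 * u ∈ Set.Icc (-9 : ℝ) 9 := ⟨by linarith, by linarith⟩
      refine .inl ⟨_, ⟨_, hv, rfl⟩, ?_⟩
      dsimp only
      rw [add_zero, ← hq.mid _ hv]
      congr 1; ring
    · have hv : 9 / 4 * (u - 5) ∈ Set.Icc (-9 : ℝ) 9 := ⟨by linarith, by linarith⟩
      refine .inr (.inl ⟨_, ⟨_, hv, rfl⟩, ?_⟩)
      dsimp only
      rw [← hq.right _ hv]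
      congr 1; ring
  have h1 := (MeasureTheory.measure_mono (μ := MeasureTheory.volume) hsub).trans
    ((MeasureTheory.measure_union_le _ _).trans
      (add_le_add_right (MeasureTheory.measure_union_le _ _) _))
  simp only [volume_image_mul_add] at h1
  rw [← add_mul, ← add_mul, ← ENNReal.ofReal_add (by positivity) (by positivity),
    ← ENNReal.ofReal_add (by positivity) (by positivity)] at h1
  set t : ℝ := ‖β ^ 3‖ ^ 2 + (‖-β ^ 2‖ ^ 2 + ‖-β ^ 2‖ ^ 2) with ht
  -- The three copies cover the arc, and the sum of their areas is |β|⁶ + 2|β|⁴ ≈ 0.5 times its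
  -- area.
  have htlt : t < 1 := by
    have hn := WindowRoot.normSq_bounds hβ hi
    have e : t = (‖β‖ ^ 2) ^ 3 + 2 * (‖β‖ ^ 2) ^ 2 := by
      rw [ht]; simp only [norm_neg, norm_pow]; ring
    rw [e]
    have h0 : 0 ≤ ‖β‖ ^ 2 := by positivity
    have := pow_le_pow_left₀ h0 hn.2.le 3
    have := pow_le_pow_left₀ h0 hn.2.le 2
    linarith
  by_contra hne
  have h2 : ENNReal.ofReal t * MeasureTheory.volume Q < 1 * MeasureTheory.volume Q :=
    ENNReal.mul_lt_mul_left hne hfin (by rwa [ENNReal.ofReal_lt_one])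
  rw [one_mul] at h2
  exact absurd h1 (not_le.2 h2)

/-- The arc is self-similar about the end of its middle third. -/
theorem zoom (hβ : β ^ 3 - 2 * β ^ 2 - 1 = 0) (hq : IsArc β q) {w : ℝ} (h1 : -1 ≤ w)
    (h2 : w ≤ 9) : q (1 + 4 * (w - 1) / 9) = -β ^ 2 * q w + β ^ 3 / 2 * (1 + β ^ 2) := by
  rcases le_total w 1 with h | h
  · obtain ⟨v, rfl⟩ : ∃ v, w = v / 9 := ⟨9 * w, by ring⟩
    have hv : v ∈ Set.Icc (-9 : ℝ) 9 := ⟨by linarith, by linarith⟩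
    rw [show 1 + 4 * (v / 9 - 1) / 9 = (5 + 4 * v / 9) / 9 by ring,
      hq.mid _ ⟨by linarith, by linarith⟩, hq.mid v hv, hq.right v hv]
    ring
  · obtain ⟨v, rfl⟩ : ∃ v, w = 5 + 4 * v / 9 := ⟨9 / 4 * (w - 5), by ring⟩
    have hv : v ∈ Set.Icc (-9 : ℝ) 9 := ⟨by linarith, by linarith⟩
    rw [show 1 + 4 * (5 + 4 * v / 9 - 1) / 9 = 5 + 4 * (-5 + 4 * v / 9) / 9 by ring,
      hq.right _ ⟨by linarith, by linarith⟩, hq.left hv, hq.right v hv]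
    linear_combination (-(1 + β ^ 2) / 2) * hβ

/-- The inverse of the arc is Hölder continuous with an exponent greater than one. -/
theorem exists_abs_sub_le (hβ : β ^ 3 - 2 * β ^ 2 - 1 = 0) (hi : β.im ≠ 0) (hq : IsArc β q)
    (hinj : Set.InjOn q (Set.Icc (-9) 9)) : ∃ C : ℝ, 0 ≤ C ∧ ∀ u ∈ Set.Icc (-9 : ℝ) 9,
      ∀ v ∈ Set.Icc (-9 : ℝ) 9, |u - v| ≤ C * ‖q u - q v‖ ^ (1.02 : ℝ) := by
  set I := Set.Icc (-9 : ℝ) 9 with hI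
  have hn := WindowRoot.normSq_bounds hβ hi
  have hn1 := WindowRoot.norm_bounds hβ hi
  -- distant points
  obtain ⟨δ, hδ, hfar⟩ : ∃ δ : ℝ, 0 < δ ∧ ∀ u ∈ I, ∀ v ∈ I, 8 / 9 ≤ |u - v| →
      δ ≤ ‖q u - q v‖ := by
    have hK : IsCompact ((I ×ˢ I) ∩ {x : ℝ × ℝ | 8 / 9 ≤ |x.1 - x.2|}) :=
      (isCompact_Icc.prod isCompact_Icc).inter_right
        (isClosed_le (f := fun _ => (8 / 9 : ℝ)) (g := fun x : ℝ × ℝ => |x.1 - x.2|)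
          (by fun_prop) (by fun_prop))
    have hqc := hq.continuous
    obtain ⟨⟨u₀, v₀⟩, ⟨⟨hu, hv⟩, huv⟩, hmin⟩ := hK.exists_isMinOn
      ⟨(0, 9), ⟨⟨by norm_num [hI], by norm_num [hI]⟩, by norm_num⟩⟩
      (f := fun x : ℝ × ℝ => ‖q x.1 - q x.2‖) (by fun_prop)
    refine ⟨‖q u₀ - q v₀‖, ?_, fun u hu v hv h => hmin (a := (u, v)) ⟨⟨hu, hv⟩, h⟩⟩
    rw [norm_pos_iff, sub_ne_zero]
    intro e
    have := hinj hu hv e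
    simp only [Set.mem_ofPred_eq] at huv
    dsimp only at this
    rw [this, sub_self, abs_zero] at huv
    linarith
  set σ : ℝ := 1.02 with hσ
  have hσ' : ((51 : ℕ) : ℝ) / (50 : ℕ) = σ := by norm_num [hσ]
  have hδσ : 0 < δ ^ σ := Real.rpow_pos_of_pos hδ _
  set C := 18 / δ ^ σ with hC
  have hC0 : 0 ≤ C := by positivity
  -- zooming in
  have hzoom : ∀ {u v u' v' : ℝ} {s : ℝ} {c : ℂ}, |u - v| = s * |u' - v'| →
      ‖q u - q v‖ = ‖c‖ * ‖q u' - q v'‖ → s ≤ ‖c‖ ^ σ →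
      |u' - v'| ≤ C * ‖q u' - q v'‖ ^ σ → |u - v| ≤ C * ‖q u - q v‖ ^ σ := by
    intro u v u' v' s c h1 h2 h3 h4
    rw [h1, h2, Real.mul_rpow (norm_nonneg _) (norm_nonneg _)]
    calc s * |u' - v'| ≤ ‖c‖ ^ σ * |u' - v'| := mul_le_mul_of_nonneg_right h3 (abs_nonneg _)
      _ ≤ ‖c‖ ^ σ * (C * ‖q u' - q v'‖ ^ σ) := mul_le_mul_of_nonneg_left h4 (by positivity)
      _ = _ := by ring
  -- The exponent is fixed here: |β|² exceeds 4/9 by enough to allow the power 1.02 = 51/50.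
  have s2 : (4 / 9 : ℝ) ≤ ‖-β ^ 2‖ ^ σ := by
    have h := le_rpow_of_pow_le (a := 4 / 9) (b := 0.453) (n := 50) (m := 51) (by norm_num)
      (by norm_num) (by norm_num) (by norm_num)
    rw [hσ'] at h
    refine h.trans
      (Real.rpow_le_rpow (by norm_num) ?_ (by norm_num [hσ]))
    rw [norm_neg, norm_pow]
    exact hn.1.le
  have s3 : (1 / 9 : ℝ) ≤ ‖β ^ 3‖ ^ σ := by
    have h := le_rpow_of_pow_le (a := 1 / 9) (b := 0.3) (n := 50) (m := 51) (by norm_num)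
      (by norm_num) (by norm_num) (by norm_num)
    rw [hσ'] at h
    refine h.trans
      (Real.rpow_le_rpow (by norm_num) ?_ (by norm_num [hσ]))
    rw [norm_pow]
    nlinarith
  have hmain : ∀ n : ℕ, ∀ u ∈ I, ∀ v ∈ I, u ≤ v → 8 / 9 * (4 / 9 : ℝ) ^ n ≤ v - u →
      |u - v| ≤ C * ‖q u - q v‖ ^ σ := by
    intro n
    have far : ∀ u ∈ I, ∀ v ∈ I, u ≤ v → 8 / 9 ≤ v - u → |u - v| ≤ C * ‖q u - q v‖ ^ σ := by
      intro u hu v hv huv h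
      have habs : |u - v| = v - u := by rw [abs_sub_comm, abs_of_nonneg (by linarith)]
      have h1 := Real.rpow_le_rpow hδ.le (hfar u hu v hv (by rw [habs]; exact h))
        (show 0 ≤ σ by norm_num [hσ])
      have h2 : C * δ ^ σ = 18 := by rw [hC]; field_simp
      have h3 := mul_le_mul_of_nonneg_left h1 hC0
      rw [habs]
      linarith [hu.1, hv.2]
    induction n with
    | zero =>
      intro u hu v hv huv h
      exact far u hu v hv huv (by linarith)
    | succ n ih =>
      intro u hu v hv huv h
      by_cases hd : 8 / 9 ≤ v - u
      · exact far u hu v hv huv hd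
      push Not at hd
      rw [pow_succ] at h
      obtain ⟨u1, u2⟩ := hu
      obtain ⟨v1, v2⟩ := hv
      -- pairs near the end of the middle third
      have near : ∀ x y : ℝ, x ≤ y → 1 / 9 ≤ x → y ≤ 1 + 32 / 9 →
          8 / 9 * ((4 / 9 : ℝ) ^ n * (4 / 9)) ≤ y - x → |x - y| ≤ C * ‖q x - q y‖ ^ σ := by
        intro x y hxy hx hy hlow
        obtain ⟨x, rfl⟩ : ∃ x', x = 1 + 4 * (x' - 1) / 9 := ⟨1 + 9 / 4 * (x - 1), by ring⟩
        obtain ⟨y, rfl⟩ : ∃ y', y = 1 + 4 * (y' - 1) / 9 := ⟨1 + 9 / 4 * (y - 1), by ring⟩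
        have b1 : -1 ≤ x := by linarith
        have b2 : x ≤ y := by linarith
        have b3 : y ≤ 9 := by linarith
        refine hzoom (s := 4 / 9) (c := -β ^ 2) ?_ ?_ s2
          (ih x ⟨by linarith, by linarith⟩ y ⟨by linarith, b3⟩ b2 (by linarith))
        · rw [← abs_of_pos (show (0 : ℝ) < 4 / 9 by norm_num), ← abs_mul]
          congr 1; norm_num; ring
        · rw [hq.zoom hβ b1 (by linarith), hq.zoom hβ (by linarith) b3, ← norm_mul]
          congr 1; ring
      have hodd : ∀ x y : ℝ, x ∈ I → y ∈ I → |(-y) - (-x)| ≤ C * ‖q (-y) - q (-x)‖ ^ σ →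
          |x - y| ≤ C * ‖q x - q y‖ ^ σ := by
        intro x y hx hy hxy
        rw [hq.odd x hx, hq.odd y hy] at hxy
        rwa [show -y - -x = x - y by ring, show -q y - -q x = q x - q y by ring] at hxy
      -- pairs in the right third
      have right : ∀ x y : ℝ, x ≤ y → 1 ≤ x → y ≤ 9 →
          8 / 9 * ((4 / 9 : ℝ) ^ n * (4 / 9)) ≤ y - x → |x - y| ≤ C * ‖q x - q y‖ ^ σ := by
        intro x y hxy hx hy hlow
        obtain ⟨x, rfl⟩ : ∃ x', x = 5 + 4 * x' / 9 := ⟨9 / 4 * (x - 5), by ring⟩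
        obtain ⟨y, rfl⟩ : ∃ y', y = 5 + 4 * y' / 9 := ⟨9 / 4 * (y - 5), by ring⟩
        have hx' : x ∈ I := ⟨by linarith, by linarith⟩
        have hy' : y ∈ I := ⟨by linarith, by linarith⟩
        refine hzoom (s := 4 / 9) (c := -β ^ 2) ?_ ?_ s2
          (ih x hx' y hy' (by linarith) (by linarith))
        · rw [← abs_of_pos (show (0 : ℝ) < 4 / 9 by norm_num), ← abs_mul]
          congr 1; norm_num; ring
        · rw [hq.right x hx', hq.right y hy', ← norm_mul]
          congr 1; ring
      have hpow : 0 < (4 / 9 : ℝ) ^ n := by positivity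
      -- Since v − u < 8/9, the pair lies in one third or straddles a single joint ±1 at distance
      -- less than 8/9. At the joint no piece contains both points, and the self-similarity about 1
      -- replaces that of the pieces. Each zoom enlarges the distance at least by 9/4, which drives
      -- the induction.
      rcases le_total 1 u with c1 | c1
      · exact right u v huv c1 v2 h
      rcases le_total v (-1) with c2 | c2
      · exact hodd u v ⟨u1, u2⟩ ⟨v1, v2⟩
          (right (-v) (-u) (by linarith) (by linarith) (by linarith) (by linarith))
      rcases le_total 1 v with c3 | c3
      · exact near u v huv (by linarith) (by linarith) h
      rcases le_total u (-1) with c4 | c4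
      · exact hodd u v ⟨u1, u2⟩ ⟨v1, v2⟩
          (near (-v) (-u) (by linarith) (by linarith) (by linarith) (by linarith))
      · obtain ⟨x, rfl⟩ : ∃ x', u = x' / 9 := ⟨9 * u, by ring⟩
        obtain ⟨y, rfl⟩ : ∃ y', v = y' / 9 := ⟨9 * v, by ring⟩
        have hx' : x ∈ I := ⟨by linarith, by linarith⟩
        have hy' : y ∈ I := ⟨by linarith, by linarith⟩
        refine hzoom (s := 1 / 9) (c := β ^ 3) ?_ ?_ s3
          (ih x hx' y hy' (by linarith) (by linarith))
        · rw [← abs_of_pos (show (0 : ℝ) < 1 / 9 by norm_num), ← abs_mul]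
          congr 1; norm_num; ring
        · rw [hq.mid x hx', hq.mid y hy', ← norm_mul]
          congr 1; ring
  have hall : ∀ u ∈ I, ∀ v ∈ I, u ≤ v → |u - v| ≤ C * ‖q u - q v‖ ^ σ := by
    intro u hu v hv huv
    rcases huv.eq_or_lt with rfl | hlt
    · rw [sub_self, abs_zero]; positivity
    obtain ⟨n, hn⟩ := exists_pow_lt_of_lt_one (show 0 < v - u by linarith)
      (show (4 / 9 : ℝ) < 1 by norm_num)
    have hpow : 0 < (4 / 9 : ℝ) ^ n := by positivity
    exact hmain n u hu v hv huv (by linarith)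
  refine ⟨C, hC0, fun u hu v hv => ?_⟩
  rcases le_total u v with h | h
  · exact hall u hu v hv h
  · rw [abs_sub_comm, norm_sub_rev]
    exact hall v hv u hu h

/-- Affine images of the arc have Hausdorff dimension greater than one. -/
theorem one_lt_dimH_image (hβ : β ^ 3 - 2 * β ^ 2 - 1 = 0) (hi : β.im ≠ 0) (hq : IsArc β q)
    (hinj : Set.InjOn q (Set.Icc (-9) 9)) {a b : ℂ} (ha : a ≠ 0) :
    1 < dimH ((fun u => a * q u + b) '' Set.Icc (-9) 9) := by
  obtain ⟨C, hC0, hC⟩ := hq.exists_abs_sub_le hβ hi hinj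
  set I := Set.Icc (-9 : ℝ) 9 with hI
  set F : ℝ → ℂ := fun u => a * q u + b with hF
  have hFinj : Set.InjOn F I := fun u hu v hv e => hinj hu hv (by
    simp only [hF, add_left_inj] at e
    exact mul_left_cancel₀ ha e)
  have hleft := hFinj.leftInvOn_invFunOn
  set f := Function.invFunOn F I with hf
  have hna : 0 < ‖a‖ := norm_pos_iff.2 ha
  have hHold : HolderOnWith (C / ‖a‖ ^ (1.02 : ℝ)).toNNReal 1.02 f (F '' I) := by
    rintro _ ⟨u, hu, rfl⟩ _ ⟨v, hv, rfl⟩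
    rw [hleft hu, hleft hv, edist_dist, edist_dist, ENNReal.ofReal_rpow_of_nonneg dist_nonneg
      (by positivity)]
    change _ ≤ ENNReal.ofReal _ * _
    rw [← ENNReal.ofReal_mul (by positivity)]
    refine ENNReal.ofReal_le_ofReal ?_
    rw [Real.dist_eq, dist_eq_norm, show F u - F v = a * (q u - q v) by simp only [hF]; ring,
      norm_mul, Real.mul_rpow (norm_nonneg _) (norm_nonneg _)]
    refine (hC u hu v hv).trans (le_of_eq ?_)
    have : ‖a‖ ^ (1.02 : ℝ) ≠ 0 := (Real.rpow_pos_of_pos hna _).ne'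
    push_cast
    field_simp
  -- The Hölder inverse maps the arc onto an interval, so 1 ≤ dim / 1.02.
  have h1 := hHold.dimH_image_le (by norm_num)
  rw [hleft.image_image, Real.dimH_of_nonempty_interior (by
    rw [hI, interior_Icc]; exact ⟨0, by norm_num⟩)] at h1
  by_contra hle
  push Not at hle
  have h2 : (Module.finrank ℝ ℝ : ℝ≥0∞) ≤ 1 / ((1.02 : NNReal) : ℝ≥0∞) :=
    h1.trans (ENNReal.div_le_div_right hle _)
  rw [Module.finrank_self, Nat.cast_one, ENNReal.le_div_iff_mul_le (by simp) (by simp),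
    one_mul] at h2
  have h3 := NNReal.coe_le_coe.2 (show (1.02 : NNReal) ≤ 1 by exact_mod_cast h2)
  norm_num at h3

end IsArc

/-! ### Covering dimension of the circle -/

theorem CoveringDimLE.of_homeomorph {X Y : Type*} [TopologicalSpace X] [TopologicalSpace Y]
    (e : X ≃ₜ Y) {n : ℕ} (h : CoveringDimLE X n) : CoveringDimLE Y n := by
  intro k U hU hcov
  obtain ⟨V, hV, hVU, hVcov, hcard⟩ := h k (fun i => e ⁻¹' U i) (fun i => (hU i).preimage
    e.continuous) (by rw [← Set.preimage_iUnion, hcov, Set.preimage_univ])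
  refine ⟨fun i => e.symm ⁻¹' V i, fun i => (hV i).preimage e.symm.continuous, fun i y hy => ?_,
    by rw [← Set.preimage_iUnion, hVcov, Set.preimage_univ], fun y => hcard (e.symm y)⟩
  simpa using hVU i hy

theorem coveringDimLE_addCircle : CoveringDimLE (AddCircle (1 : ℝ)) 1 := by
  intro k U hU hcov
  let π : ℝ → AddCircle (1 : ℝ) := fun s => (s : AddCircle (1 : ℝ))
  have hπ : Continuous π := AddCircle.continuous_mk' 1
  have hopen : IsOpenMap π := QuotientAddGroup.isOpenMap_coe
  have hper : ∀ (s : ℝ) (m : ℤ), π (s + m) = π s := fun s m => by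
    refine (QuotientAddGroup.eq.2 ?_).symm
    exact AddSubgroup.mem_zmultiples_iff.2 ⟨m, by simp⟩
  have hker : ∀ s s', π s = π s' → ∃ m : ℤ, s' = s + m := by
    intro s s' e
    obtain ⟨m, hm⟩ := AddSubgroup.mem_zmultiples_iff.1 (QuotientAddGroup.eq.1 e)
    rw [zsmul_eq_mul, mul_one] at hm
    exact ⟨m, by rw [hm]; ring⟩
  -- short intervals are mapped into members of the cover
  obtain ⟨δ, hδ, hball⟩ := lebesgue_number_lemma_of_metric (s := Set.Icc (0 : ℝ) 1) isCompact_Icc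
    (fun i => (hU i).preimage hπ) (by
      rw [← Set.preimage_iUnion, hcov, Set.preimage_univ]; exact Set.subset_univ _)
  have hball' : ∀ x : ℝ, ∃ i, π '' Metric.ball x δ ⊆ U i := by
    intro x
    obtain ⟨i, hi⟩ := hball (Int.fract x) ⟨Int.fract_nonneg x, (Int.fract_lt_one x).le⟩
    refine ⟨i, ?_⟩
    rintro _ ⟨y, hy, rfl⟩
    have : y - ⌊x⌋ ∈ π ⁻¹' U i := hi (by
      rw [Metric.mem_ball, Real.dist_eq] at hy ⊢
      rwa [Int.fract, sub_sub_sub_cancel_right])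
    rwa [Set.mem_preimage, ← hper _ ⌊x⌋, sub_add_cancel] at this
  obtain ⟨N, hN⟩ := exists_nat_gt (2 / δ)
  have hN0 : (0 : ℝ) < N := lt_trans (by positivity) hN
  rw [div_lt_iff₀ hδ] at hN
  -- Arcs of length 1.2/N with starting points 1/N apart: they cover the circle and no point lies on
  -- more than two of them.
  let arc : ℤ → Set (AddCircle (1 : ℝ)) := fun j =>
    π '' {s | (j : ℝ) - 0.1 < N * s ∧ N * s < j + 1.1}
  have harc : ∀ j, ∃ i, arc j ⊆ U i := by
    intro j
    obtain ⟨i, hi⟩ := hball' (j / N)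
    refine ⟨i, (Set.image_mono ?_).trans hi⟩
    rintro s ⟨h1, h2⟩
    rw [Metric.mem_ball, Real.dist_eq, abs_lt]
    have e : (j : ℝ) / N * N = j := div_mul_cancel₀ _ hN0.ne'
    constructor <;> nlinarith
  have harc_open : ∀ j, IsOpen (arc j) := fun j =>
    hopen _ ((isOpen_lt (f := fun _ => (j : ℝ) - 0.1) (g := fun s : ℝ => N * s) (by fun_prop)
      (by fun_prop)).inter (isOpen_lt (f := fun s : ℝ => N * s) (g := fun _ => (j : ℝ) + 1.1)
      (by fun_prop) (by fun_prop)))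
  have harc_add : ∀ (j m : ℤ), arc (j + N * m) = arc j := by
    have : ∀ (j m : ℤ), arc j ⊆ arc (j + N * m) := by
      rintro j m _ ⟨s, ⟨h1, h2⟩, rfl⟩
      refine ⟨s + m, ⟨?_, ?_⟩, hper s m⟩ <;> push_cast <;> linarith
    refine fun j m => Set.Subset.antisymm ?_ (this j m)
    have h := this (j + N * m) (-m)
    rwa [show j + N * m + N * -m = j by ring] at h
  -- The colour depends on the arc as a set and not on its index, so it has period N in the index.
  choose c hc using fun A : {A : Set (AddCircle (1 : ℝ)) // ∃ i, A ⊆ U i} => A.2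
  let col : ℤ → Fin k := fun j => c ⟨arc j, harc j⟩
  have hmem : ∀ s : ℝ, ∀ j : ℤ, π s ∈ arc j → col j = col ⌊N * s + 0.1⌋ ∨
      col j = col (⌊N * s + 0.1⌋ - 1) := by
    rintro s j ⟨s', ⟨h1, h2⟩, e⟩
    obtain ⟨m, rfl⟩ := hker _ _ e
    have hcol : col j = col (j + N * m) := by
      simp only [col]
      congr 1
      exact Subtype.ext (harc_add j m).symm
    have f1 : j + N * m ≤ ⌊N * (s' + m) + 0.1⌋ := Int.le_floor.2 (by push_cast; linarith)
    have f2 : ⌊N * (s' + m) + 0.1⌋ < j + N * m + 2 := Int.floor_lt.2 (by push_cast; linarith)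
    rw [hcol]
    obtain h | h : j + N * m = ⌊N * (s' + m) + 0.1⌋ ∨ j + N * m = ⌊N * (s' + m) + 0.1⌋ - 1 := by
      omega
    · exact .inl (by rw [h])
    · exact .inr (by rw [h])
  refine ⟨fun i => ⋃ j, ⋃ _ : col j = i, arc j, fun i => isOpen_iUnion fun j => isOpen_iUnion
    fun _ => harc_open j, ?_, ?_, ?_⟩
  · intro i
    refine Set.iUnion_subset fun j => Set.iUnion_subset ?_
    rintro rfl
    exact hc ⟨arc j, harc j⟩
  · refine Set.eq_univ_of_forall fun x => ?_
    obtain ⟨s, rfl⟩ := QuotientAddGroup.mk_surjective x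
    refine Set.mem_iUnion.2 ⟨col ⌊N * s⌋, Set.mem_iUnion.2 ⟨⌊N * s⌋, Set.mem_iUnion.2 ⟨rfl, s,
      ⟨?_, ?_⟩, rfl⟩⟩⟩
    · linarith [Int.floor_le (N * s)]
    · linarith [Int.lt_floor_add_one (N * s)]
  · intro x
    obtain ⟨s, rfl⟩ := QuotientAddGroup.mk_surjective x
    refine (Set.ncard_le_ncard (t := {col ⌊N * s + 0.1⌋, col (⌊N * s + 0.1⌋ - 1)}) ?_
      (Set.toFinite _)).trans
      ((Set.ncard_insert_le _ _).trans (by rw [Set.ncard_singleton]))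
    intro i hi
    simp only [Set.mem_ofPred_eq, Set.mem_iUnion, exists_prop] at hi
    obtain ⟨j, rfl, hj⟩ := hi
    exact hmem s j hj

theorem coveringDimLE_circle : CoveringDimLE Circle 1 :=
  coveringDimLE_addCircle.of_homeomorph (AddCircle.homeomorphCircle one_ne_zero)

/-! ### Topological discs in the plane -/

/-- Compact convex sets with non-empty interior, and their boundaries. -/
theorem exists_homeomorph_closedBall {s : Set ℂ} (hs : IsClosed s) (hc : Convex ℝ s)
    (hne : (interior s).Nonempty) (hb : Bornology.IsBounded s) :
    ∃ e : ℂ ≃ₜ ℂ, e '' s = Metric.closedBall 0 1 ∧ e '' frontier s = Metric.sphere 0 1 := by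
  obtain ⟨e, -, h2, h3⟩ := exists_homeomorph_image_interior_closure_frontier_eq_unitBall hc hne hb
  rw [hs.closure_eq] at h2
  exact ⟨e, h2, h3⟩

section Disc

variable {S : Set ℂ} (e : ℂ ≃ₜ ℂ)

theorem nonempty_homeomorph_of_image_eq (h1 : e '' S = Metric.closedBall 0 1) :
    Nonempty (S ≃ₜ Metric.closedBall (0 : ℂ) 1) :=
  ⟨(e.image S).trans (Homeomorph.setCongr h1)⟩

theorem nonempty_homeomorph_circle (h : e '' S = Metric.sphere 0 1) :
    Nonempty (Circle ≃ₜ S) := by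
  refine ⟨((e.image S).trans (Homeomorph.setCongr (h.trans ?_))).symm⟩
  rfl

theorem isSimpleClosedCurve_of_homeomorph (e : Circle ≃ₜ S) : IsSimpleClosedCurve S :=
  ⟨fun z => e z, continuous_subtype_val.comp e.continuous,
    Subtype.val_injective.comp e.injective, by
      change Set.range (Subtype.val ∘ e) = S
      rw [Set.range_comp, e.surjective.range_eq, Set.image_univ, Subtype.range_coe]⟩

end Disc

/-! ### Uniqueness of attractors -/

/-- A set contained in the union of its images under contractions `z ↦ a i * z + b i` is contained
in every non-empty closed set that contains its images. -/
theorem subset_of_contractions {ι : Type*} {a b : ι → ℂ} {ρ : ℝ} (hρ0 : 0 ≤ ρ) (hρ : ρ < 1)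
    (ha : ∀ i, ‖a i‖ ≤ ρ) {K K' : Set ℂ} (hK : IsCompact K) (hK' : IsCompact K')
    (hne : K'.Nonempty) (h : ∀ x ∈ K, ∃ i, ∃ y ∈ K, x = a i * y + b i)
    (h' : ∀ i, ∀ y ∈ K', a i * y + b i ∈ K') : K ⊆ K' := by
  obtain ⟨D, hD⟩ := (hK.isBounded.union hK'.isBounded).exists_norm_le
  obtain ⟨y₀, hy₀⟩ := hne
  -- Following addresses for n levels in K and applying the same maps to points of K' brings every
  -- point of K within a multiple of ρⁿ of K'.
  have key : ∀ n : ℕ, ∀ x ∈ K, ∃ y ∈ K', ‖x - y‖ ≤ 2 * D * ρ ^ n := by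
    intro n
    induction n with
    | zero =>
      intro x hx
      refine ⟨y₀, hy₀, (norm_sub_le _ _).trans ?_⟩
      linarith [hD x (.inl hx), hD y₀ (.inr hy₀)]
    | succ n ih =>
      intro x hx
      obtain ⟨i, x', hx', rfl⟩ := h x hx
      obtain ⟨y, hy, hxy⟩ := ih x' hx'
      refine ⟨_, h' i y hy, ?_⟩
      rw [add_sub_add_right_eq_sub, ← mul_sub, norm_mul]
      calc ‖a i‖ * ‖x' - y‖ ≤ ρ * (2 * D * ρ ^ n) :=
            mul_le_mul (ha i) hxy (norm_nonneg _) hρ0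
        _ = 2 * D * ρ ^ (n + 1) := by ring
  intro x hx
  rw [← hK'.isClosed.closure_eq, Metric.mem_closure_iff]
  intro ε hε
  have hlim : Filter.Tendsto (fun n : ℕ => 2 * D * ρ ^ n) Filter.atTop (nhds 0) := by
    simpa using (tendsto_pow_atTop_nhds_zero_of_lt_one hρ0 hρ).const_mul (2 * D)
  obtain ⟨n, hn⟩ := (hlim.eventually_lt_const hε).exists
  obtain ⟨y, hy, hxy⟩ := key n x hx
  exact ⟨y, hy, by rw [dist_eq_norm]; linarith⟩

/-! ### The iterated function system -/

namespace IsWindowSystem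

variable {β : ℂ} {A B C : Set ℂ}

/-- The first two pieces of B together are the equation of A, translated by β² − β; the third is
resolved by the equation of C. So A determines the system and solves a single equation. -/
theorem eq_B' (S : IsWindowSystem β A B C) :
    B = (fun z => z + (β ^ 2 - β)) '' A ∪ (fun z => β ^ 2 * z + β ^ 3) '' A := by
  have h1 : (fun z => β * z + β ^ 2 - β) '' A ∪ (fun z => β * z + β ^ 2 - β) '' B =
      (fun z => z + (β ^ 2 - β)) '' A := by
    conv_rhs => rw [S.eq_A]
    rw [Set.image_union, Set.image_image, Set.image_image]
    simp only [add_sub_assoc]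
  conv_lhs => rw [S.eq_B, h1, S.eq_C, Set.image_image]
  congr 1
  exact Set.image_congr fun z _ => by ring

theorem eq_A' (S : IsWindowSystem β A B C) :
    A = (fun z => β * z) '' A ∪ ((fun z => β * z + (β ^ 3 - β ^ 2)) '' A ∪
      (fun z => β ^ 3 * z + β ^ 4) '' A) := by
  conv_lhs => rw [S.eq_A, S.eq_B', Set.image_union, Set.image_image, Set.image_image]
  congr 2 <;> exact Set.image_congr fun z _ => by ring

theorem subset (hβ : β ^ 3 - 2 * β ^ 2 - 1 = 0) (hi : β.im ≠ 0) {A' B' C' : Set ℂ}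
    (S : IsWindowSystem β A B C) (S' : IsWindowSystem β A' B' C') : A ⊆ A' := by
  have h0 := norm_nonneg β
  have h1 := WindowRoot.norm_lt_one hβ hi
  refine subset_of_contractions (ι := Fin 3) (a := ![β, β, β ^ 3])
    (b := ![0, β ^ 3 - β ^ 2, β ^ 4]) h0 h1 ?_ S.compact_A S'.compact_A S'.nonempty_A ?_ ?_
  · intro i
    have h3 : ‖β‖ ^ 3 ≤ ‖β‖ := by nlinarith [sq_nonneg ‖β‖]
    fin_cases i <;> simp only [Matrix.cons_val, norm_pow, Fin.reduceFinMk] <;>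
      first | exact le_rfl | exact h3
  · intro x hx
    rw [S.eq_A'] at hx
    rcases hx with ⟨y, hy, rfl⟩ | ⟨y, hy, rfl⟩ | ⟨y, hy, rfl⟩
    · exact ⟨0, y, hy, by simp⟩
    · exact ⟨1, y, hy, by simp⟩
    · exact ⟨2, y, hy, by simp⟩
  · intro i y hy
    rw [S'.eq_A']
    fin_cases i
    · exact .inl ⟨y, hy, by simp⟩
    · exact .inr (.inl ⟨y, hy, by simp⟩)
    · exact .inr (.inr ⟨y, hy, by simp⟩)

theorem unique (hβ : β ^ 3 - 2 * β ^ 2 - 1 = 0) (hi : β.im ≠ 0) {A' B' C' : Set ℂ}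
    (S : IsWindowSystem β A B C) (S' : IsWindowSystem β A' B' C') :
    A = A' ∧ B = B' ∧ C = C' := by
  obtain rfl : A = A' := (S.subset hβ hi S').antisymm (S'.subset hβ hi S)
  exact ⟨rfl, S.eq_B'.trans S'.eq_B'.symm, S.eq_C.trans S'.eq_C.symm⟩

end IsWindowSystem

namespace IsTile

variable {β : ℂ} {q : ℝ → ℂ} {h : ℂ → ℂ}

theorem image_Sq (H : IsTile β q h) : h '' Model.Sq =
    (fun z => β * z - (1 + β ^ 2) / 2) '' (h '' Model.Sq) ∪
      ((fun z => β * z + (1 + β ^ 2) / 2) '' (h '' Model.Sq) ∪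
        (fun z => β ^ 3 * z) '' (h '' Model.Sq)) := by
  apply Set.Subset.antisymm
  · rintro _ ⟨p, hp, rfl⟩
    obtain ⟨a, ha, rfl | rfl | rfl⟩ := Model.exists_preimage hp
    · exact .inl ⟨_, ⟨a, ha, rfl⟩, (H.gm a ha).symm⟩
    · exact .inr (.inl ⟨_, ⟨a, ha, rfl⟩, (H.gp ha).symm⟩)
    · exact .inr (.inr ⟨_, ⟨a, ha, rfl⟩, (H.gz a ha).symm⟩)
  · rintro _ (⟨_, ⟨a, ha, rfl⟩, rfl⟩ | ⟨_, ⟨a, ha, rfl⟩, rfl⟩ | ⟨_, ⟨a, ha, rfl⟩, rfl⟩)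
    · exact ⟨_, (Model.gm_mem ha).1, H.gm a ha⟩
    · exact ⟨_, (Model.gp_mem ha).1, H.gp ha⟩
    · exact ⟨_, (Model.gz_mem ha).1, H.gz a ha⟩

theorem image_Win (H : IsTile β q h) : h '' Model.Win =
    (fun z => β * z - (1 + β ^ 2) / 2) '' (h '' Model.Sq) ∪
      (fun z => β ^ 3 * z) '' (h '' Model.Sq) := by
  rw [← Model.image_gm_union_image_gz, Set.image_union]
  simp only [Set.image_image]
  exact congrArg₂ _ (Set.image_congr fun a ha => H.gm a ha) (Set.image_congr fun a ha => H.gz a ha)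

/-- The solution of the iterated function system. -/
theorem isWindowSystem (hβ : β ^ 3 - 2 * β ^ 2 - 1 = 0) (H : IsTile β q h) :
    IsWindowSystem β ((fun z => z - β ^ 2 / 2) '' (h '' Model.Sq))
      ((fun z => z + (β ^ 2 / 2 - β)) '' (h '' Model.Sq) ∪
        (fun z => β ^ 2 * z - β / 2) '' (h '' Model.Sq))
      ((fun z => β * z - 1 / 2) '' (h '' Model.Sq)) := by
  have hne : (h '' Model.Sq).Nonempty := ⟨h 0, 0, by simp [Model.Sq], rfl⟩
  have hcomp : IsCompact (h '' Model.Sq) := Model.isCompact_Sq.image H.continuous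
  have hD := H.image_Sq
  generalize h '' Model.Sq = D at *
  have hA : (fun z => z - β ^ 2 / 2) '' D = (fun z => β * z) '' ((fun z => z - β ^ 2 / 2) '' D) ∪
      (fun z => β * z) '' ((fun z => z + (β ^ 2 / 2 - β)) '' D ∪
        (fun z => β ^ 2 * z - β / 2) '' D) := by
    conv_lhs => rw [hD]
    simp only [Set.image_union, Set.image_image]
    refine congrArg₂ _ ?_ (congrArg₂ _ ?_ ?_) <;> refine Set.image_congr fun z _ => ?_
    · linear_combination hβ / 2
    · linear_combination -hβ / 2
    · ring
  refine ⟨hne.image _, (hne.image _).inl, hne.image _, hcomp.image (by fun_prop),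
    (hcomp.image (by fun_prop)).union (hcomp.image (by fun_prop)), hcomp.image (by fun_prop), hA,
    ?_, ?_⟩
  · have h1 : ∀ s t : Set ℂ, (fun z => β * z + β ^ 2 - β) '' s ∪
        (fun z => β * z + β ^ 2 - β) '' t =
          (fun z => z + (β ^ 2 - β)) '' ((fun z => β * z) '' s ∪ (fun z => β * z) '' t) := by
      intro s t
      rw [Set.image_union, Set.image_image, Set.image_image]
      simp only [add_sub_assoc]
    rw [h1, ← hA, Set.image_image, Set.image_image]
    refine congrArg₂ _ ?_ ?_ <;> refine Set.image_congr fun z _ => ?_ <;> ring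
  · rw [Set.image_image]
    refine Set.image_congr fun z _ => ?_
    linear_combination hβ / 2

/-- Dividing by β² turns the left piece of D into β⁻¹D, whose subdivision consists of A and the two
parts of B, and the middle piece β³D into a translate of C. -/
theorem union_eq (hβ : β ^ 3 - 2 * β ^ 2 - 1 = 0) (H : IsTile β q h) :
    (fun z => z - β ^ 2 / 2) '' (h '' Model.Sq) ∪
      ((fun z => z + (β ^ 2 / 2 - β)) '' (h '' Model.Sq) ∪
        (fun z => β ^ 2 * z - β / 2) '' (h '' Model.Sq)) ∪
      ((fun z => β * z - 1 / 2) '' (h '' Model.Sq)) =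
    (fun z => (β ^ 2)⁻¹ * z - 1 / 2) '' (h '' Model.Win) := by
  have h0 := WindowRoot.ne_zero hβ
  have hinv : (β ^ 2)⁻¹ * β ^ 2 = 1 := inv_mul_cancel₀ (pow_ne_zero 2 h0)
  rw [H.image_Win]
  have hD := H.image_Sq
  generalize h '' Model.Sq = D at *
  rw [Set.image_union, Set.image_image, Set.image_image]
  refine congrArg₂ _ ?_ ?_
  · conv_rhs => rw [hD]
    simp only [Set.image_union, Set.image_image]
    refine congrArg₂ _ ?_ (congrArg₂ _ ?_ ?_) <;> refine Set.image_congr fun z _ => ?_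
    · linear_combination (-(z - β ^ 2 / 2 + 1 / 2)) * hinv - (β ^ 2)⁻¹ * (β + 1) / 2 * hβ
    · linear_combination (-(z + β ^ 2 / 2 - β + 1 / 2)) * hinv - (β ^ 2)⁻¹ * (1 - β) / 2 * hβ
    · linear_combination (-(β ^ 2 * z - β / 2 + 1 / 2)) * hinv - (β ^ 2)⁻¹ / 2 * hβ
  · refine Set.image_congr fun z _ => ?_
    linear_combination (-β * z) * hinv

end IsTile

/-! ### The polygon that models the window -/

namespace Model

theorem isCompact_Win : IsCompact Win := isCompact_Sq.of_isClosed_subset isClosed_Win fun _ h => h.1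

theorem convex_Win : Convex ℝ Win := by
  rintro x ⟨⟨⟨x1, x2⟩, x3, x4⟩, x5, x6⟩ y ⟨⟨⟨y1, y2⟩, y3, y4⟩, y5, y6⟩ a b ha hb hab
  obtain rfl : b = 1 - a := by linarith
  refine ⟨⟨⟨?_, ?_⟩, ?_, ?_⟩, ?_, ?_⟩ <;> simp <;> nlinarith

theorem mem_interior_Win {p : ℂ} (h1 : -9 < p.re) (h2 : p.re < 1) (h3 : -9 < p.im)
    (h4 : p.im < 9) (h5 : 3 * p.re < 2 * p.im + 15) : p ∈ interior Win := by
  have hre := Complex.continuous_re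
  have him := Complex.continuous_im
  have hopen : IsOpen {p : ℂ | ((-9 < p.re ∧ p.re < 1) ∧ -9 < p.im ∧ p.im < 9) ∧
      3 * p.re < 2 * p.im + 15} :=
    (((isOpen_lt continuous_const hre).inter (isOpen_lt hre continuous_const)).inter
      ((isOpen_lt continuous_const him).inter (isOpen_lt him continuous_const))).inter
      (isOpen_lt (continuous_const.mul hre) ((continuous_const.mul him).add continuous_const))
  refine interior_maximal ?_ hopen ⟨⟨⟨h1, h2⟩, h3, h4⟩, h5⟩
  rintro z ⟨⟨⟨z1, z2⟩, z3, z4⟩, z5⟩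
  exact ⟨⟨⟨z1.le, by linarith⟩, z3.le, z4.le⟩, z2.le, z5.le⟩

theorem of_mem_interior_Win {p : ℂ} (hp : p ∈ interior Win) : -9 < p.re ∧ |p.im| < 9 := by
  have h1 : p ∈ interior {z : ℂ | -9 ≤ z.re} := interior_mono (fun z h => h.1.1.1) hp
  have h2 : p ∈ interior {z : ℂ | -9 ≤ z.im} := interior_mono (fun z h => h.1.2.1) hp
  have h3 : p ∈ interior {z : ℂ | z.im ≤ 9} := interior_mono (fun z h => h.1.2.2) hp
  rw [Complex.interior_setOfPred_le_re] at h1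
  rw [Complex.interior_setOfPred_le_im] at h2
  rw [Complex.interior_setOfPred_im_le] at h3
  exact ⟨h1, abs_lt.2 ⟨h2, h3⟩⟩

theorem left_mem_frontier_Win {y : ℝ} (hy : y ∈ Set.Icc (-9 : ℝ) 9) :
    (⟨-9, y⟩ : ℂ) ∈ frontier Win := by
  rw [isClosed_Win.frontier_eq]
  refine ⟨⟨⟨⟨le_rfl, by norm_num⟩, hy⟩, by norm_num, ?_⟩, fun h => ?_⟩
  · dsimp only; linarith [hy.1]
  · exact lt_irrefl _ (of_mem_interior_Win h).1

/-- The sides of the window. -/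
theorem of_mem_frontier_Win {p : ℂ} (hp : p ∈ frontier Win) : ∃ u ∈ Set.Icc (-9 : ℝ) 9,
    p = ⟨-9, u⟩ ∨ p = ⟨u, -9⟩ ∨ p = ⟨u, 9⟩ ∨ p = gz ⟨u, 9⟩ ∨ p = gz ⟨9, u⟩ := by
  rw [isClosed_Win.frontier_eq] at hp
  obtain ⟨⟨⟨⟨h1, h2⟩, h3, h4⟩, h5, h6⟩, h7⟩ := hp
  obtain ⟨x, y⟩ := p
  dsimp only at *
  rcases h1.eq_or_lt with rfl | h1
  · exact ⟨y, ⟨h3, h4⟩, .inl rfl⟩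
  rcases h3.eq_or_lt with rfl | h3
  · exact ⟨x, ⟨h1.le, h2⟩, .inr (.inl rfl)⟩
  rcases h4.eq_or_lt with rfl | h4
  · exact ⟨x, ⟨h1.le, h2⟩, .inr (.inr (.inl rfl))⟩
  rcases h5.eq_or_lt with rfl | h5
  · refine ⟨9 - 6 / 5 * (y + 6), ⟨by linarith, by linarith⟩, .inr (.inr (.inr (.inl ?_)))⟩
    apply Complex.ext <;> simp only [gz] <;> ring
  rcases h6.eq_or_lt with h6 | h6
  · refine ⟨9 * x, ⟨by linarith, by linarith⟩, .inr (.inr (.inr (.inr ?_)))⟩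
    apply Complex.ext <;> simp only [gz] <;> linarith
  · exact (h7 (mem_interior_Win h1 h5 h3 h4 h6)).elim

theorem nonempty_interior_Win : (interior Win).Nonempty :=
  ⟨0, mem_interior_Win (by simp) (by simp) (by simp) (by simp) (by simp)⟩

end Model

/-- The affine map that sends the image of the window to the union of the three attractors. -/
noncomputable def windowChart {β : ℂ} (h0 : β ≠ 0) : ℂ ≃ₜ ℂ where
  toFun z := (β ^ 2)⁻¹ * z - 1 / 2
  invFun z := β ^ 2 * (z + 1 / 2)
  left_inv z := by
    have := mul_inv_cancel₀ (pow_ne_zero 2 h0)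
    linear_combination z * this
  right_inv z := by
    have := mul_inv_cancel₀ (pow_ne_zero 2 h0)
    linear_combination (z + 1 / 2) * this
  continuous_toFun := by fun_prop
  continuous_invFun := by fun_prop

/-! ### Null boundary and lattice tiling of the window -/

namespace IsTile

variable {β : ℂ} {q : ℝ → ℂ} {h : ℂ → ℂ}

theorem injOn_arc (hβ : β ^ 3 - 2 * β ^ 2 - 1 = 0) (hi : β.im ≠ 0)
    (H : IsTile β q h) : Set.InjOn q (Set.Icc (-9) 9) := by
  intro u hu v hv e
  have i9 : (-9 : ℝ) ∈ Set.Icc (-9 : ℝ) 9 := by norm_num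
  have := H.eq_of_eq hβ hi (p := ⟨u, -9⟩) (p' := ⟨v, -9⟩) ⟨hu, i9⟩ ⟨hv, i9⟩ (by
    rw [H.bot u hu, H.bot v hv, e])
  exact congrArg Complex.re this

/-- The boundary of the window is mapped to a null set. -/
theorem volume_image_frontier (hβ : β ^ 3 - 2 * β ^ 2 - 1 = 0) (hi : β.im ≠ 0) (hq : IsArc β q)
    (H : IsTile β q h) (c b : ℂ) :
    MeasureTheory.volume ((fun p => c * h p + b) '' frontier Model.Win) = 0 := by
  set Q := q '' Set.Icc (-9) 9 with hQ
  have hnull : ∀ c b : ℂ, MeasureTheory.volume ((fun z => c * z + b) '' Q) = 0 := fun c b => by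
    rw [volume_image_mul_add, hq.volume_image hβ hi, mul_zero]
  have hall : ∀ c : Fin 5 → ℂ, ∀ b : Fin 5 → ℂ,
      MeasureTheory.volume (⋃ i, (fun z => c i * z + b i) '' Q) = 0 := fun c b =>
    MeasureTheory.measure_iUnion_null fun i => hnull _ _
  -- The five sides of the polygon are mapped to five similar copies of the arc, with the factors
  -- and translations listed here.
  refine MeasureTheory.measure_mono_null ?_ (hall
    ![c * β, c, c, c * β ^ 3, c * β ^ 4]
    ![c * (-(1 / 2)) + b, c * (-(β / 2)) + b, c * (β / 2) + b, c * (β ^ 4 / 2) + b,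
      c * (β ^ 3 / 2) + b])
  rintro _ ⟨p, hp, rfl⟩
  have i9 : (9 : ℝ) ∈ Set.Icc (-9 : ℝ) 9 := by norm_num
  obtain ⟨u, hu, hp⟩ := Model.of_mem_frontier_Win hp
  rw [Set.mem_iUnion]
  rcases hp with rfl | rfl | rfl | rfl | rfl
  · refine ⟨0, q u, ⟨u, hu, rfl⟩, ?_⟩
    simp only [Matrix.cons_val, H.left u hu]; ring
  · refine ⟨1, q u, ⟨u, hu, rfl⟩, ?_⟩
    simp only [Matrix.cons_val, H.bot u hu]; ring
  · refine ⟨2, q u, ⟨u, hu, rfl⟩, ?_⟩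
    simp only [Matrix.cons_val, H.top hq hu]; ring
  · refine ⟨3, q u, ⟨u, hu, rfl⟩, ?_⟩
    simp only [Matrix.cons_val, H.gz ⟨u, 9⟩ ⟨hu, i9⟩, H.top hq hu]; ring
  · refine ⟨4, q u, ⟨u, hu, rfl⟩, ?_⟩
    simp only [Matrix.cons_val, H.gz ⟨9, u⟩ ⟨i9, hu⟩, H.right hq hu]; ring

/-- The image of the window tiles the plane. -/
theorem isLatticeTiling (hβ : β ^ 3 - 2 * β ^ 2 - 1 = 0) (hi : β.im ≠ 0) (hq : IsArc β q)
    (H : IsTile β q h) {P : ℂ ≃ₜ ℂ}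
    (hP : ∀ p ∈ Model.Sq, ∀ a b : ℤ, P (p + 18 * (a + b * Complex.I)) = h p + (a + b * β))
    (hb : ∀ z, ‖P z - (z.re + z.im * β) / 18‖ ≤ 2) :
    IsLatticeTiling (P.trans (windowChart (WindowRoot.ne_zero hβ)) '' Model.Win) (1 - β)
      (β ^ 2 - 2 * β) := by
  have h0 := WindowRoot.ne_zero hβ
  have hPh : ∀ p ∈ Model.Win, P p = h p := fun p hp => by simpa using hP p hp.1 0 0
  set E := P.trans (windowChart h0) with hE
  have hEp : ∀ p ∈ Model.Win, β ^ 2 * (E p + 1 / 2) = h p := fun p hp => by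
    rw [← hPh p hp]
    exact (windowChart h0).symm_apply_apply (P p)
  have hinj : ∀ z w : ℂ, β ^ 2 * z = β ^ 2 * w → z = w := fun z w =>
    mul_left_cancel₀ (pow_ne_zero 2 h0)
  refine ⟨?_, ?_, ?_⟩
  · rw [LinearIndependent.pair_iff]
    intro s t e
    have hn := (WindowRoot.normSq_bounds hβ hi).1
    have hx := (WindowRoot.re_bounds hβ hi).2
    have hsq : β ^ 2 = 2 * β.re * β - ‖β‖ ^ 2 := by
      have h1 : β * (starRingEnd ℂ) β = ‖β‖ ^ 2 := Complex.mul_conj' β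
      have h2 : β + (starRingEnd ℂ) β = 2 * β.re := by
        rw [Complex.add_conj]; push_cast; ring
      linear_combination β * h2 - h1
    -- Multiplying the relation by β turns the second vector into β³ − 2β² = 1, so coordinates in
    -- the basis 1, β suffice.
    simp only [Complex.real_smul] at e
    obtain ⟨e1, e2⟩ := WindowRoot.linearIndependent_coords hi (a := s * ‖β‖ ^ 2 + t)
      (b := s * (1 - 2 * β.re)) (by
        push_cast
        linear_combination β * e - t * hβ + s * hsq)
    obtain rfl : s = 0 := by
      rcases mul_eq_zero.1 e2 with e2 | e2
      · exact e2
      · linarith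
    exact ⟨rfl, by linarith⟩
  · intro z
    -- Multiplication by β² takes 1 − β to −(1 + β²) and β² − 2β to β; hence the sign of k in the
    -- lattice vector.
    obtain ⟨a, k, p, hp, e⟩ := exists_mem_window hβ hi hb hq H hP (β ^ 2 * (z + 1 / 2))
    refine ⟨((-k : ℤ) : ℤ) • (1 - β) + a • (β ^ 2 - 2 * β),
      Submodule.mem_span_pair.2 ⟨-k, a, rfl⟩, E p, ⟨p, hp, rfl⟩, hinj _ _ ?_⟩
    have := hEp p hp
    simp only [zsmul_eq_mul]
    push_cast
    linear_combination this - e + (k + a * β) * hβ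
  · intro s hs t ht hst
    obtain ⟨s₁, s₂, rfl⟩ := Submodule.mem_span_pair.1 hs
    obtain ⟨t₁, t₂, rfl⟩ := Submodule.mem_span_pair.1 ht
    have hint : ∀ w : ℂ, interior ((fun x => w + x) '' (E '' Model.Win)) =
        (fun x => w + x) '' (E '' interior Model.Win) := fun w => by
      rw [E.image_interior]
      exact ((Homeomorph.addLeft w).image_interior _).symm
    rw [hint, hint, Set.disjoint_left]
    rintro _ ⟨_, ⟨p, hp, rfl⟩, rfl⟩ ⟨_, ⟨p', hp', rfl⟩, e⟩
    have hpW := interior_subset hp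
    have hpW' := interior_subset hp'
    have e1 := hEp p hpW
    have e2 := hEp p' hpW'
    simp only [zsmul_eq_mul] at e
    obtain ⟨h1, h2⟩ := eq_zero_of_mem_window hβ hi hb hq H hP hpW hpW'
      (Model.of_mem_interior_Win hp).1 (Model.of_mem_interior_Win hp').1
      (Model.of_mem_interior_Win hp).2 (Model.of_mem_interior_Win hp').2
      (a := t₂ - s₂) (k := s₁ - t₁) (by
        push_cast
        rw [← e1, ← e2]
        linear_combination -β ^ 2 * e + ((s₁ - t₁) - (s₂ - t₂) * β) * hβ)
    obtain rfl : t₂ = s₂ := by omega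
    obtain rfl : s₁ = t₁ := by omega
    exact hst rfl

end IsTile

/-! ### The main theorem -/

theorem mainTheorem6 (β : ℂ) (hβ : β ^ 3 - 2 * β ^ 2 - 1 = 0) (hβ_im : β.im ≠ 0) :
    (∃! Ω : Set ℂ × Set ℂ × Set ℂ, IsWindowSystem β Ω.1 Ω.2.1 Ω.2.2) ∧
    ∀ A B C Ω : Set ℂ, IsWindowSystem β A B C → Ω = A ∪ B ∪ C →
      IsCompact Ω ∧
      Nonempty (Ω ≃ₜ Metric.closedBall (0 : ℂ) 1) ∧
      0 < MeasureTheory.volume Ω ∧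
      IsFractal (frontier Ω) ∧
      MeasureTheory.volume (frontier Ω) = 0 ∧
      IsSimpleClosedCurve (frontier Ω) ∧
      IsLatticeTiling Ω (1 - β) (β ^ 2 - 2 * β) := by
  have h0 := WindowRoot.ne_zero hβ
  obtain ⟨q, hq⟩ := exists_isArc hβ hβ_im
  obtain ⟨h, H⟩ := exists_isTile hβ hβ_im hq
  have S := H.isWindowSystem hβ
  refine ⟨⟨⟨_, _, _⟩, S, ?_⟩, ?_⟩
  · rintro ⟨A, B, C⟩ S'
    obtain ⟨h1, h2, h3⟩ := S'.unique hβ hβ_im S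
    exact Prod.ext h1 (Prod.ext h2 h3)
  rintro A B C Ω S' rfl
  obtain ⟨P, hP, hb⟩ := H.exists_plane hβ hβ_im hq
  have hPh : ∀ p ∈ Model.Win, P p = h p := fun p hp => by simpa using hP p hp.1 0 0
  obtain ⟨hA, hB, hC⟩ := S'.unique hβ hβ_im S
  set E := P.trans (windowChart h0) with hE
  have hEh : ∀ p ∈ Model.Win, E p = (β ^ 2)⁻¹ * h p - 1 / 2 := fun p hp => by
    rw [← hPh p hp]
    rfl
  have hΩ : A ∪ B ∪ C = E '' Model.Win := by
    rw [hA, hB, hC, H.union_eq hβ, Set.image_image]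
    exact Set.image_congr fun p hp => (hEh p hp).symm
  have hfr : frontier (A ∪ B ∪ C) = E '' frontier Model.Win := by
    rw [hΩ, E.image_frontier]
  have hfW : frontier Model.Win ⊆ Model.Win := Model.isClosed_Win.frontier_subset
  obtain ⟨e, he1, he2⟩ := exists_homeomorph_closedBall Model.isClosed_Win Model.convex_Win
    Model.nonempty_interior_Win Model.isCompact_Win.isBounded
  have hdisc : (E.symm.trans e) '' (A ∪ B ∪ C) = Metric.closedBall 0 1 := by
    rw [hΩ, ← he1, Set.image_image]
    exact Set.image_congr fun p _ => congrArg e (E.symm_apply_apply p)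
  have hcirc : (E.symm.trans e) '' frontier (A ∪ B ∪ C) = Metric.sphere 0 1 := by
    rw [hfr, ← he2, Set.image_image]
    exact Set.image_congr fun p _ => congrArg e (E.symm_apply_apply p)
  obtain ⟨φ⟩ := nonempty_homeomorph_circle _ hcirc
  refine ⟨?_, nonempty_homeomorph_of_image_eq _ hdisc, ?_, ⟨1, coveringDimLE_circle.of_homeomorph φ,
    ?_⟩, ?_, isSimpleClosedCurve_of_homeomorph φ, ?_⟩
  · rw [hΩ]
    exact Model.isCompact_Win.image E.continuous
  · rw [hΩ]
    refine MeasureTheory.Measure.measure_pos_of_nonempty_interior _ ?_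
    rw [← E.image_interior]
    exact Model.nonempty_interior_Win.image _
  · rw [hfr, Nat.cast_one]
    -- The left side of the polygon alone, mapped to a similar copy of the arc, makes the dimension
    -- of the boundary greater than 1.
    refine (hq.one_lt_dimH_image hβ hβ_im (H.injOn_arc hβ hβ_im) (a := (β ^ 2)⁻¹ * β)
      (b := (β ^ 2)⁻¹ * -(1 / 2) - 1 / 2)
      (mul_ne_zero (inv_ne_zero (pow_ne_zero 2 h0)) h0)).trans_le (dimH_mono ?_)
    rintro _ ⟨u, hu, rfl⟩
    have hL := Model.left_mem_frontier_Win hu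
    refine ⟨_, hL, ?_⟩
    rw [hEh _ (hfW hL), H.left u hu]
    ring
  · rw [hfr, Set.image_congr (g := fun p => (β ^ 2)⁻¹ * h p + -(1 / 2)) fun p hp => by
      rw [hEh p (hfW hp), sub_eq_add_neg]]
    exact H.volume_image_frontier hβ hβ_im hq _ _
  · rw [hΩ]
    exact H.isLatticeTiling hβ hβ_im hq hP hb
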